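/- Let $X$ be a complete connected Riemannian manifold of dimension $\nu$ and of bounded geometry: its injectivity radius is strictly positive, and the covariant derivatives of every order of its Riemann curvature tensor are bounded. Let $d$ be the geodesic distance, $B(x,r)$ the open balls, $D=\{(x,x):x\in X\}$ the diagonal, and $dx$ the Riemannian measure; $L^p$ and $\|\cdot\|_p$ refer to $dx$. For $0\le\alpha<\nu$ and $1\le p\le\infty$ let $\mathcal K(\alpha,p)$ be the class of measurable kernels $K$ with measurable sections $K(x,\cdot)$, $K(\cdot,y)$, complex valued, defined everywhere on $(X\times X)\setminus D$ if $\alpha>0$ and everywhere on $X\times X$ if $\alpha=0$, such that * (L1) for a constant $c>0$, $|K(x,y)|\le c\max(1,d(x,y)^{-\alpha})$ for all $(x,y)\in(X\times X)\setminus D$ if $\alpha>0$, and $|K(x,y)|\le c$ for all $x,y\in X$ if $\alpha=0$; * (L2) for every $r>0$, $\lfloor K\rfloor_{p,r}:=\max\Big(\sup_{x\in X}\|\chi_{X\setminus B(x,r)}K(x,\cdot)\|_p,\ \sup_{y\in X}\|\chi_{X\setminus B(y,r)}K(\cdot,y)\|_p\Big)<\infty$. Let $\mathcal K_0(\alpha,p)$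 be the class of all $K\in\mathcal K(\alpha,p)$ with $\lim_{r\to\infty}\lfloor K\rfloor_{p,r}=0$. **Lemma.** Let $K_j\in\mathcal K(\alpha_j,q_j)$, $j=1,2$, and $W=\sum_{k=1}^nW_k$ with $n\ge1$ and $W_k\in L^{p_k}(X)$. Put $p_{\min}=\min_kp_k$, $p_{\max}=\max_kp_k$, and let $p_k'$ be the exponent conjugate to $p_k$. Suppose that * (a) $\dfrac1{p_{\max}}+\dfrac1{q_1}+\dfrac1{q_2}=1$; * (b) $p_{\min}\ge1$ if $\alpha_1=\alpha_2=0$, and $p_{\min}>\nu/(\nu-\max(\alpha_1,\alpha_2))$ otherwise. Let $F(x,y,z)=K_1(x,z)W(z)K_2(z,y)$. Then the following assertions hold. 1. $F(x,y,\cdot)\in L^1(X)$ for $x\ne y$; hence $J(x,y)=\int_XF(x,y,z)\,dz$ is well defined on $(X\times X)\setminus D$. 2. Let $\alpha=\max\big(0,\ \alpha_1+\alpha_2-\nu/p_1',\ \dots,\ \alpha_1+\alpha_2-\nu/p_n'\big)$. If $p_k'(\alpha_1+\alpha_2)\ne\nu$ for all $k$ (where $\infty\cdot0=0$), then $J\in\mathcal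 K(\alpha,\infty)$; in particular, if moreover $\alpha=0$, then $F(x,y,\cdot)\in L^1(X)$ for all $x,y\in X$. If $p_k'(\alpha_1+\alpha_2)=\nu$ for some $k$, then $J\in\mathcal K(\alpha,\infty)$ if $\alpha>0$, and $J\in\mathcal K(\beta,\infty)$ for every $\beta$ with $0<\beta<\nu$ if $\alpha=0$. 3. Suppose that $p_{\max}<\infty$, or that $K_1\in\mathcal K_0(\alpha_1,q_1)$, or that $K_2\in\mathcal K_0(\alpha_2,q_2)$. * (3a) If $K_1(\cdot,z)$ is continuous in $X\setminus\{z\}$ for a.e. $z$, then $J(\cdot,y)$ is continuous in $X\setminus\{y\}$ for all $y\in X$. * (3b) If $K_2(z,\cdot)$ is continuous in $X\setminus\{z\}$ for a.e. $z$, then $J(x,\cdot)$ is continuous in $X\setminus\{x\}$ for all $x\in X$. * (3c) If $K_1(\cdot,z)$ and $K_2(z,\cdot)$ are continuous in $X\setminus\{z\}$ for a.e. $z$, then $J$ is continuous in $(X\times X)\setminus D$. 4. Suppose that $\alpha_1+\alpha_2<\nu$ and, if $\alpha_1+\alpha_2\ne0$, that for some $q>\nu/(\nu-\alpha_1-\alpha_2)$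 all $W_k$ belong to $L^q_{\rm loc}(X)$. Then $F(x,y,\cdot)\in L^1(X)$ for all $x,y\in X$, so that $J$ is well defined on $X\times X$. If, in addition, $p_{\max}<\infty$ or $K_1\in\mathcal K_0(\alpha_1,q_1)$ or $K_2\in\mathcal K_0(\alpha_2,q_2)$, then * (4a) if $K_1(\cdot,z)$ is continuous in $X\setminus\{z\}$ for a.e. $z$, then $J(\cdot,y)$ is continuous in $X$ for all $y\in X$; * (4b) if $K_2(z,\cdot)$ is continuous in $X\setminus\{z\}$ for a.e. $z$, then $J(x,\cdot)$ is continuous in $X$ for all $x\in X$; * (4c) if $K_1(\cdot,z)$ and $K_2(z,\cdot)$ are continuous in $X\setminus\{z\}$ for a.e. $z$, then $J$ is continuous in $X\times X$. -/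

import Mathlib

open MeasureTheory Set Filter Topology Metric Bundle
open scoped ENNReal Manifold ContDiff

noncomputable section

/-! ### Riemannian geometry in charts

`X` is a smooth manifold modelled on `ℝ^ν`, with a Riemannian metric given by inner products on
the tangent spaces. Tensors are written in components with respect to a smooth chart `φ` of `X`;
all components are functions on the open set `φ.target` of `ℝ^ν`. -/

section Charts

variable {ν : ℕ} {X : Type*} [TopologicalSpace X]
  [ChartedSpace (EuclideanSpace ℝ (Fin ν)) X]

/-- The coordinate vector field `∂ᵢ` of the chart `φ`, at the point with coordinates `u`. -/
def coordVector (φ : OpenPartialHomeomorph X (EuclideanSpace ℝ (Fin ν))) (i : Fin ν)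
    (u : EuclideanSpace ℝ (Fin ν)) : TangentSpace (𝓡 ν) (φ.symm u) :=
  mfderiv (𝓡 ν) (𝓡 ν) φ.symm u (EuclideanSpace.single i (1 : ℝ))

/-- The partial derivative `∂ᵢ f` of a function on `ℝ^ν`. -/
def partialDeriv (i : Fin ν) (f : EuclideanSpace ℝ (Fin ν) → ℝ)
    (u : EuclideanSpace ℝ (Fin ν)) : ℝ :=
  fderiv ℝ f u (EuclideanSpace.single i (1 : ℝ))

variable [RiemannianBundle (fun x : X => TangentSpace (𝓡 ν) x)]

/-- The matrix `(g_{ij})` of the Riemannian metric in the chart `φ`. -/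
def metricMatrix (φ : OpenPartialHomeomorph X (EuclideanSpace ℝ (Fin ν)))
    (u : EuclideanSpace ℝ (Fin ν)) : Matrix (Fin ν) (Fin ν) ℝ :=
  Matrix.of fun i j => inner ℝ (coordVector φ i u) (coordVector φ j u)

/-- The Christoffel symbol `Γ^k_{ij}` of the Levi-Civita connection in the chart `φ`. -/
def christoffel (φ : OpenPartialHomeomorph X (EuclideanSpace ℝ (Fin ν))) (k i j : Fin ν)
    (u : EuclideanSpace ℝ (Fin ν)) : ℝ :=
  (1 / 2) * ∑ l, (metricMatrix φ u)⁻¹ k l *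
    (partialDeriv i (fun v => metricMatrix φ v j l) u
      + partialDeriv j (fun v => metricMatrix φ v i l) u
      - partialDeriv l (fun v => metricMatrix φ v i j) u)

/-- The components `R^l_{kij}` of the curvature, `R(∂ᵢ, ∂ⱼ) ∂ₖ = ∑ₗ R^l_{kij} ∂ₗ`. -/
def curvature (φ : OpenPartialHomeomorph X (EuclideanSpace ℝ (Fin ν))) (l k i j : Fin ν)
    (u : EuclideanSpace ℝ (Fin ν)) : ℝ :=
  partialDeriv i (christoffel φ l j k) u - partialDeriv j (christoffel φ l i k) u
    + ∑ m, (christoffel φ l i m u * christoffel φ m j k u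
      - christoffel φ l j m u * christoffel φ m i k u)

/-- The components `R_{lkij}` of the Riemann curvature tensor, with all indices lowered, as a
covariant tensor of rank four. -/
def riemannTensor (φ : OpenPartialHomeomorph X (EuclideanSpace ℝ (Fin ν)))
    (I : Fin 4 → Fin ν) (u : EuclideanSpace ℝ (Fin ν)) : ℝ :=
  ∑ m, metricMatrix φ u (I 0) m * curvature φ m (I 1) (I 2) (I 3) u

/-- The covariant derivative `∇T` of a covariant tensor `T` of rank `m`; the new index is the
first one:
`(∇T)_{i i₁ … iₘ} = ∂ᵢ T_{i₁ … iₘ} - ∑ₛ ∑ₗ Γ^l_{i iₛ} T_{i₁ … l … iₘ}`, with `l` in place `s`. -/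
def covDeriv (φ : OpenPartialHomeomorph X (EuclideanSpace ℝ (Fin ν))) {m : ℕ}
    (T : (Fin m → Fin ν) → EuclideanSpace ℝ (Fin ν) → ℝ)
    (I : Fin (m + 1) → Fin ν) (u : EuclideanSpace ℝ (Fin ν)) : ℝ :=
  partialDeriv (I 0) (T (Fin.tail I)) u
    - ∑ s : Fin m, ∑ l : Fin ν,
        christoffel φ l (I 0) (Fin.tail I s) u * T (Function.update (Fin.tail I) s l) u

/-- The `k`-th covariant derivative of the Riemann curvature tensor. -/
def riemannCovDeriv (φ : OpenPartialHomeomorph X (EuclideanSpace ℝ (Fin ν))) :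
    (k : ℕ) → (Fin (4 + k) → Fin ν) → EuclideanSpace ℝ (Fin ν) → ℝ
  | 0 => riemannTensor φ
  | k + 1 => covDeriv φ (riemannCovDeriv φ k)

/-- The square of the pointwise norm of a covariant tensor of rank `m` with respect to the
Riemannian metric: `∑ g^{i₁ j₁} ⋯ g^{iₘ jₘ} T_{i₁ … iₘ} T_{j₁ … jₘ}`. -/
def tensorNormSq (φ : OpenPartialHomeomorph X (EuclideanSpace ℝ (Fin ν))) {m : ℕ}
    (T : (Fin m → Fin ν) → EuclideanSpace ℝ (Fin ν) → ℝ)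
    (u : EuclideanSpace ℝ (Fin ν)) : ℝ :=
  ∑ I : Fin m → Fin ν, ∑ J : Fin m → Fin ν,
    (∏ s, (metricMatrix φ u)⁻¹ (I s) (J s)) * T I u * T J u

/-- `γ` is a smooth geodesic on the open set `s` of times: it satisfies the geodesic equation
`c''ₖ + ∑ Γ^k_{ij}(c) c'ᵢ c'ⱼ = 0`, where `c = φ ∘ γ`, in every smooth chart `φ`. -/
def IsGeodesicOn (γ : ℝ → X) (s : Set ℝ) : Prop :=
  ContMDiffOn 𝓘(ℝ, ℝ) (𝓡 ν) ∞ γ s ∧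
  ∀ φ ∈ IsManifold.maximalAtlas (𝓡 ν) ∞ X, ∀ t ∈ s, γ t ∈ φ.source → ∀ k : Fin ν,
    deriv (deriv fun τ => φ (γ τ) k) t
      + ∑ i, ∑ j, christoffel φ k i j (φ (γ t))
          * deriv (fun τ => φ (γ τ) i) t * deriv (fun τ => φ (γ τ) j) t = 0

/-- `μ = √(det g) du` in the chart `φ`, transported to the domain of `φ` in `X`. -/
def chartVolume [MeasurableSpace X]
    (φ : OpenPartialHomeomorph X (EuclideanSpace ℝ (Fin ν))) : Measure X :=
  Measure.map φ.symm ((volume.restrict φ.target).withDensity fun u =>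
    ENNReal.ofReal (Real.sqrt (metricMatrix φ u).det))

variable (ν X) in
/-- The Riemannian (Riemann–Lebesgue) measure of `X`: the least measure that dominates
`√(det g) du` in each smooth chart. As these measures agree on the overlaps of the charts, it is
the measure whose restriction to the domain of each chart is `√(det g) du`. -/
def riemannianVolume [MeasurableSpace X] : Measure X :=
  ⨆ φ ∈ IsManifold.maximalAtlas (𝓡 ν) ∞ X, chartVolume φ

end Charts

section BoundedGeometry

variable {ν : ℕ} {X : Type*} [MetricSpace X] [ChartedSpace (EuclideanSpace ℝ (Fin ν)) X]
  [RiemannianBundle (fun x : X => TangentSpace (𝓡 ν) x)]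

/-- `φ` is a system of geodesic normal coordinates at `a`, of radius `r`: it maps the metric ball
`B(a, r)` diffeomorphically onto the Euclidean ball `B(0, r)`, the coordinate frame at `a` is
orthonormal, and the rays `t ↦ φ⁻¹(t w)` are geodesics. In other words, if `T_a X` is identified
with `ℝ^ν` by that orthonormal frame, then `φ⁻¹` is the exponential map at `a`, and it is a
diffeomorphism of the ball of radius `r` in `T_a X` onto `B(a, r)`. -/
structure IsNormalChart (a : X) (r : ℝ)
    (φ : OpenPartialHomeomorph X (EuclideanSpace ℝ (Fin ν))) : Prop where
  mem_maximalAtlas : φ ∈ IsManifold.maximalAtlas (𝓡 ν) ∞ X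
  source_eq : φ.source = ball a r
  target_eq : φ.target = ball 0 r
  map_zero : φ.symm 0 = a
  metric_zero : metricMatrix φ 0 = 1
  geodesic : ∀ w : EuclideanSpace ℝ (Fin ν),
    IsGeodesicOn (ν := ν) (fun t : ℝ => φ.symm (t • w)) {t : ℝ | ‖t • w‖ < r}

variable (ν) in
/-- The injectivity radius at `a`: the supremum of the radii up to which the exponential map at
`a` is a diffeomorphism from the balls of `T_a X` onto the metric balls. -/
def injectivityRadius (a : X) : ℝ≥0∞ :=
  ⨆ (r : ℝ) (_ : ∀ s : ℝ, 0 < s → s ≤ r →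
    ∃ φ : OpenPartialHomeomorph X (EuclideanSpace ℝ (Fin ν)), IsNormalChart a s φ),
    ENNReal.ofReal r

variable (ν X) in
/-- Bounded geometry: the injectivity radius of `X` is positive, and the covariant derivatives of
every order of the Riemann curvature tensor are bounded. (The norm of a tensor at a point does
not depend on the chart.) -/
structure BoundedGeometry : Prop where
  injectivityRadius_pos : 0 < ⨅ a : X, injectivityRadius ν a
  curvature_bounded : ∀ k : ℕ, ∃ C : ℝ, ∀ φ ∈ IsManifold.maximalAtlas (𝓡 ν) ∞ X,
    ∀ u ∈ φ.target, tensorNormSq φ (riemannCovDeriv φ k) u ≤ C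

end BoundedGeometry

/-! ### Classes of kernels

Kernels are total functions of two variables; the values on the diagonal are irrelevant for
exponents `α > 0`. -/

section Kernels

variable {X : Type*} [MetricSpace X] [MeasurableSpace X]

/-- `⌊K⌋_{p,r}`, the larger one of the numbers `sup_x ‖χ_{X ∖ B(x,r)} K(x,·)‖_p` and
`sup_y ‖χ_{X ∖ B(y,r)} K(·,y)‖_p`. -/
def offDiagNorm (μ : Measure X) (K : X → X → ℂ) (p : ℝ≥0∞) (r : ℝ) : ℝ≥0∞ :=
  max (⨆ x, eLpNorm ((ball x r)ᶜ.indicator fun z => K x z) p μ)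
    (⨆ y, eLpNorm ((ball y r)ᶜ.indicator fun z => K z y) p μ)

/-- The class `𝒦(α, p)` of kernels on `X`, where `0 ≤ α < ν` and `1 ≤ p ≤ ∞`. Kernels, and their
sections, are measurable with respect to the completed measures. If `α > 0` the bound is required
off the diagonal only. -/
structure MemKernelClass (ν : ℕ) (μ : Measure X) (α : ℝ) (p : ℝ≥0∞) (K : X → X → ℂ) : Prop where
  exponent_nonneg : 0 ≤ α
  exponent_lt : α < ν
  one_le : 1 ≤ p
  aestronglyMeasurable : AEStronglyMeasurable (fun z : X × X => K z.1 z.2) (μ.prod μ)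
  aestronglyMeasurable_left : ∀ x, AEStronglyMeasurable (fun y => K x y) μ
  aestronglyMeasurable_right : ∀ y, AEStronglyMeasurable (fun x => K x y) μ
  bound : ∃ c : ℝ, 0 < c ∧ ∀ x y, (0 < α → x ≠ y) → ‖K x y‖ ≤ c * max 1 (dist x y ^ (-α))
  offDiagNorm_lt_top : ∀ r : ℝ, 0 < r → offDiagNorm μ K p r < ⊤

/-- The class `𝒦₀(α, p)`. -/
structure MemKernelClassZero (ν : ℕ) (μ : Measure X) (α : ℝ) (p : ℝ≥0∞) (K : X → X → ℂ) : Prop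
    extends MemKernelClass ν μ α p K where
  tendsto_offDiagNorm : Tendsto (fun r : ℝ => offDiagNorm μ K p r) atTop (𝓝 0)

/-- The function `F(x, y, z) = K₁(x, z) W(z) K₂(z, y)`. -/
def compIntegrand (K₁ K₂ : X → X → ℂ) (W : X → ℂ) (x y z : X) : ℂ :=
  K₁ x z * W z * K₂ z y

/-- The kernel `J(x, y) = ∫ F(x, y, z) dz`. -/
def compKernel (μ : Measure X) (K₁ K₂ : X → X → ℂ) (W : X → ℂ) (x y : X) : ℂ :=
  ∫ z, compIntegrand K₁ K₂ W x y z ∂μ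

end Kernels

end

/-!
The conditions on the exponents make `F(x, y, ·) = K₁(x, ·) W K₂(·, y)` a product to which
Hölder's inequality applies, with `W_k ∈ L^p` and `K₁(x, ·) K₂(·, y) ∈ L^s` for conjugate `p` and
`s`. Away from `x` and `y` the product of the kernels is bounded and lies in `L^m`,
`1 / m = 1 / q₁ + 1 / q₂`, hence in `L^s`, since condition (a) gives `m ≤ s`
(`MemKernelClass.exists_eLpNorm_far_le`). Near `x` and `y` it is dominated by
`d(x, z) ^ (-α₁) d(z, y) ^ (-α₂)`; condition (b) says `s α₁ < ν` and `s α₂ < ν`, and the `L^s` norm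
over balls of a fixed radius is of order `d(x, y) ^ (-γ)` with any `γ > 0`,
`γ ≥ α₁ + α₂ - ν / s`, or bounded if `s (α₁ + α₂) < ν`
(`UniformVolumeGrowth.exists_eLpNorm_near_le`). The sum of the two estimates is the bound of the
composition (`UniformVolumeGrowth.exists_lintegral_compIntegrand_le`).

All that these estimates use of the manifold is that the volume of balls of radius `r ≤ R` is at
most `C r ^ ν`, uniformly in the centre, that balls have finite volume, and that closed balls are
compact. The first fact follows from the bound of the curvature: in normal coordinates the
coordinate fields along a ray are Jacobi fields divided by the parameter, and Grönwall's argument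
for the energy `|J|² + |D J|²` bounds the metric by a constant that depends on the curvature bound
and on the radius only (`metricForm_le_exp`). The Riemannian measure of a ball is then at most
that of a Euclidean ball, up to a constant (`BoundedGeometry.exists_volume_ball_le`). The same
bound makes the inverses of the normal charts Lipschitz, so that small balls are totally bounded;
as `X` is a length space, so are all balls, and completeness gives compactness
(`BoundedGeometry.properSpace`).

For the continuity of `J` at `(x₀, y₀)`, the space is cut into three parts
(`tendsto_compKernel`). The integrals of `|F(x, y, ·)|` over small balls around `x₀` and `y₀` are
uniformly small, by Hölder's inequality with a finite exponent on `W_k`, whose `L^p` norm over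
small balls tends to zero (`LocallyControlled.eventually_lintegral_le`); off the diagonal, or under
the local integrability assumption of the last part, such an exponent exists. The integrals over
the complement of a set of finite measure are uniformly small, because `p_k < ∞` or because one of
the kernels belongs to `𝒦₀` (`UniformlySmallTails`). On the rest both kernels are bounded, and the
dominated convergence theorem applies.
-/

/-! ### Covariant tensors -/

/-- A frame that is orthonormal for `G`: the rows of `B` are the vectors of the frame, and `Q`
maps a vector to its coordinates in it. -/
theorem Matrix.PosDef.exists_inv_eq_transpose_mul_self {n : Type*} [Fintype n] [DecidableEq n]
    {G : Matrix n n ℝ} (hG : G.PosDef) :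
    ∃ B Q : Matrix n n ℝ, G⁻¹ = B.transpose * B ∧ G = Q.transpose * Q ∧
      B.transpose * Q = 1 := by
  obtain ⟨B, hB⟩ : ∃ B : Matrix n n ℝ, G⁻¹ = B.transpose * B := by
    open scoped MatrixOrder in
    obtain ⟨B, hB⟩ := CStarAlgebra.nonneg_iff_eq_star_mul_self.mp
      (Matrix.nonneg_iff_posSemidef.2 hG.inv.posSemidef)
    exact ⟨B, by
      rw [hB, Matrix.star_eq_conjTranspose, Matrix.conjTranspose_eq_transpose_of_trivial]⟩
  have hu : IsUnit G.det := (Matrix.isUnit_iff_isUnit_det _).1 hG.isUnit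
  have h1 : B.transpose * (B * G) = 1 := by
    rw [← Matrix.mul_assoc, ← hB, Matrix.nonsing_inv_mul _ hu]
  refine ⟨B, B * G, hB, ?_, h1⟩
  have hs : G.transpose = G := by
    have := hG.isHermitian
    rwa [Matrix.IsHermitian, Matrix.conjTranspose_eq_transpose_of_trivial] at this
  rw [Matrix.transpose_mul, hs, Matrix.mul_assoc, h1, Matrix.mul_one]

/-- The Cauchy–Schwarz inequality for covariant tensors: in a frame that is orthonormal for `G`
both sides become the Euclidean ones. -/
theorem tensor_apply_sq_le {n : Type*} [Fintype n] [DecidableEq n] {m : ℕ}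
    {G : Matrix n n ℝ} (hG : G.PosDef) (T : (Fin m → n) → ℝ) (a : Fin m → n → ℝ) :
    (∑ I : Fin m → n, T I * ∏ s, a s (I s)) ^ 2 ≤
      (∑ I : Fin m → n, ∑ J : Fin m → n, (∏ s, G⁻¹ (I s) (J s)) * T I * T J)
        * ∏ s, ∑ i, ∑ j, G i j * a s i * a s j := by
  obtain ⟨B, Q, hB, hQ, hBQ⟩ := hG.exists_inv_eq_transpose_mul_self
  set b : Fin m → n → ℝ := fun s => Q.mulVec (a s) with hb
  have ha : ∀ s i, a s i = ∑ A, B A i * b s A := by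
    intro s i
    have : a s = B.transpose.mulVec (b s) := by
      rw [hb, Matrix.mulVec_mulVec, hBQ, Matrix.one_mulVec]
    rw [this]
    simp [Matrix.mulVec, dotProduct]
  have h1 : ∀ s, ∑ i, ∑ j, G i j * a s i * a s j = ∑ A, b s A ^ 2 := by
    intro s
    have e1 : ∑ i, ∑ j, G i j * a s i * a s j = dotProduct (a s) (G.mulVec (a s)) := by
      simp only [dotProduct, Matrix.mulVec, Finset.mul_sum]
      exact Finset.sum_congr rfl fun i _ => Finset.sum_congr rfl fun j _ => by ring
    rw [e1, hQ, ← Matrix.mulVec_mulVec, Matrix.dotProduct_mulVec, Matrix.vecMul_transpose]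
    simp [hb, dotProduct, pow_two]
  set T' : (Fin m → n) → ℝ := fun A => ∑ I, T I * ∏ s, B (A s) (I s) with hT'
  have h2 : ∑ I : Fin m → n, T I * ∏ s, a s (I s) = ∑ A, T' A * ∏ s, b s (A s) := by
    simp only [hT', ha, Finset.prod_univ_sum, Fintype.piFinset_univ, Finset.mul_sum,
      Finset.sum_mul, Finset.prod_mul_distrib]
    rw [Finset.sum_comm]
    exact Finset.sum_congr rfl fun i _ => Finset.sum_congr rfl fun j _ => by ring
  have h3 : ∑ I : Fin m → n, ∑ J : Fin m → n, (∏ s, G⁻¹ (I s) (J s)) * T I * T J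
      = ∑ A, T' A ^ 2 := by
    have : ∀ i j, G⁻¹ i j = ∑ A, B A i * B A j := by
      intro i j
      rw [hB]; simp [Matrix.mul_apply]
    simp only [this, hT', Finset.prod_univ_sum, Fintype.piFinset_univ, Finset.sum_mul,
      Finset.prod_mul_distrib, pow_two, Finset.mul_sum]
    rw [Finset.sum_comm]
    conv_lhs => enter [2, x]; rw [Finset.sum_comm]
    rw [Finset.sum_comm]
    refine Finset.sum_congr rfl fun A _ => ?_
    rw [Finset.sum_comm]
    exact Finset.sum_congr rfl fun i _ => Finset.sum_congr rfl fun j _ => by ring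
  have h4 : ∏ s, ∑ i, ∑ j, G i j * a s i * a s j = ∑ A : Fin m → n, (∏ s, b s (A s)) ^ 2 := by
    simp only [h1, Finset.prod_univ_sum, Fintype.piFinset_univ, Finset.prod_pow]
  rw [h2, h3, h4]
  exact Finset.sum_mul_sq_le_sq_mul_sq _ _ _

theorem Fintype.sum_pi_fin_succ {n M : Type*} [Fintype n] [AddCommMonoid M] {m : ℕ}
    (F : (Fin (m + 1) → n) → M) :
    ∑ I, F I = ∑ i, ∑ I : Fin m → n, F (Fin.cons i I) := by
  rw [← Fintype.sum_prod_type' (f := fun i I => F (Fin.cons i I))]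
  exact (Fintype.sum_equiv (Fin.consEquiv fun _ => n) _ _ fun x => rfl).symm

/-! ### The metric in a chart -/

section ChartMetric

variable {ν : ℕ} {X : Type*} [TopologicalSpace X]
  [ChartedSpace (EuclideanSpace ℝ (Fin ν)) X]
  {φ : OpenPartialHomeomorph X (EuclideanSpace ℝ (Fin ν))}

theorem mdifferentiable_of_mem_maximalAtlas [IsManifold (𝓡 ν) ∞ X]
    (hφ : φ ∈ IsManifold.maximalAtlas (𝓡 ν) ∞ X) : φ.MDifferentiable (𝓡 ν) (𝓡 ν) :=
  ⟨(contMDiffOn_of_mem_maximalAtlas hφ).mdifferentiableOn (by simp),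
    (contMDiffOn_symm_of_mem_maximalAtlas hφ).mdifferentiableOn (by simp)⟩

variable [RiemannianBundle (fun x : X => TangentSpace (𝓡 ν) x)]

/-- The matrix of the metric represents the inner product of the images of coordinate vectors. -/
theorem sum_metricMatrix_mul (φ : OpenPartialHomeomorph X (EuclideanSpace ℝ (Fin ν)))
    (u a b : EuclideanSpace ℝ (Fin ν)) :
    ∑ i, ∑ j, metricMatrix φ u i j * a i * b j =
      inner ℝ (mfderiv (𝓡 ν) (𝓡 ν) φ.symm u a) (mfderiv (𝓡 ν) (𝓡 ν) φ.symm u b) := by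
  have key : ∀ a : EuclideanSpace ℝ (Fin ν), mfderiv (𝓡 ν) (𝓡 ν) φ.symm u a =
      ∑ i, a i • coordVector φ i u := by
    intro a
    have ha : a = ∑ i, a i • EuclideanSpace.single i (1 : ℝ) := by
      ext j
      simp [Finset.sum_apply, Pi.single_apply]
    conv_lhs => rw [ha]
    refine (map_sum (mfderiv (𝓡 ν) (𝓡 ν) φ.symm u) _ _).trans ?_
    refine Finset.sum_congr rfl fun i _ => ?_
    exact (mfderiv (𝓡 ν) (𝓡 ν) φ.symm u).map_smul _ _
  rw [key a, key b, sum_inner]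
  refine Finset.sum_congr rfl fun i _ => ?_
  rw [inner_sum]
  refine Finset.sum_congr rfl fun j _ => ?_
  rw [real_inner_smul_left, real_inner_smul_right, metricMatrix, Matrix.of_apply]
  ring

theorem metricMatrix_comm (φ : OpenPartialHomeomorph X (EuclideanSpace ℝ (Fin ν)))
    (u : EuclideanSpace ℝ (Fin ν)) (i j : Fin ν) :
    metricMatrix φ u i j = metricMatrix φ u j i := by
  simp only [metricMatrix, Matrix.of_apply]
  exact real_inner_comm _ _

theorem metricMatrix_posDef [IsManifold (𝓡 ν) ∞ X]
    (hφ : φ ∈ IsManifold.maximalAtlas (𝓡 ν) ∞ X) {u : EuclideanSpace ℝ (Fin ν)}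
    (hu : u ∈ φ.target) : (metricMatrix φ u).PosDef := by
  refine Matrix.PosDef.of_dotProduct_mulVec_pos ?_ ?_
  · ext i j
    simp [metricMatrix_comm φ u j i]
  · intro x hx
    have h := sum_metricMatrix_mul φ u (WithLp.toLp 2 x) (WithLp.toLp 2 x)
    have e : star x ⬝ᵥ (metricMatrix φ u).mulVec x =
        ∑ i, ∑ j, metricMatrix φ u i j * x i * x j := by
      simp only [dotProduct, Matrix.mulVec, Finset.mul_sum]
      exact Finset.sum_congr rfl fun i _ => Finset.sum_congr rfl fun j _ => by
        simp; ring
    rw [e]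
    simp only [] at h
    rw [h]
    refine real_inner_self_pos.2 fun h0 => hx ?_
    have hinj := (mdifferentiable_of_mem_maximalAtlas hφ).symm.mfderiv_injective
      (x := u) (by simpa using hu)
    have := hinj (h0.trans (map_zero _).symm)
    exact congrArg WithLp.ofLp this

theorem contDiffOn_metricMatrix [IsManifold (𝓡 ν) ∞ X]
    [IsContMDiffRiemannianBundle (𝓡 ν) ∞ (EuclideanSpace ℝ (Fin ν))
      (fun x : X => TangentSpace (𝓡 ν) x)]
    (hφ : φ ∈ IsManifold.maximalAtlas (𝓡 ν) ∞ X) (i j : Fin ν) :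
    ContDiffOn ℝ ∞ (fun u => metricMatrix φ u i j) φ.target := by
  rw [← contMDiffOn_iff_contDiffOn]
  have hU : UniqueMDiffOn (𝓡 ν) φ.target := φ.open_target.uniqueMDiffOn
  have h1 := (contMDiffOn_symm_of_mem_maximalAtlas hφ).contMDiffOn_tangentMapWithin (m := ∞)
    (by simp) hU
  have h2 : ∀ i : Fin ν, ContMDiffOn (𝓡 ν) (𝓡 ν).tangent ∞
      (fun u => (⟨φ.symm u, coordVector φ i u⟩ : TangentBundle (𝓡 ν) X)) φ.target := by
    intro i
    have hc : ContMDiff (𝓡 ν) (𝓡 ν).tangent ∞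
        (fun u : EuclideanSpace ℝ (Fin ν) =>
          (⟨u, EuclideanSpace.single i (1 : ℝ)⟩ :
            TangentBundle (𝓡 ν) (EuclideanSpace ℝ (Fin ν)))) := by
      intro u
      rw [contMDiffAt_totalSpace]
      refine ⟨contMDiffAt_id, ?_⟩
      simpa using contMDiffAt_const
    have := h1.comp hc.contMDiffOn (s := φ.target) (fun u hu => hu)
    refine this.congr fun u hu => ?_
    simp only [Function.comp_apply, tangentMapWithin]
    congr 1
    rw [coordVector, mfderivWithin_of_isOpen φ.open_target hu]
  exact ContMDiffOn.inner_bundle (h2 i) (h2 j)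

end ChartMetric

/-! ### Christoffel symbols -/

theorem Matrix.contDiffOn_det {E n : Type*} [NormedAddCommGroup E] [NormedSpace ℝ E]
    [Fintype n] [DecidableEq n] {k : WithTop ℕ∞} {s : Set E} {A : E → Matrix n n ℝ}
    (hA : ∀ i j, ContDiffOn ℝ k (fun x => A x i j) s) :
    ContDiffOn ℝ k (fun x => (A x).det) s := by
  simp only [Matrix.det_apply']
  exact ContDiffOn.sum fun σ _ => contDiffOn_const.mul (contDiffOn_prod fun i _ => hA _ _)

theorem Matrix.contDiffOn_inv {E n : Type*} [NormedAddCommGroup E] [NormedSpace ℝ E]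
    [Fintype n] [DecidableEq n] {k : WithTop ℕ∞} {s : Set E} {A : E → Matrix n n ℝ}
    (hA : ∀ i j, ContDiffOn ℝ k (fun x => A x i j) s) (hdet : ∀ x ∈ s, (A x).det ≠ 0) (i j : n) :
    ContDiffOn ℝ k (fun x => (A x)⁻¹ i j) s := by
  simp only [Matrix.inv_def, Ring.inverse_eq_inv', Matrix.smul_apply, smul_eq_mul,
    Matrix.adjugate_apply]
  refine ((Matrix.contDiffOn_det hA).inv hdet).mul (Matrix.contDiffOn_det fun p q => ?_)
  by_cases hp : p = j
  · subst hp; simpa using contDiffOn_const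
  · simpa [Matrix.updateRow_ne hp] using hA p q

section Christoffel

variable {ν : ℕ}

theorem contDiffOn_partialDeriv {U : Set (EuclideanSpace ℝ (Fin ν))} (hU : IsOpen U)
    {f : EuclideanSpace ℝ (Fin ν) → ℝ} (hf : ContDiffOn ℝ ∞ f U) (i : Fin ν) :
    ContDiffOn ℝ ∞ (partialDeriv i f) U :=
  (hf.fderiv_of_isOpen hU (m := ∞) (by simp)).clm_apply contDiffOn_const

theorem fderiv_eq_sum_partialDeriv (f : EuclideanSpace ℝ (Fin ν) → ℝ)
    (u w : EuclideanSpace ℝ (Fin ν)) :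
    fderiv ℝ f u w = ∑ m, w m * partialDeriv m f u := by
  have hw : w = ∑ i, w i • EuclideanSpace.single i (1 : ℝ) := by
    ext j
    simp [Finset.sum_apply, Pi.single_apply]
  conv_lhs => rw [hw]
  simp [partialDeriv]

/-- The chain rule along a curve, in terms of partial derivatives. -/
theorem hasDerivAt_comp_curve {U : Set (EuclideanSpace ℝ (Fin ν))} (hU : IsOpen U)
    {f : EuclideanSpace ℝ (Fin ν) → ℝ} (hf : ContDiffOn ℝ ∞ f U)
    {c : ℝ → EuclideanSpace ℝ (Fin ν)} {w : EuclideanSpace ℝ (Fin ν)} {t : ℝ}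
    (hc : HasDerivAt c w t) (ht : c t ∈ U) :
    HasDerivAt (fun τ => f (c τ)) (∑ m, w m * partialDeriv m f (c t)) t := by
  rw [← fderiv_eq_sum_partialDeriv]
  have h1 : DifferentiableAt ℝ f (c t) :=
    (hf.differentiableOn (by simp)).differentiableAt (hU.mem_nhds ht)
  exact h1.hasFDerivAt.comp_hasDerivAt t hc

variable {X : Type*} [TopologicalSpace X]
  [ChartedSpace (EuclideanSpace ℝ (Fin ν)) X]
  {φ : OpenPartialHomeomorph X (EuclideanSpace ℝ (Fin ν))}
  [RiemannianBundle (fun x : X => TangentSpace (𝓡 ν) x)]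

theorem christoffel_comm (φ : OpenPartialHomeomorph X (EuclideanSpace ℝ (Fin ν)))
    (k i j : Fin ν) (u : EuclideanSpace ℝ (Fin ν)) :
    christoffel φ k i j u = christoffel φ k j i u := by
  unfold christoffel
  congr 1
  refine Finset.sum_congr rfl fun l _ => ?_
  simp only [metricMatrix_comm φ _ i j]
  ring

variable [IsManifold (𝓡 ν) ∞ X]

theorem metricMatrix_det_ne_zero (hφ : φ ∈ IsManifold.maximalAtlas (𝓡 ν) ∞ X)
    {u : EuclideanSpace ℝ (Fin ν)} (hu : u ∈ φ.target) : (metricMatrix φ u).det ≠ 0 :=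
  (metricMatrix_posDef hφ hu).det_pos.ne'

/-- The Christoffel symbols of the first kind. -/
theorem sum_metricMatrix_mul_christoffel (hφ : φ ∈ IsManifold.maximalAtlas (𝓡 ν) ∞ X)
    {u : EuclideanSpace ℝ (Fin ν)} (hu : u ∈ φ.target) (m i j : Fin ν) :
    ∑ k, metricMatrix φ u m k * christoffel φ k i j u =
      (1 / 2) * (partialDeriv i (fun v => metricMatrix φ v j m) u
      + partialDeriv j (fun v => metricMatrix φ v i m) u
      - partialDeriv m (fun v => metricMatrix φ v i j) u) := by
  have h1 : metricMatrix φ u * (metricMatrix φ u)⁻¹ = 1 :=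
    Matrix.mul_nonsing_inv _ (isUnit_iff_ne_zero.2 (metricMatrix_det_ne_zero hφ hu))
  have h2 : ∀ l, ∑ k, metricMatrix φ u m k * (metricMatrix φ u)⁻¹ k l = if m = l then 1 else 0 := by
    intro l
    rw [← Matrix.mul_apply, h1, Matrix.one_apply]
  simp only [christoffel, Finset.mul_sum]
  rw [Finset.sum_comm]
  have h3 : ∀ l, ∑ k, metricMatrix φ u m k * (1 / 2 * ((metricMatrix φ u)⁻¹ k l *
      (partialDeriv i (fun v => metricMatrix φ v j l) u
      + partialDeriv j (fun v => metricMatrix φ v i l) u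
      - partialDeriv l (fun v => metricMatrix φ v i j) u))) =
      (if m = l then 1 else 0) * ((1 / 2) * (partialDeriv i (fun v => metricMatrix φ v j l) u
      + partialDeriv j (fun v => metricMatrix φ v i l) u
      - partialDeriv l (fun v => metricMatrix φ v i j) u)) := by
    intro l
    rw [← h2, Finset.sum_mul]
    exact Finset.sum_congr rfl fun k _ => by ring
  simp only [h3, ite_mul, one_mul, zero_mul, Finset.sum_ite_eq, Finset.mem_univ, if_true]

/-- The Levi-Civita connection is compatible with the metric. -/
theorem partialDeriv_metricMatrix (hφ : φ ∈ IsManifold.maximalAtlas (𝓡 ν) ∞ X)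
    {u : EuclideanSpace ℝ (Fin ν)} (hu : u ∈ φ.target) (k i j : Fin ν) :
    partialDeriv k (fun v => metricMatrix φ v i j) u =
      ∑ l, metricMatrix φ u j l * christoffel φ l k i u
        + ∑ l, metricMatrix φ u i l * christoffel φ l k j u := by
  rw [sum_metricMatrix_mul_christoffel hφ hu, sum_metricMatrix_mul_christoffel hφ hu]
  simp only [metricMatrix_comm φ _ j i]
  ring

variable [IsContMDiffRiemannianBundle (𝓡 ν) ∞ (EuclideanSpace ℝ (Fin ν))
      (fun x : X => TangentSpace (𝓡 ν) x)]

theorem contDiffOn_christoffel (hφ : φ ∈ IsManifold.maximalAtlas (𝓡 ν) ∞ X) (k i j : Fin ν) :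
    ContDiffOn ℝ ∞ (christoffel φ k i j) φ.target := by
  unfold christoffel
  refine contDiffOn_const.mul (ContDiffOn.sum fun l _ => ?_)
  have hd := fun i j l =>
    contDiffOn_partialDeriv φ.open_target (contDiffOn_metricMatrix hφ i j) l
  exact (Matrix.contDiffOn_inv (contDiffOn_metricMatrix hφ)
    (fun u hu => metricMatrix_det_ne_zero hφ hu) k l).mul
    (((hd _ _ _).add (hd _ _ _)).sub (hd _ _ _))

end Christoffel

/-! ### The connection and the curvature as multilinear forms -/

section Forms

variable {ν : ℕ} {X : Type*} [TopologicalSpace X]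
  [ChartedSpace (EuclideanSpace ℝ (Fin ν)) X]
  [RiemannianBundle (fun x : X => TangentSpace (𝓡 ν) x)]

/-- The metric `g(a, b)` at the point with coordinates `u`, on vectors given by their
components. -/
noncomputable def metricForm (φ : OpenPartialHomeomorph X (EuclideanSpace ℝ (Fin ν)))
    (u : EuclideanSpace ℝ (Fin ν)) (a b : Fin ν → ℝ) : ℝ :=
  ∑ i, ∑ j, metricMatrix φ u i j * a i * b j

/-- The vector `Γ(a, b)` with components `∑ Γ^k_{ij} aᵢ bⱼ`. -/
noncomputable def christoffelForm (φ : OpenPartialHomeomorph X (EuclideanSpace ℝ (Fin ν)))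
    (u : EuclideanSpace ℝ (Fin ν)) (a b : Fin ν → ℝ) (k : Fin ν) : ℝ :=
  ∑ i, ∑ j, christoffel φ k i j u * a i * b j

/-- The derivative of `u ↦ Γ(a, b)` in the direction `w`. -/
noncomputable def christoffelFormDeriv (φ : OpenPartialHomeomorph X (EuclideanSpace ℝ (Fin ν)))
    (u : EuclideanSpace ℝ (Fin ν)) (w a b : Fin ν → ℝ) (k : Fin ν) : ℝ :=
  ∑ i, ∑ j, (∑ m, w m * partialDeriv m (christoffel φ k i j) u) * a i * b j

/-- The vector `R(a, b) c`. -/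
noncomputable def curvatureForm (φ : OpenPartialHomeomorph X (EuclideanSpace ℝ (Fin ν)))
    (u : EuclideanSpace ℝ (Fin ν)) (a b c : Fin ν → ℝ) (k : Fin ν) : ℝ :=
  ∑ i, ∑ j, ∑ m, curvature φ k m i j u * a i * b j * c m

variable {φ : OpenPartialHomeomorph X (EuclideanSpace ℝ (Fin ν))} {u : EuclideanSpace ℝ (Fin ν)}

theorem christoffelForm_comm (a b : Fin ν → ℝ) :
    christoffelForm φ u a b = christoffelForm φ u b a := by
  funext k
  unfold christoffelForm
  rw [Finset.sum_comm]
  exact Finset.sum_congr rfl fun i _ => Finset.sum_congr rfl fun j _ => by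
    rw [christoffel_comm]; ring

theorem christoffelFormDeriv_comm (w a b : Fin ν → ℝ) :
    christoffelFormDeriv φ u w a b = christoffelFormDeriv φ u w b a := by
  funext k
  unfold christoffelFormDeriv
  rw [Finset.sum_comm]
  refine Finset.sum_congr rfl fun i _ => Finset.sum_congr rfl fun j _ => ?_
  have : christoffel φ k j i = christoffel φ k i j := funext fun u => christoffel_comm φ k j i u
  rw [this]; ring

theorem christoffelForm_add_smul (w a b : Fin ν → ℝ) (t : ℝ) (k : Fin ν) :
    christoffelForm φ u w (fun l => a l + t * b l) k
      = christoffelForm φ u w a k + t * christoffelForm φ u w b k := by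
  unfold christoffelForm
  simp only [Finset.mul_sum, ← Finset.sum_add_distrib]
  exact Finset.sum_congr rfl fun i _ => Finset.sum_congr rfl fun j _ => by ring

theorem metricForm_comm (a b : Fin ν → ℝ) : metricForm φ u a b = metricForm φ u b a := by
  unfold metricForm
  rw [Finset.sum_comm]
  exact Finset.sum_congr rfl fun i _ => Finset.sum_congr rfl fun j _ => by
    rw [metricMatrix_comm]; ring

/-- The curvature in terms of the connection and its derivative:
`R(a, b) c = (∂ₐΓ)(b, c) - (∂_bΓ)(a, c) + Γ(a, Γ(b, c)) - Γ(b, Γ(a, c))`. -/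
theorem curvatureForm_eq (a b c : Fin ν → ℝ) (k : Fin ν) :
    curvatureForm φ u a b c k =
      christoffelFormDeriv φ u a b c k - christoffelFormDeriv φ u b a c k
      + christoffelForm φ u a (christoffelForm φ u b c) k
      - christoffelForm φ u b (christoffelForm φ u a c) k := by
  have e1 : christoffelFormDeriv φ u a b c k =
      ∑ i, ∑ j, ∑ m, partialDeriv i (christoffel φ k j m) u * a i * b j * c m := by
    unfold christoffelFormDeriv
    simp only [Finset.sum_mul]
    conv_lhs => enter [2, j]; rw [Finset.sum_comm]
    rw [Finset.sum_comm]
    exact Finset.sum_congr rfl fun i _ => Finset.sum_congr rfl fun j _ =>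
      Finset.sum_congr rfl fun m _ => by ring
  have e2 : christoffelFormDeriv φ u b a c k =
      ∑ i, ∑ j, ∑ m, partialDeriv j (christoffel φ k i m) u * a i * b j * c m := by
    unfold christoffelFormDeriv
    simp only [Finset.sum_mul]
    conv_lhs => enter [2, j]; rw [Finset.sum_comm]
    exact Finset.sum_congr rfl fun i _ => Finset.sum_congr rfl fun j _ =>
      Finset.sum_congr rfl fun m _ => by ring
  have e3 : ∀ a b : Fin ν → ℝ, christoffelForm φ u a (christoffelForm φ u b c) k =
      ∑ i, ∑ j, ∑ m, (∑ l, christoffel φ k i l u * christoffel φ l j m u) * a i * b j * c m := by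
    intro a b
    unfold christoffelForm
    simp only [Finset.sum_mul, Finset.mul_sum]
    refine Finset.sum_congr rfl fun i _ => ?_
    rw [Finset.sum_comm]
    refine Finset.sum_congr rfl fun j _ => ?_
    rw [Finset.sum_comm]
    exact Finset.sum_congr rfl fun i _ => Finset.sum_congr rfl fun j _ => by ring
  have e4 : christoffelForm φ u b (christoffelForm φ u a c) k =
      ∑ i, ∑ j, ∑ m, (∑ l, christoffel φ k j l u * christoffel φ l i m u) * a i * b j * c m := by
    rw [e3, Finset.sum_comm]
    exact Finset.sum_congr rfl fun i _ => Finset.sum_congr rfl fun j _ =>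
      Finset.sum_congr rfl fun m _ => by ring
  rw [e1, e2, e3 a b, e4]
  unfold curvatureForm curvature
  simp only [← Finset.sum_sub_distrib, ← Finset.sum_add_distrib]
  refine Finset.sum_congr rfl fun i _ => Finset.sum_congr rfl fun j _ =>
    Finset.sum_congr rfl fun m _ => ?_
  simp only [Finset.sum_sub_distrib]
  ring

theorem metricForm_add_left (a a' b : Fin ν → ℝ) :
    metricForm φ u (fun i => a i + a' i) b = metricForm φ u a b + metricForm φ u a' b := by
  unfold metricForm
  simp only [← Finset.sum_add_distrib]
  exact Finset.sum_congr rfl fun i _ => Finset.sum_congr rfl fun j _ => by ring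

variable [IsManifold (𝓡 ν) ∞ X]

/-- Compatibility of the connection with the metric:
`(∂_w g)(a, b) = g(Γ(w, a), b) + g(a, Γ(w, b))`. -/
theorem sum_partialDeriv_metricMatrix (hφ : φ ∈ IsManifold.maximalAtlas (𝓡 ν) ∞ X)
    (hu : u ∈ φ.target) (w a b : Fin ν → ℝ) :
    ∑ i, ∑ j, (∑ m, w m * partialDeriv m (fun v => metricMatrix φ v i j) u) * a i * b j =
      metricForm φ u (christoffelForm φ u w a) b + metricForm φ u a (christoffelForm φ u w b) := by
  have e : ∀ a b : Fin ν → ℝ, metricForm φ u a (christoffelForm φ u w b) =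
      ∑ i, ∑ j, (∑ m, w m * ∑ l, metricMatrix φ u i l * christoffel φ l m j u) * a i * b j := by
    intro a b
    unfold metricForm christoffelForm
    simp only [Finset.sum_mul, Finset.mul_sum]
    refine Finset.sum_congr rfl fun i _ => ?_
    rw [Finset.sum_comm]
    conv_lhs => enter [2, y]; rw [Finset.sum_comm]
    rw [Finset.sum_comm]
    refine Finset.sum_congr rfl fun j _ => Finset.sum_congr rfl fun m _ =>
      Finset.sum_congr rfl fun l _ => ?_
    ring
  rw [metricForm_comm _ b, e, e]
  conv_rhs => enter [1]; rw [Finset.sum_comm]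
  simp only [← Finset.sum_add_distrib]
  refine Finset.sum_congr rfl fun i _ => Finset.sum_congr rfl fun j _ => ?_
  simp only [partialDeriv_metricMatrix hφ hu, mul_add, Finset.sum_add_distrib]
  ring

variable [IsContMDiffRiemannianBundle (𝓡 ν) ∞ (EuclideanSpace ℝ (Fin ν))
      (fun x : X => TangentSpace (𝓡 ν) x)]
  {c : ℝ → EuclideanSpace ℝ (Fin ν)} {w : EuclideanSpace ℝ (Fin ν)} {t : ℝ}
  {a b : ℝ → Fin ν → ℝ} {a' b' : Fin ν → ℝ}

theorem hasDerivAt_christoffelForm (hφ : φ ∈ IsManifold.maximalAtlas (𝓡 ν) ∞ X)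
    (hc : HasDerivAt c w t) (ht : c t ∈ φ.target)
    (ha : ∀ i, HasDerivAt (fun τ => a τ i) (a' i) t)
    (hb : ∀ i, HasDerivAt (fun τ => b τ i) (b' i) t) (k : Fin ν) :
    HasDerivAt (fun τ => christoffelForm φ (c τ) (a τ) (b τ) k)
      (christoffelFormDeriv φ (c t) w (a t) (b t) k + christoffelForm φ (c t) a' (b t) k
        + christoffelForm φ (c t) (a t) b' k) t := by
  unfold christoffelForm christoffelFormDeriv
  simp only [← Finset.sum_add_distrib]
  refine HasDerivAt.fun_sum fun i _ => HasDerivAt.fun_sum fun j _ => ?_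
  refine (((hasDerivAt_comp_curve φ.open_target (contDiffOn_christoffel hφ k i j) hc ht).fun_mul
    (ha i)).fun_mul (hb j)).congr_deriv ?_
  ring

/-- The derivative of `g(a, b)` along a curve, in terms of covariant derivatives. -/
theorem hasDerivAt_metricForm (hφ : φ ∈ IsManifold.maximalAtlas (𝓡 ν) ∞ X)
    (hc : HasDerivAt c w t) (ht : c t ∈ φ.target)
    (ha : ∀ i, HasDerivAt (fun τ => a τ i) (a' i) t)
    (hb : ∀ i, HasDerivAt (fun τ => b τ i) (b' i) t) :
    HasDerivAt (fun τ => metricForm φ (c τ) (a τ) (b τ))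
      (metricForm φ (c t) (fun i => a' i + christoffelForm φ (c t) w (a t) i) (b t)
        + metricForm φ (c t) (fun i => b' i + christoffelForm φ (c t) w (b t) i) (a t)) t := by
  have h : HasDerivAt (fun τ => metricForm φ (c τ) (a τ) (b τ))
      ((∑ i, ∑ j, (∑ m, w m * partialDeriv m (fun v => metricMatrix φ v i j) (c t))
        * a t i * b t j) + metricForm φ (c t) a' (b t) + metricForm φ (c t) (a t) b') t := by
    unfold metricForm
    simp only [← Finset.sum_add_distrib]
    refine HasDerivAt.fun_sum fun i _ => HasDerivAt.fun_sum fun j _ => ?_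
    refine (((hasDerivAt_comp_curve φ.open_target (contDiffOn_metricMatrix hφ i j) hc ht).fun_mul
      (ha i)).fun_mul (hb j)).congr_deriv ?_
    ring
  refine h.congr_deriv ?_
  rw [sum_partialDeriv_metricMatrix hφ ht, metricForm_add_left, metricForm_add_left,
    metricForm_comm b', metricForm_comm (christoffelForm φ (c t) w (b t))]
  ring

end Forms

/-! ### Jacobi fields in normal coordinates -/

section Jacobi

variable {ν : ℕ} {X : Type*} [TopologicalSpace X]
  [ChartedSpace (EuclideanSpace ℝ (Fin ν)) X]
  [RiemannianBundle (fun x : X => TangentSpace (𝓡 ν) x)]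
  {φ : OpenPartialHomeomorph X (EuclideanSpace ℝ (Fin ν))}
  {u : EuclideanSpace ℝ (Fin ν)}

theorem metricForm_self_nonneg (a : Fin ν → ℝ) : 0 ≤ metricForm φ u a a := by
  rw [metricForm, sum_metricMatrix_mul φ u (WithLp.toLp 2 a) (WithLp.toLp 2 a)]
  exact real_inner_self_nonneg

theorem two_mul_metricForm_le (a b : Fin ν → ℝ) :
    2 * metricForm φ u a b ≤ metricForm φ u a a + metricForm φ u b b := by
  simp only [metricForm]
  rw [sum_metricMatrix_mul φ u (WithLp.toLp 2 a) (WithLp.toLp 2 a),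
    sum_metricMatrix_mul φ u (WithLp.toLp 2 a) (WithLp.toLp 2 b),
    sum_metricMatrix_mul φ u (WithLp.toLp 2 b) (WithLp.toLp 2 b)]
  set x := mfderiv (𝓡 ν) (𝓡 ν) φ.symm u (WithLp.toLp 2 a)
  set y := mfderiv (𝓡 ν) (𝓡 ν) φ.symm u (WithLp.toLp 2 b)
  have h := real_inner_self_nonneg (x := x - y)
  rw [inner_sub_left, inner_sub_right, inner_sub_right, real_inner_comm x y] at h
  linarith

/-- The bound of the curvature, as a multilinear form, by the norm of the curvature tensor. -/
theorem metricForm_curvatureForm_sq_le [IsManifold (𝓡 ν) ∞ X]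
    (hφ : φ ∈ IsManifold.maximalAtlas (𝓡 ν) ∞ X) (hu : u ∈ φ.target) (a b c d : Fin ν → ℝ) :
    metricForm φ u (curvatureForm φ u a b c) d ^ 2 ≤
      tensorNormSq φ (riemannTensor φ) u *
        (metricForm φ u d d * metricForm φ u c c * metricForm φ u a a * metricForm φ u b b) := by
  have h := tensor_apply_sq_le (metricMatrix_posDef hφ hu) (fun I => riemannTensor φ I u)
    ![d, c, a, b]
  have e1 : ∏ s : Fin 4, ∑ i, ∑ j, metricMatrix φ u i j * (![d, c, a, b] : Fin 4 → Fin ν → ℝ) s i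
      * (![d, c, a, b] : Fin 4 → Fin ν → ℝ) s j =
      metricForm φ u d d * metricForm φ u c c * metricForm φ u a a * metricForm φ u b b := by
    simp only [Fin.prod_univ_four, metricForm]
    rfl
  rw [e1] at h
  refine le_trans (le_of_eq ?_) h
  congr 1
  simp only [Fintype.sum_pi_fin_succ, Fin.prod_univ_four, riemannTensor, Fin.cons_zero,
    Matrix.cons_val_zero, Matrix.cons_val_one, Matrix.cons_val]
  rw [metricForm_comm]
  unfold metricForm curvatureForm
  simp only [Finset.mul_sum, Finset.sum_mul]
  refine Finset.sum_congr rfl fun i _ => ?_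
  simp only [Fintype.sum_unique]
  conv_lhs =>
    enter [2, m]
    conv => enter [2, x]; rw [Finset.sum_comm]
    rw [Finset.sum_comm]
  rw [Finset.sum_comm]
  refine Finset.sum_congr rfl fun x _ => ?_
  rw [Finset.sum_comm]
  refine Finset.sum_congr rfl fun y _ => ?_
  rw [Finset.sum_comm]
  refine Finset.sum_congr rfl fun z _ => Finset.sum_congr rfl fun m _ => ?_
  calc _ = metricMatrix φ u i m * curvature φ m x y z u * (d i * c x * a y * b z) := by ring
    _ = _ := rfl

variable [IsManifold (𝓡 ν) ∞ X]
  [IsContMDiffRiemannianBundle (𝓡 ν) ∞ (EuclideanSpace ℝ (Fin ν))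
      (fun x : X => TangentSpace (𝓡 ν) x)]

/-- The geodesic equation for the rays through the origin, differentiated with respect to the
direction of the ray. -/
theorem christoffelFormDeriv_of_ray_geodesic (hφ : φ ∈ IsManifold.maximalAtlas (𝓡 ν) ∞ X)
    (hgeo : ∀ (t : ℝ) (w : EuclideanSpace ℝ (Fin ν)), t • w ∈ φ.target → ∀ k,
      christoffelForm φ (t • w) w w k = 0)
    {t : ℝ} {w : EuclideanSpace ℝ (Fin ν)} (ht : t • w ∈ φ.target)
    (v : EuclideanSpace ℝ (Fin ν)) (k : Fin ν) :
    t * christoffelFormDeriv φ (t • w) v w w k + 2 * christoffelForm φ (t • w) w v k = 0 := by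
  have hc : HasDerivAt (fun ε : ℝ => t • (w + ε • v)) (t • v) 0 := by
    have := (((hasDerivAt_id (0 : ℝ)).smul_const v).const_add w).fun_const_smul t
    simpa using this
  have hw : ∀ i, HasDerivAt (fun ε : ℝ => (w + ε • v) i) (v i) 0 := by
    intro i
    have := ((hasDerivAt_id (0 : ℝ)).mul_const (v i)).const_add (w i)
    simpa using this
  have h0 : t • (w + (0 : ℝ) • v) ∈ φ.target := by simpa using ht
  have h1 := hasDerivAt_christoffelForm hφ hc h0 hw hw k
  have hev : (fun _ : ℝ => (0 : ℝ)) =ᶠ[𝓝 0] fun ε : ℝ =>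
      christoffelForm φ (t • (w + ε • v)) (fun i => (w + ε • v) i)
        (fun i => (w + ε • v) i) k := by
    filter_upwards [hc.continuousAt.preimage_mem_nhds (φ.open_target.mem_nhds h0)] with ε hε
    exact (hgeo t _ hε k).symm
  have h2 := h1.unique ((hasDerivAt_const (0 : ℝ) (0 : ℝ)).congr_of_eventuallyEq hev.symm)
  have e : christoffelFormDeriv φ (t • w) (t • v : EuclideanSpace ℝ (Fin ν)) w w k =
      t * christoffelFormDeriv φ (t • w) v w w k := by
    unfold christoffelFormDeriv
    simp only [Finset.mul_sum, Finset.sum_mul, PiLp.smul_apply, smul_eq_mul]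
    exact Finset.sum_congr rfl fun i _ => Finset.sum_congr rfl fun j _ =>
      Finset.sum_congr rfl fun m _ => by ring
  simp only [zero_smul, add_zero] at h2
  rw [e, christoffelForm_comm (v : Fin ν → ℝ)] at h2
  linarith

/-- The Jacobi equation `D² J = R(w, J) w` for the field `J(t) = t v` along the ray `t ↦ t w`:
the covariant derivative of `D J = v + t Γ(w, v)`. -/
theorem hasDerivAt_covDeriv_jacobi (hφ : φ ∈ IsManifold.maximalAtlas (𝓡 ν) ∞ X)
    (hgeo : ∀ (t : ℝ) (w : EuclideanSpace ℝ (Fin ν)), t • w ∈ φ.target → ∀ k,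
      christoffelForm φ (t • w) w w k = 0)
    {t : ℝ} {w : EuclideanSpace ℝ (Fin ν)} (ht : t • w ∈ φ.target)
    (v : EuclideanSpace ℝ (Fin ν)) (k : Fin ν) :
    HasDerivAt (fun τ : ℝ => v k + τ * christoffelForm φ (τ • w) w v k)
      (t * curvatureForm φ (t • w) w v w k - christoffelForm φ (t • w) w
        (fun l => v l + t * christoffelForm φ (t • w) w v l) k) t := by
  have hc : HasDerivAt (fun τ : ℝ => τ • w) w t := by
    simpa using (hasDerivAt_id t).smul_const w
  have h1 := hasDerivAt_christoffelForm (a := fun _ => w) (b := fun _ => v) (a' := 0) (b' := 0)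
    hφ hc ht (fun i => hasDerivAt_const _ _) (fun i => hasDerivAt_const _ _) k
  have h2 := ((hasDerivAt_id t).mul h1).const_add (v k)
  refine h2.congr_deriv ?_
  have z1 : christoffelForm φ (t • w) 0 v k = 0 := by simp [christoffelForm]
  have z2 : christoffelForm φ (t • w) w 0 k = 0 := by simp [christoffelForm]
  have z3 : christoffelForm φ (t • w) v (christoffelForm φ (t • w) w w) k = 0 := by
    have : christoffelForm φ (t • w) w w = 0 := funext fun l => hgeo t w ht l
    rw [this]; simp [christoffelForm]
  have h3 := christoffelFormDeriv_of_ray_geodesic hφ hgeo ht v k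
  rw [z1, z2, curvatureForm_eq, z3, christoffelForm_add_smul, christoffelFormDeriv_comm _ v w,
    christoffelForm_comm (v : Fin ν → ℝ) w]
  simp only [id]
  linear_combination h3

/-- The speed of a ray that is a geodesic is constant. -/
theorem metricForm_ray_eq (hφ : φ ∈ IsManifold.maximalAtlas (𝓡 ν) ∞ X)
    (hgeo : ∀ (t : ℝ) (w : EuclideanSpace ℝ (Fin ν)), t • w ∈ φ.target → ∀ k,
      christoffelForm φ (t • w) w w k = 0)
    {w : EuclideanSpace ℝ (Fin ν)} (hw : ∀ t ∈ Icc (0 : ℝ) 1, t • w ∈ φ.target)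
    {t : ℝ} (ht : t ∈ Icc (0 : ℝ) 1) :
    metricForm φ (t • w) w w = metricForm φ 0 w w := by
  have hd : ∀ s ∈ Icc (0 : ℝ) 1, HasDerivAt (fun τ : ℝ => metricForm φ (τ • w) w w) 0 s := by
    intro s hs
    have hc : HasDerivAt (fun τ : ℝ => τ • w) w s := by
      simpa using (hasDerivAt_id s).smul_const w
    have h1 := hasDerivAt_metricForm (a := fun _ => w) (b := fun _ => w) (a' := 0) (b' := 0)
      hφ hc (hw s hs) (fun i => hasDerivAt_const _ _) (fun i => hasDerivAt_const _ _)
    refine h1.congr_deriv ?_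
    simp [hgeo s w (hw s hs), metricForm]
  have := constant_of_has_deriv_right_zero (f := fun τ : ℝ => metricForm φ (τ • w) w w)
    (a := 0) (b := 1) (fun s hs => (hd s hs).continuousAt.continuousWithinAt)
    (fun s hs => (hd s ⟨hs.1, hs.2.le⟩).hasDerivWithinAt) t ht
  simpa using this

/-- In coordinates in which the rays through the origin are geodesics, and the metric at the
origin is Euclidean, a bound of the curvature bounds the metric: the energy `|J|² + |D J|²` of the
Jacobi field `J(t) = t v` grows at most exponentially. -/
theorem metricForm_le_exp (hφ : φ ∈ IsManifold.maximalAtlas (𝓡 ν) ∞ X)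
    (hgeo : ∀ (t : ℝ) (w : EuclideanSpace ℝ (Fin ν)), t • w ∈ φ.target → ∀ k,
      christoffelForm φ (t • w) w w k = 0)
    (h0 : metricMatrix φ 0 = 1) {C : ℝ}
    (hC : ∀ u ∈ φ.target, tensorNormSq φ (riemannTensor φ) u ≤ C ^ 2) (hC0 : 0 ≤ C)
    {w : EuclideanSpace ℝ (Fin ν)} (hw : ∀ t ∈ Icc (0 : ℝ) 1, t • w ∈ φ.target)
    (v : EuclideanSpace ℝ (Fin ν)) :
    metricForm φ w v v ≤ Real.exp (1 + C * ‖w‖ ^ 2) * ‖v‖ ^ 2 := by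
  have hnorm : ∀ a : EuclideanSpace ℝ (Fin ν), metricForm φ 0 a a = ‖a‖ ^ 2 := by
    intro a
    rw [EuclideanSpace.real_norm_sq_eq]
    simp [metricForm, h0, Matrix.one_apply, pow_two]
  -- `J` is the Jacobi field, `DJ` its covariant derivative, and `E' ≤ κ E` for the energy `E`
  set κ : ℝ := 1 + C * ‖w‖ ^ 2 with hκ
  set J : ℝ → Fin ν → ℝ := fun t k => t * v k with hJ
  set DJ : ℝ → Fin ν → ℝ := fun t k => v k + t * christoffelForm φ (t • w) w v k with hDJ
  set E : ℝ → ℝ := fun t => metricForm φ (t • w) (J t) (J t) + metricForm φ (t • w) (DJ t) (DJ t)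
    with hE
  have hd : ∀ t ∈ Icc (0 : ℝ) 1, HasDerivAt E
      (2 * metricForm φ (t • w) (DJ t) (J t) +
        2 * metricForm φ (t • w) (curvatureForm φ (t • w) w (J t) w) (DJ t)) t := by
    intro t ht
    have hc : HasDerivAt (fun τ : ℝ => τ • w) w t := by
      simpa using (hasDerivAt_id t).smul_const w
    have hJd : ∀ i, HasDerivAt (fun τ => J τ i) (v i) t := fun i => by
      simpa using (hasDerivAt_id t).mul_const (v i)
    have hDJd := fun k => hasDerivAt_covDeriv_jacobi hφ hgeo (hw t ht) v k
    have h1 := hasDerivAt_metricForm hφ hc (hw t ht) hJd hJd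
    have h2 := hasDerivAt_metricForm hφ hc (hw t ht) hDJd hDJd
    refine (h1.add h2).congr_deriv ?_
    have e1 : (fun i => v i + christoffelForm φ (t • w) w (J t) i) = DJ t := by
      funext i
      have := christoffelForm_add_smul (φ := φ) (u := t • w) w 0 v t i
      simp only [Pi.zero_apply, zero_add] at this
      simp only [hJ, hDJ, this]
      simp [christoffelForm]
    have e2 : (fun i => t * curvatureForm φ (t • w) w v w i - christoffelForm φ (t • w) w
        (fun l => v l + t * christoffelForm φ (t • w) w v l) i +
        christoffelForm φ (t • w) w (fun k => v k + t * christoffelForm φ (t • w) w v k) i) =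
        curvatureForm φ (t • w) w (J t) w := by
      funext i
      simp only [hJ, curvatureForm, sub_add_cancel, Finset.mul_sum]
      exact Finset.sum_congr rfl fun i _ => Finset.sum_congr rfl fun j _ =>
        Finset.sum_congr rfl fun m _ => by ring
    rw [e1, e2]
    ring
  have hle : ∀ t ∈ Icc (0 : ℝ) 1, 2 * metricForm φ (t • w) (DJ t) (J t) +
        2 * metricForm φ (t • w) (curvatureForm φ (t • w) w (J t) w) (DJ t) ≤ κ * E t := by
    intro t ht
    have h1 := two_mul_metricForm_le (φ := φ) (u := t • w) (DJ t) (J t)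
    have h2 := metricForm_curvatureForm_sq_le hφ (hw t ht) w (J t) w (DJ t)
    rw [metricForm_ray_eq hφ hgeo hw ht, hnorm] at h2
    have hJ0 := metricForm_self_nonneg (φ := φ) (u := t • w) (J t)
    have hD0 := metricForm_self_nonneg (φ := φ) (u := t • w) (DJ t)
    have h3 : metricForm φ (t • w) (curvatureForm φ (t • w) w (J t) w) (DJ t) ^ 2 ≤
        (C * ‖w‖ ^ 2 * ((metricForm φ (t • w) (J t) (J t)
          + metricForm φ (t • w) (DJ t) (DJ t)) / 2)) ^ 2 := by
      refine h2.trans ?_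
      have hn : 0 ≤ metricForm φ (t • w) (DJ t) (DJ t) * ‖w‖ ^ 2 * ‖w‖ ^ 2
          * metricForm φ (t • w) (J t) (J t) := by positivity
      refine (mul_le_mul_of_nonneg_right (hC _ (hw t ht)) hn).trans ?_
      have hp : 0 ≤ C ^ 2 * (‖w‖ ^ 2) ^ 2 := by positivity
      nlinarith [mul_nonneg hp (sq_nonneg (metricForm φ (t • w) (J t) (J t)
          - metricForm φ (t • w) (DJ t) (DJ t)))]
    have h4 := abs_le_of_sq_le_sq' h3 (by positivity)
    simp only [hE, hκ]
    nlinarith [h4.2]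
  -- Grönwall's argument, with the initial values `J 0 = 0` and `DJ 0 = v`
  have hanti : AntitoneOn (fun t => Real.exp (-(κ * t)) * E t) (Icc 0 1) := by
    have hdd : ∀ t ∈ Icc (0 : ℝ) 1, HasDerivAt (fun t => Real.exp (-(κ * t)) * E t)
        (Real.exp (-(κ * t)) * (-(κ * 1)) * E t + Real.exp (-(κ * t)) *
          (2 * metricForm φ (t • w) (DJ t) (J t) +
        2 * metricForm φ (t • w) (curvatureForm φ (t • w) w (J t) w) (DJ t))) t := fun t ht =>
      (((hasDerivAt_id t).const_mul κ).neg.exp).mul (hd t ht)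
    refine antitoneOn_of_deriv_nonpos (convex_Icc 0 1)
      (fun t ht => (hdd t ht).continuousAt.continuousWithinAt)
      (fun t ht => (hdd t (interior_subset ht)).differentiableAt.differentiableWithinAt)
      (fun t ht => ?_)
    rw [(hdd t (interior_subset ht)).deriv]
    have := mul_le_mul_of_nonneg_left (hle t (interior_subset ht)) (Real.exp_pos (-(κ * t))).le
    linarith
  have h01 := hanti (left_mem_Icc.2 zero_le_one) (right_mem_Icc.2 zero_le_one) zero_le_one
  have hE0 : E 0 = ‖v‖ ^ 2 := by
    simp only [hE, hJ, hDJ, zero_smul, zero_mul, add_zero]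
    rw [hnorm]
    simp [metricForm]
  have hE1 : metricForm φ w v v ≤ E 1 := by
    have := metricForm_self_nonneg (φ := φ) (u := w) (DJ 1)
    simp only [hE, hJ, one_smul, one_mul]
    linarith
  simp only [mul_zero, neg_zero, Real.exp_zero, one_mul, mul_one, hE0] at h01
  rw [Real.exp_neg, inv_mul_le_iff₀ (Real.exp_pos _)] at h01
  exact hE1.trans h01

end Jacobi

/-! ### The Riemannian measure of small balls -/

section ChartVolume

theorem OpenPartialHomeomorph.measurableSet_target_inter_preimage_symm
    {X E : Type*} [TopologicalSpace X] [MeasurableSpace X] [BorelSpace X] [TopologicalSpace E]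
    [MeasurableSpace E] [BorelSpace E] (φ : OpenPartialHomeomorph X E) {A : Set X}
    (hA : MeasurableSet A) :
    MeasurableSet (φ.target ∩ φ.symm ⁻¹' A) := by
  have h1 : Measurable (φ.target.domRestrict φ.symm) :=
    (continuousOn_iff_continuous_domRestrict.1 φ.continuousOn_symm).measurable
  have h2 := φ.open_target.measurableSet.subtype_image (h1 hA)
  convert h2 using 1
  ext u
  simp [Set.domRestrict, and_comm]

variable {ν : ℕ} {X : Type*} [TopologicalSpace X]
  [ChartedSpace (EuclideanSpace ℝ (Fin ν)) X]
  {φ ψ : OpenPartialHomeomorph X (EuclideanSpace ℝ (Fin ν))}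
  [RiemannianBundle (fun x : X => TangentSpace (𝓡 ν) x)]

theorem inner_tangentSpace_congr {x y : X} (h : x = y) (v w : EuclideanSpace ℝ (Fin ν)) :
    @inner ℝ (TangentSpace (𝓡 ν) x) _ v w = @inner ℝ (TangentSpace (𝓡 ν) y) _ v w := by
  rw [h]

/-- The transformation of `√(det g)` under a change of charts. -/
theorem sqrt_det_metricMatrix_eq [IsManifold (𝓡 ν) ∞ X]
    (hφ : φ ∈ IsManifold.maximalAtlas (𝓡 ν) ∞ X)
    (hψ : ψ ∈ IsManifold.maximalAtlas (𝓡 ν) ∞ X) {u : EuclideanSpace ℝ (Fin ν)}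
    (hu : u ∈ ψ.target) (hu' : ψ.symm u ∈ φ.source) :
    DifferentiableAt ℝ (φ ∘ ψ.symm) u ∧
    Real.sqrt (metricMatrix ψ u).det = |(fderiv ℝ (φ ∘ ψ.symm) u).det| *
      Real.sqrt (metricMatrix φ (φ (ψ.symm u))).det := by
  have hφd := mdifferentiable_of_mem_maximalAtlas hφ
  have hψd := mdifferentiable_of_mem_maximalAtlas hψ
  have hτ : MDifferentiableAt (𝓡 ν) (𝓡 ν) (φ ∘ ψ.symm) u :=
    (hφd.mdifferentiableAt hu').comp u (hψd.mdifferentiableAt_symm hu)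
  have hτ' : DifferentiableAt ℝ (φ ∘ ψ.symm) u := mdifferentiableAt_iff_differentiableAt.1 hτ
  refine ⟨hτ', ?_⟩
  set τ := φ ∘ ψ.symm with hτdef
  have hx : φ.symm (τ u) = ψ.symm u := φ.left_inv hu'
  have hcomp : mfderiv (𝓡 ν) (𝓡 ν) ψ.symm u =
      (mfderiv (𝓡 ν) (𝓡 ν) φ.symm (τ u)).comp (mfderiv (𝓡 ν) (𝓡 ν) τ u) := by
    have hev : ψ.symm =ᶠ[𝓝 u] φ.symm ∘ τ := by
      have : ψ.symm ⁻¹' φ.source ∈ 𝓝 u :=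
        (ψ.continuousAt_symm hu).preimage_mem_nhds (φ.open_source.mem_nhds hu')
      filter_upwards [this] with v hv
      exact (φ.left_inv hv).symm
    refine HasMFDerivAt.mfderiv ?_
    refine HasMFDerivAt.congr_of_eventuallyEq ?_ hev
    exact HasMFDerivAt.comp u
      (hφd.mdifferentiableAt_symm (φ.map_source hu')).hasMFDerivAt hτ.hasMFDerivAt
  set M : Matrix (Fin ν) (Fin ν) ℝ := LinearMap.toMatrix (EuclideanSpace.basisFun (Fin ν) ℝ).toBasis
    (EuclideanSpace.basisFun (Fin ν) ℝ).toBasis (fderiv ℝ τ u).toLinearMap with hM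
  have hMd : M.det = (fderiv ℝ τ u).det := by
    rw [hM, LinearMap.det_toMatrix]
  have hMe : ∀ k i, M k i = (fderiv ℝ τ u (EuclideanSpace.single i (1 : ℝ))) k := by
    intro k i
    simp [hM, LinearMap.toMatrix_apply]
  have hG : metricMatrix ψ u = M.transpose * metricMatrix φ (τ u) * M := by
    ext i j
    have h1 : metricMatrix ψ u i j = ∑ k, ∑ l, metricMatrix φ (τ u) k l *
        (fderiv ℝ τ u (EuclideanSpace.single i (1 : ℝ))) k *
        (fderiv ℝ τ u (EuclideanSpace.single j (1 : ℝ))) l := by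
      rw [sum_metricMatrix_mul, metricMatrix, Matrix.of_apply, coordVector, coordVector, hcomp,
        mfderiv_eq_fderiv]
      exact inner_tangentSpace_congr hx.symm _ _
    rw [h1]
    simp only [Matrix.mul_apply, Matrix.transpose_apply, ← hMe, Finset.sum_mul]
    rw [Finset.sum_comm]
    exact Finset.sum_congr rfl fun k _ => Finset.sum_congr rfl fun l _ => by ring
  rw [hG, Matrix.det_mul, Matrix.det_mul, Matrix.det_transpose, hMd]
  rw [show (fderiv ℝ τ u).det * (metricMatrix φ (τ u)).det * (fderiv ℝ τ u).det =
    (fderiv ℝ τ u).det ^ 2 * (metricMatrix φ (τ u)).det by ring,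
    Real.sqrt_mul (sq_nonneg _), Real.sqrt_sq_eq_abs]
  rfl

variable [MeasurableSpace X] [BorelSpace X]

theorem chartVolume_apply
    (φ : OpenPartialHomeomorph X (EuclideanSpace ℝ (Fin ν))) {A : Set X} (hA : MeasurableSet A) :
    chartVolume φ A = ∫⁻ u in φ.target ∩ φ.symm ⁻¹' A,
      ENNReal.ofReal (Real.sqrt (metricMatrix φ u).det) := by
  have hm : AEMeasurable φ.symm ((volume.restrict φ.target).withDensity fun u =>
      ENNReal.ofReal (Real.sqrt (metricMatrix φ u).det)) :=
    (φ.continuousOn_symm.aemeasurable φ.open_target.measurableSet).mono_ac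
      (withDensity_absolutelyContinuous _ _)
  rw [chartVolume, Measure.map_apply_of_aemeasurable hm hA, withDensity_apply',
    inter_comm, Measure.restrict_restrict₀']
  exact φ.open_target.measurableSet.nullMeasurableSet

variable [IsManifold (𝓡 ν) ∞ X]

/-- In the domain of `φ`, the measure defined by any other chart is at most the one defined by `φ`.
The inequality holds because only a part of `φ.source` may be covered by `ψ`. -/
theorem chartVolume_le_of_subset_source (hφ : φ ∈ IsManifold.maximalAtlas (𝓡 ν) ∞ X)
    (hψ : ψ ∈ IsManifold.maximalAtlas (𝓡 ν) ∞ X) {A : Set X} (hA : MeasurableSet A)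
    (hAφ : A ⊆ φ.source) : chartVolume ψ A ≤ chartVolume φ A := by
  rw [chartVolume_apply ψ hA, chartVolume_apply φ hA]
  have hS := ψ.measurableSet_target_inter_preimage_symm hA
  set S := ψ.target ∩ ψ.symm ⁻¹' A
  have hinj : InjOn (φ ∘ ψ.symm) S := fun x hx y hy hxy =>
    ψ.symm.injOn hx.1 hy.1 (φ.injOn (hAφ hx.2) (hAφ hy.2) hxy)
  have hcov := lintegral_image_eq_lintegral_abs_det_fderiv_mul volume hS
    (fun u hu => (sqrt_det_metricMatrix_eq hφ hψ hu.1
      (hAφ hu.2)).1.hasFDerivAt.hasFDerivWithinAt) hinj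
    (fun v => ENNReal.ofReal (Real.sqrt (metricMatrix φ v).det))
  have hsub : (φ ∘ ψ.symm) '' S ⊆ φ.target ∩ φ.symm ⁻¹' A := by
    rintro _ ⟨u, hu, rfl⟩
    refine ⟨φ.map_source (hAφ hu.2), ?_⟩
    simp only [mem_preimage, Function.comp_apply, φ.left_inv (hAφ hu.2)]
    exact hu.2
  calc _ = ∫⁻ u in S, ENNReal.ofReal |(fderiv ℝ (φ ∘ ψ.symm) u).det| *
        ENNReal.ofReal (Real.sqrt (metricMatrix φ ((φ ∘ ψ.symm) u)).det) := by
        refine setLIntegral_congr_fun hS fun u hu => ?_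
        rw [(sqrt_det_metricMatrix_eq hφ hψ hu.1 (hAφ hu.2)).2, ENNReal.ofReal_mul (abs_nonneg _)]
        rfl
    _ = _ := hcov.symm
    _ ≤ _ := lintegral_mono_set hsub

/-- On the domain of a chart the Riemannian measure, a supremum over all charts, is at most the
measure that the chart defines. -/
theorem riemannianVolume_le_chartVolume (hφ : φ ∈ IsManifold.maximalAtlas (𝓡 ν) ∞ X)
    {A : Set X} (hA : A ⊆ φ.source) : riemannianVolume ν X A ≤ chartVolume φ A := by
  have hs := φ.open_source.measurableSet
  have hle : riemannianVolume ν X ≤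
      chartVolume φ + (riemannianVolume ν X).restrict φ.sourceᶜ := by
    conv_lhs => rw [riemannianVolume]
    refine iSup₂_le fun ψ hψ => Measure.le_iff.2 fun B hB => ?_
    rw [← measure_inter_add_sdiff B hs, Measure.add_apply, Measure.restrict_apply hB]
    refine add_le_add ?_ ?_
    · exact (chartVolume_le_of_subset_source hφ hψ (hB.inter hs) inter_subset_right).trans
        (measure_mono inter_subset_left)
    · exact (le_iSup₂ (f := fun ψ (_ : ψ ∈ IsManifold.maximalAtlas (𝓡 ν) ∞ X) =>
        chartVolume ψ) ψ hψ) _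
  refine (hle A).trans ?_
  have h0 : (riemannianVolume ν X).restrict φ.sourceᶜ A = 0 := by
    refine measure_mono_null hA ?_
    rw [Measure.restrict_apply hs, inter_compl_self, measure_empty]
  rw [Measure.add_apply, h0, add_zero]

end ChartVolume

section NormalChart

variable {ν : ℕ} {X : Type*} [MetricSpace X] [ChartedSpace (EuclideanSpace ℝ (Fin ν)) X]
  [RiemannianBundle (fun x : X => TangentSpace (𝓡 ν) x)]

/-- A bound of the quadratic form of the metric bounds its coefficients. -/
theorem abs_metricMatrix_le {φ : OpenPartialHomeomorph X (EuclideanSpace ℝ (Fin ν))}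
    {u : EuclideanSpace ℝ (Fin ν)} {A : ℝ}
    (h : ∀ v : EuclideanSpace ℝ (Fin ν), metricForm φ u v v ≤ A * ‖v‖ ^ 2) (i j : Fin ν) :
    |metricMatrix φ u i j| ≤ A := by
  have h1 : ∀ i, ‖coordVector φ i u‖ ^ 2 ≤ A := by
    intro i
    have := h (EuclideanSpace.single i 1)
    rw [metricForm, sum_metricMatrix_mul] at this
    rw [real_inner_self_eq_norm_sq] at this
    exact this.trans (by simp)
  have h2 : |metricMatrix φ u i j| ≤ ‖coordVector φ i u‖ * ‖coordVector φ j u‖ := by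
    simp only [metricMatrix, Matrix.of_apply]
    exact abs_real_inner_le_norm _ _
  nlinarith [h1 i, h1 j, sq_nonneg (‖coordVector φ i u‖ - ‖coordVector φ j u‖)]

/-- The geodesic equation of the rays in normal coordinates. -/
theorem IsNormalChart.christoffelForm_eq_zero {a : X} {r : ℝ}
    {φ : OpenPartialHomeomorph X (EuclideanSpace ℝ (Fin ν))} (h : IsNormalChart a r φ)
    (t : ℝ) (w : EuclideanSpace ℝ (Fin ν)) (ht : t • w ∈ φ.target) (k : Fin ν) :
    christoffelForm φ (t • w) w w k = 0 := by
  have hr : ‖t • w‖ < r := by simpa [h.target_eq] using ht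
  have hg := (h.geodesic w).2 φ h.mem_maximalAtlas t hr (φ.map_target ht) k
  have hev : ∀ i, (fun τ : ℝ => φ (φ.symm (τ • w)) i) =ᶠ[𝓝 t] fun τ => τ * w i := by
    intro i
    have hc : ContinuousAt (fun τ : ℝ => τ • w) t := by fun_prop
    filter_upwards [hc.preimage_mem_nhds (φ.open_target.mem_nhds ht)] with τ hτ
    rw [φ.right_inv hτ]
    simp
  have hd : ∀ i, deriv (fun τ : ℝ => φ (φ.symm (τ • w)) i) =ᶠ[𝓝 t] fun _ => w i := by
    intro i
    refine (hev i).deriv.trans (Eventually.of_forall fun τ => ?_)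
    simp
  rw [(hd k).deriv_eq, deriv_const, zero_add] at hg
  simp only [(hd _).eq_of_nhds, φ.right_inv ht] at hg
  exact hg

variable [IsManifold (𝓡 ν) ∞ X]
  [IsContMDiffRiemannianBundle (𝓡 ν) ∞ (EuclideanSpace ℝ (Fin ν))
      (fun x : X => TangentSpace (𝓡 ν) x)]

/-- On a manifold of bounded geometry there are normal coordinates of a uniform radius around
each point, and the components of the metric in them are uniformly bounded. -/
theorem BoundedGeometry.exists_normalChart (hX : BoundedGeometry ν X) :
    ∃ R : ℝ, 0 < R ∧ ∃ A : ℝ, 0 ≤ A ∧ ∀ (a : X) (s : ℝ), 0 < s → s ≤ R →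
      ∃ φ : OpenPartialHomeomorph X (EuclideanSpace ℝ (Fin ν)), IsNormalChart a s φ ∧
        ∀ u ∈ φ.target, ∀ v : EuclideanSpace ℝ (Fin ν), metricForm φ u v v ≤ A * ‖v‖ ^ 2 := by
  obtain ⟨ρ, hρ0, hρ⟩ := ENNReal.lt_iff_exists_real_btwn.1 hX.injectivityRadius_pos
  obtain ⟨C, hC⟩ := hX.curvature_bounded 0
  have hρpos : 0 < ρ := ENNReal.ofReal_pos.1 hρ.1
  refine ⟨ρ, hρpos, Real.exp (1 + Real.sqrt |C| * ρ ^ 2), (Real.exp_pos _).le,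
    fun a s hs hsR => ?_⟩
  have h1 : ENNReal.ofReal ρ < injectivityRadius ν a := hρ.2.trans_le (iInf_le _ a)
  obtain ⟨r, h1⟩ := lt_iSup_iff.1 h1
  obtain ⟨hr, h1⟩ := lt_iSup_iff.1 h1
  have hρr : ρ < r := (ENNReal.ofReal_lt_ofReal_iff_of_nonneg hρpos.le).1 h1
  obtain ⟨φ, hφ⟩ := hr s hs (hsR.trans hρr.le)
  refine ⟨φ, hφ, fun u hu v => ?_⟩
  have hus : ‖u‖ < s := by simpa [hφ.target_eq] using hu
  have hseg : ∀ t ∈ Icc (0 : ℝ) 1, t • u ∈ φ.target := by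
    intro t ht
    rw [hφ.target_eq, mem_ball_zero_iff, norm_smul, Real.norm_of_nonneg ht.1]
    nlinarith [norm_nonneg u, ht.1, ht.2]
  have hm := metricForm_le_exp hφ.mem_maximalAtlas hφ.christoffelForm_eq_zero hφ.metric_zero
    (C := Real.sqrt |C|) (fun u hu => ?_) (Real.sqrt_nonneg _) hseg v
  · refine hm.trans ?_
    gcongr
    linarith
  · rw [Real.sq_sqrt (abs_nonneg C)]
    exact (hC φ hφ.mem_maximalAtlas u hu).trans (le_abs_self C)

/-- On a manifold of bounded geometry the volume of small balls of radius `s` is at most a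
uniform multiple of `s ^ ν`. -/
theorem BoundedGeometry.exists_volume_ball_le [MeasurableSpace X] [BorelSpace X]
    (hX : BoundedGeometry ν X) :
    ∃ R : ℝ, 0 < R ∧ ∃ C : ℝ≥0∞, C ≠ ⊤ ∧ ∀ (a : X) (s : ℝ), 0 < s → s ≤ R →
      riemannianVolume ν X (ball a s) ≤ C * ENNReal.ofReal (s ^ ν) := by
  obtain ⟨R, hR, A, hA, h⟩ := hX.exists_normalChart
  refine ⟨R, hR, ENNReal.ofReal (Real.sqrt (ν.factorial * A ^ ν)) *
    volume (ball (0 : EuclideanSpace ℝ (Fin ν)) 1),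
    ENNReal.mul_ne_top ENNReal.ofReal_ne_top measure_ball_lt_top.ne, fun a s hs hsR => ?_⟩
  obtain ⟨φ, hφ, hb⟩ := h a s hs hsR
  refine (riemannianVolume_le_chartVolume hφ.mem_maximalAtlas hφ.source_eq.ge).trans ?_
  rw [chartVolume_apply φ isOpen_ball.measurableSet]
  calc _ ≤ ∫⁻ u in φ.target, ENNReal.ofReal (Real.sqrt (metricMatrix φ u).det) :=
        lintegral_mono_set inter_subset_left
    _ ≤ ∫⁻ u in φ.target, ENNReal.ofReal (Real.sqrt (ν.factorial * A ^ ν)) := by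
        refine setLIntegral_mono_ae' φ.open_target.measurableSet (ae_of_all _ fun u hu => ?_)
        refine ENNReal.ofReal_le_ofReal (Real.sqrt_le_sqrt ?_)
        have := Matrix.det_le (A := metricMatrix φ u) (abv := IsAbsoluteValue.toAbsoluteValue abs)
          (x := A) (fun i j => abs_metricMatrix_le (hb u hu) i j)
        simpa using (le_abs_self _).trans this
    _ = _ := by
        rw [setLIntegral_const, hφ.target_eq, Measure.addHaar_ball_of_pos _ _ hs]
        simp only [finrank_euclideanSpace, Fintype.card_fin]
        ring

end NormalChart

/-! ### Compactness of closed balls -/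

section LengthSpace

variable {ν : ℕ} {X : Type*} [MetricSpace X] [ChartedSpace (EuclideanSpace ℝ (Fin ν)) X]
  [RiemannianBundle (fun x : X => TangentSpace (𝓡 ν) x)]

/-- The length space property: a point of the ball of radius `ρ + η` is close to the ball of radius
`ρ`. -/
theorem exists_mem_ball_dist_lt [IsRiemannianManifold (𝓡 ν) X] {x y : X} {ρ η : ℝ}
    (hρ : 0 < ρ) (hη : 0 < η) (hy : y ∈ ball x (ρ + η)) : ∃ z ∈ ball x ρ, dist y z < 2 * η := by
  by_cases hyρ : dist x y < ρ
  · exact ⟨y, by rwa [mem_ball'], by simpa using hη⟩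
  push Not at hyρ
  set ρ' := max 0 (ρ - η) with hρ'
  have h0 : 0 ≤ ρ' := le_max_left _ _
  have h1 : ρ' < ρ := max_lt hρ (by linarith)
  have h2 : ρ - η ≤ ρ' := le_max_right _ _
  have hlt : Manifold.riemannianEDist (𝓡 ν) x y < ENNReal.ofReal (ρ + η) := by
    rw [← IsRiemannianManifold.out (I := 𝓡 ν) x y, edist_dist]
    rw [mem_ball'] at hy
    exact (ENNReal.ofReal_lt_ofReal_iff (by linarith)).2 hy
  obtain ⟨γ, γ0, γ1, hγ, hL⟩ := Manifold.exists_lt_of_riemannianEDist_lt hlt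
  have hcont : ContinuousOn (fun t => dist x (γ t)) (Icc 0 1) :=
    fun t ht => (continuous_const.dist continuous_id).continuousAt.comp_continuousWithinAt
      (hγ.continuousOn t ht)
  obtain ⟨t, ht, htρ⟩ := intermediate_value_Icc zero_le_one hcont
    (show ρ' ∈ Icc _ _ by simpa [γ0, γ1] using ⟨h0, by linarith⟩)
  have e1 : edist x (γ t) ≤ Manifold.pathELength (𝓡 ν) γ 0 t := by
    rw [IsRiemannianManifold.out (I := 𝓡 ν) x (γ t)]
    exact Manifold.riemannianEDist_le_pathELength (hγ.mono (Icc_subset_Icc le_rfl ht.2)) γ0 rfl ht.1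
  have e2 : edist (γ t) y ≤ Manifold.pathELength (𝓡 ν) γ t 1 := by
    rw [IsRiemannianManifold.out (I := 𝓡 ν) (γ t) y]
    exact Manifold.riemannianEDist_le_pathELength (hγ.mono (Icc_subset_Icc ht.1 le_rfl)) rfl γ1 ht.2
  have e3 : edist x (γ t) + edist (γ t) y < ENNReal.ofReal (ρ + η) := by
    refine (add_le_add e1 e2).trans_lt ?_
    rwa [Manifold.pathELength_add ht.1 ht.2]
  rw [edist_dist, edist_dist, ← ENNReal.ofReal_add dist_nonneg dist_nonneg,
    ENNReal.ofReal_lt_ofReal_iff (by linarith)] at e3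
  simp only [] at htρ
  refine ⟨γ t, by rw [mem_ball']; linarith, ?_⟩
  rw [dist_comm]; linarith

variable [IsManifold (𝓡 ν) ∞ X] [IsRiemannianManifold (𝓡 ν) X]

/-- The inverse of a chart is Lipschitz on convex sets on which the metric is bounded: the images
of segments are short paths. -/
theorem edist_symm_le {φ : OpenPartialHomeomorph X (EuclideanSpace ℝ (Fin ν))}
    (hφ : φ ∈ IsManifold.maximalAtlas (𝓡 ν) ∞ X) (hconv : Convex ℝ φ.target) {A : ℝ}
    (h : ∀ u ∈ φ.target, ∀ v : EuclideanSpace ℝ (Fin ν), metricForm φ u v v ≤ A ^ 2 * ‖v‖ ^ 2)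
    (hA : 0 ≤ A) {u v : EuclideanSpace ℝ (Fin ν)} (hu : u ∈ φ.target) (hv : v ∈ φ.target) :
    edist (φ.symm u) (φ.symm v) ≤ ENNReal.ofReal (A * dist u v) := by
  set c : ℝ → EuclideanSpace ℝ (Fin ν) := fun t => u + t • (v - u) with hc
  have hcd : ∀ t, HasDerivAt c (v - u) t := fun t => by
    simpa [hc] using ((hasDerivAt_id t).smul_const (v - u)).const_add u
  have hct : ∀ t ∈ Icc (0 : ℝ) 1, c t ∈ φ.target := fun t ht =>
    hconv.add_smul_sub_mem hu hv ht
  have hcs : ContMDiff 𝓘(ℝ, ℝ) (𝓡 ν) 1 c := by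
    rw [contMDiff_iff_contDiff]
    exact contDiff_const.add (contDiff_id.smul contDiff_const)
  have hγ : ContMDiffOn 𝓘(ℝ, ℝ) (𝓡 ν) 1 (φ.symm ∘ c) (Icc 0 1) :=
    ((contMDiffOn_symm_of_mem_maximalAtlas hφ).of_le (by simp)).comp hcs.contMDiffOn hct
  rw [IsRiemannianManifold.out (I := 𝓡 ν) (φ.symm u) (φ.symm v)]
  refine (Manifold.riemannianEDist_le_pathELength hγ (by simp [hc]) (by simp [hc])
    zero_le_one).trans ?_
  rw [Manifold.pathELength_eq_lintegral_mfderiv_Icc]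
  have hb : ∀ t ∈ Icc (0 : ℝ) 1, ‖mfderiv 𝓘(ℝ, ℝ) (𝓡 ν) (φ.symm ∘ c) t 1‖ₑ ≤
      ENNReal.ofReal (A * dist u v) := by
    intro t ht
    have h1 : MDifferentiableAt (𝓡 ν) (𝓡 ν) φ.symm (c t) :=
      (mdifferentiable_of_mem_maximalAtlas hφ).mdifferentiableAt_symm (hct t ht)
    have h2 : MDifferentiableAt 𝓘(ℝ, ℝ) (𝓡 ν) c t :=
      mdifferentiableAt_iff_differentiableAt.2 (hcd t).differentiableAt
    rw [mfderiv_comp t h1 h2, mfderiv_eq_fderiv]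
    have h3 : fderiv ℝ c t 1 = v - u := by simpa using (hcd t).deriv
    have h4 := h (c t) (hct t ht) (v - u)
    rw [metricForm, sum_metricMatrix_mul, real_inner_self_eq_norm_sq, ← mul_pow,
      ← dist_eq_norm, dist_comm] at h4
    have h5 := abs_le_of_sq_le_sq' h4 (by positivity)
    rw [← ofReal_norm]
    refine ENNReal.ofReal_le_ofReal (le_trans (le_of_eq ?_) h5.2)
    rw [← h3]; rfl
  calc _ ≤ ∫⁻ t in Icc (0 : ℝ) 1, ENNReal.ofReal (A * dist u v) :=
        setLIntegral_mono_ae' measurableSet_Icc (ae_of_all _ hb)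
    _ = _ := by simp

variable [IsContMDiffRiemannianBundle (𝓡 ν) ∞ (EuclideanSpace ℝ (Fin ν))
      (fun x : X => TangentSpace (𝓡 ν) x)]

/-- Balls of a small uniform radius are totally bounded, being Lipschitz images of Euclidean balls.
For larger ones the radius is increased step by step: a finite net of a ball serves, with larger
mesh, for a slightly larger ball. -/
theorem BoundedGeometry.totallyBounded_ball (hX : BoundedGeometry ν X) (x : X) (r : ℝ) :
    TotallyBounded (ball x r) := by
  obtain ⟨R, hR, A, hA, h⟩ := hX.exists_normalChart
  have hsmall : ∀ a : X, TotallyBounded (ball a R) := by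
    intro a
    obtain ⟨φ, hφ, hb⟩ := h a R hR le_rfl
    have hlip : ∀ u ∈ φ.target, ∀ v ∈ φ.target,
        dist (φ.symm u) (φ.symm v) ≤ Real.sqrt A * dist u v := by
      intro u hu v hv
      have := edist_symm_le hφ.mem_maximalAtlas (A := Real.sqrt A)
        (by rw [hφ.target_eq]; exact convex_ball _ _)
        (by rwa [Real.sq_sqrt hA]) (Real.sqrt_nonneg _) hu hv
      rw [edist_dist] at this
      exact (ENNReal.ofReal_le_ofReal_iff (by positivity)).1 this
    have himg : ball a R = φ.symm '' φ.target := by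
      rw [φ.symm_image_target_eq_source, hφ.source_eq]
    have htb : TotallyBounded φ.target := by
      rw [hφ.target_eq]
      exact (isCompact_closedBall 0 R).totallyBounded.subset ball_subset_closedBall
    rw [Metric.totallyBounded_iff]
    intro ε hε
    obtain ⟨t, ht, hft, hcov⟩ := Metric.finite_approx_of_totallyBounded htb
      (ε / (Real.sqrt A + 1)) (by positivity)
    refine ⟨φ.symm '' t, hft.image _, ?_⟩
    rw [himg]
    rintro _ ⟨u, hu, rfl⟩
    obtain ⟨v, hv, huv⟩ := mem_iUnion₂.1 (hcov hu)
    refine mem_iUnion₂.2 ⟨φ.symm v, mem_image_of_mem _ hv, ?_⟩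
    rw [mem_ball] at huv ⊢
    rw [lt_div_iff₀ (by positivity)] at huv
    have := hlip u hu v (ht hv)
    nlinarith [dist_nonneg (x := u) (y := v)]
  have hstep : ∀ ρ : ℝ, 0 < ρ → TotallyBounded (ball x ρ) →
      TotallyBounded (ball x (ρ + R / 3)) := by
    intro ρ hρ hT
    obtain ⟨t, -, hft, hcov⟩ := Metric.finite_approx_of_totallyBounded hT (R / 3) (by positivity)
    refine TotallyBounded.subset ?_ ((totallyBounded_biUnion hft).2 fun y _ => hsmall y)
    intro y hy
    obtain ⟨z, hz, hyz⟩ := exists_mem_ball_dist_lt (ν := ν) hρ (by positivity) hy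
    obtain ⟨w, hw, hzw⟩ := mem_iUnion₂.1 (hcov hz)
    refine mem_iUnion₂.2 ⟨w, hw, ?_⟩
    rw [mem_ball] at hzw ⊢
    linarith [dist_triangle y z w]
  have hn : ∀ n : ℕ, TotallyBounded (ball x ((n + 1) * (R / 3))) := by
    intro n
    induction n with
    | zero => exact (hsmall x).subset (ball_subset_ball (by push_cast; linarith))
    | succ n ih =>
      have := hstep _ (by positivity) ih
      convert this using 2
      push_cast; ring
  obtain ⟨n, hn'⟩ := exists_nat_gt (r / (R / 3))
  refine (hn n).subset (ball_subset_ball ?_)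
  rw [div_lt_iff₀ (by positivity)] at hn'
  linarith

theorem BoundedGeometry.properSpace [CompleteSpace X] (hX : BoundedGeometry ν X) :
    ProperSpace X :=
  ⟨fun x r => TotallyBounded.isCompact_of_isClosed
    ((hX.totallyBounded_ball x (r + 1)).subset (closedBall_subset_ball (by linarith)))
    isClosed_closedBall⟩

theorem BoundedGeometry.volume_ball_lt_top [MeasurableSpace X] [BorelSpace X]
    (hX : BoundedGeometry ν X) (x : X) (r : ℝ) : riemannianVolume ν X (ball x r) < ⊤ := by
  obtain ⟨R, hR, C, hC, h⟩ := hX.exists_volume_ball_le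
  obtain ⟨t, -, hft, hcov⟩ := Metric.finite_approx_of_totallyBounded
    (hX.totallyBounded_ball x r) R hR
  refine (measure_mono hcov).trans_lt ?_
  refine (measure_biUnion_lt_top hft fun y _ => ?_)
  exact (h y R hR le_rfl).trans_lt (ENNReal.mul_lt_top hC.lt_top ENNReal.ofReal_lt_top)

end LengthSpace

/-! ### Integrals of a singular power -/

/-- The weight `max(1, 1/t)`; the bound `max(1, t ^ (-α))` of a kernel at distance `t > 0` is its
power with exponent `α`. Its value at `t = 0` is `1`, by the convention
`0⁻¹ = 0`. -/
noncomputable def singWeight (t : ℝ) : ℝ := max 1 t⁻¹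

theorem one_le_singWeight (t : ℝ) : 1 ≤ singWeight t := le_max_left _ _

theorem singWeight_pos (t : ℝ) : 0 < singWeight t := zero_lt_one.trans_le (one_le_singWeight t)

theorem singWeight_anti {s t : ℝ} (hs : 0 < s) (hst : s ≤ t) : singWeight t ≤ singWeight s :=
  max_le_max le_rfl (inv_anti₀ hs hst)

theorem singWeight_of_le_one {t : ℝ} (ht : 0 < t) (h1 : t ≤ 1) : singWeight t = t⁻¹ :=
  max_eq_right ((one_le_inv₀ ht).2 h1)

theorem measurable_singWeight : Measurable singWeight :=
  measurable_const.max measurable_inv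

theorem singWeight_half_le (t : ℝ) : singWeight (t / 2) ≤ 2 * singWeight t := by
  refine max_le (by linarith [one_le_singWeight t]) ?_
  have : t⁻¹ ≤ singWeight t := le_max_right _ _
  rw [inv_div, div_eq_mul_inv]
  linarith

theorem one_le_singWeight_rpow (t : ℝ) {a : ℝ} (ha : 0 ≤ a) : 1 ≤ singWeight t ^ a :=
  Real.one_le_rpow (one_le_singWeight t) ha

/-- The volume of balls of radius `s ≤ R` is at most `C s ^ ν`, uniformly in the centre, and the
volume of every ball is finite. The radius `R` is at most `1`, so that the weight is the inverse of
the distance on balls of this radius. -/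
structure UniformVolumeGrowth {X : Type*} [MetricSpace X] [MeasurableSpace X] (ν : ℕ)
    (μ : Measure X) (R : ℝ) (C : ℝ≥0∞) : Prop where
  dim_pos : 0 < ν
  radius_pos : 0 < R
  radius_le_one : R ≤ 1
  const_ne_top : C ≠ ⊤
  ball_le : ∀ (x : X) (s : ℝ), 0 < s → s ≤ R → μ (ball x s) ≤ C * ENNReal.ofReal (s ^ ν)
  ball_lt_top : ∀ (x : X) (s : ℝ), μ (ball x s) < ⊤

/-- An integral over a union of sets on which the integrals are bounded by a geometric sequence. -/
theorem lintegral_le_geometric {X : Type*} [MeasurableSpace X] {μ : Measure X} {A : Set X}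
    {S : ℕ → Set X} {f : X → ℝ≥0∞} {D : ℝ≥0∞} {B q : ℝ} (hA : A ⊆ ⋃ j, S j) (hB : 0 ≤ B)
    (hq0 : 0 ≤ q) (hq1 : q < 1) (h : ∀ j, ∫⁻ z in S j, f z ∂μ ≤ D * ENNReal.ofReal (B * q ^ j)) :
    ∫⁻ z in A, f z ∂μ ≤ D * ENNReal.ofReal (B * (1 - q)⁻¹) := by
  calc _ ≤ ∫⁻ z in ⋃ j, S j, f z ∂μ := lintegral_mono_set hA
    _ ≤ ∑' j, ∫⁻ z in S j, f z ∂μ := lintegral_iUnion_le _ _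
    _ ≤ ∑' j, D * ENNReal.ofReal (B * q ^ j) := ENNReal.tsum_le_tsum h
    _ = D * ENNReal.ofReal (B * (1 - q)⁻¹) := by
        rw [ENNReal.tsum_mul_left, ← ENNReal.ofReal_tsum_of_nonneg (fun j => by positivity)
          ((summable_geometric_of_lt_one hq0 hq1).mul_left B), tsum_mul_left,
          tsum_geometric_of_lt_one hq0 hq1]

theorem setLIntegral_ofReal_le {X : Type*} [MeasurableSpace X] {μ : Measure X} {S : Set X}
    (hS : MeasurableSet S) {f : X → ℝ} {b : ℝ} {m : ℝ≥0∞} (hf : ∀ z ∈ S, f z ≤ b)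
    (hm : μ S ≤ m) : ∫⁻ z in S, ENNReal.ofReal (f z) ∂μ ≤ ENNReal.ofReal b * m := by
  calc _ ≤ ∫⁻ _ in S, ENNReal.ofReal b ∂μ :=
        setLIntegral_mono_ae' hS (ae_of_all _ fun z hz => ENNReal.ofReal_le_ofReal (hf z hz))
    _ = ENNReal.ofReal b * μ S := setLIntegral_const _ _
    _ ≤ _ := by gcongr

theorem UniformVolumeGrowth.tendsto_measure_ball {X : Type*} [MetricSpace X]
    [MeasurableSpace X] {ν : ℕ} {μ : Measure X} {R : ℝ} {C : ℝ≥0∞}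
    (h : UniformVolumeGrowth ν μ R C) (x : X) :
    Tendsto (fun s : ℝ => μ (ball x s)) (𝓝[>] 0) (𝓝 0) := by
  have hlim : Tendsto (fun s : ℝ => C * ENNReal.ofReal (s ^ ν)) (𝓝[>] 0) (𝓝 0) := by
    have h1 : Tendsto (fun s : ℝ => ENNReal.ofReal (s ^ ν)) (𝓝 0) (𝓝 0) := by
      have : Continuous fun s : ℝ => ENNReal.ofReal (s ^ ν) :=
        ENNReal.continuous_ofReal.comp (continuous_pow ν)
      simpa [h.dim_pos.ne'] using this.tendsto 0
    simpa using (ENNReal.Tendsto.const_mul h1 (Or.inr h.const_ne_top)).mono_left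
      nhdsWithin_le_nhds
  refine tendsto_of_tendsto_of_tendsto_of_le_of_le' tendsto_const_nhds hlim
    (Eventually.of_forall fun _ => zero_le) ?_
  filter_upwards [Ioc_mem_nhdsGT h.radius_pos] with s hs
  exact h.ball_le x s hs.1 hs.2

theorem UniformVolumeGrowth.measure_singleton {X : Type*} [MetricSpace X]
    [MeasurableSpace X] {ν : ℕ} {μ : Measure X} {R : ℝ} {C : ℝ≥0∞}
    (h : UniformVolumeGrowth ν μ R C) (x : X) : μ {x} = 0 := by
  refine le_antisymm (ge_of_tendsto (h.tendsto_measure_ball x) ?_) zero_le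
  filter_upwards [self_mem_nhdsWithin] with s hs
  exact measure_mono (singleton_subset_iff.2 (mem_ball_self hs))

theorem mul_pow_rpow {r : ℝ} {b : ℝ} (hr : 0 ≤ r) (hb : 0 ≤ b) (e : ℝ) (j : ℕ) :
    (r * b ^ j) ^ e = r ^ e * (b ^ e) ^ j := by
  rw [Real.mul_rpow hr (by positivity), Real.rpow_pow_comm hb]

section

variable {X : Type*} [MetricSpace X] [MeasurableSpace X] [BorelSpace X] {ν : ℕ} {μ : Measure X}
  {R : ℝ} {C : ℝ≥0∞}

theorem UniformVolumeGrowth.lintegral_outer_le (h : UniformVolumeGrowth ν μ R C) {a : ℝ}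
    (ha : 0 ≤ a) (x p : X) {r : ℝ} (hr : 0 < r) :
    ∫⁻ z in ball p R ∩ (ball x r)ᶜ, ENNReal.ofReal (singWeight (dist x z) ^ a) ∂μ ≤
      ENNReal.ofReal (singWeight r ^ a) * (C * ENNReal.ofReal (R ^ ν)) := by
  refine setLIntegral_ofReal_le (measurableSet_ball.inter measurableSet_ball.compl)
    (fun z hz => ?_) ((measure_mono inter_subset_left).trans (h.ball_le p R h.radius_pos le_rfl))
  have : r ≤ dist x z := by simpa [dist_comm] using hz.2
  exact Real.rpow_le_rpow (singWeight_pos _).le (singWeight_anti hr this) ha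

/-- The integral over a small ball of a power of the distance to its centre. -/
theorem UniformVolumeGrowth.lintegral_ball_le (h : UniformVolumeGrowth ν μ R C) {a : ℝ}
    (ha : 0 ≤ a) (haν : a < ν) : ∃ D : ℝ≥0∞, D ≠ ⊤ ∧ ∀ (x : X) (r : ℝ), 0 < r → r ≤ R →
      ∫⁻ z in ball x r, ENNReal.ofReal (singWeight (dist x z) ^ a) ∂μ ≤
        D * ENNReal.ofReal (r ^ (ν - a)) := by
  set q : ℝ := 2⁻¹ ^ (ν - a) with hq
  have hq0 : 0 ≤ q := by positivity
  have hq1 : q < 1 := Real.rpow_lt_one (by norm_num) (by norm_num) (by linarith)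
  refine ⟨C * ENNReal.ofReal (2 ^ a * (1 - q)⁻¹),
    ENNReal.mul_ne_top h.const_ne_top ENNReal.ofReal_ne_top, fun x r hr hrR => ?_⟩
  -- decomposition into dyadic annuli that shrink to `x`
  set S : ℕ → Set X := fun j => ball x (r * 2⁻¹ ^ j) ∩ (ball x (r * 2⁻¹ ^ (j + 1)))ᶜ with hS
  have hcov : ball x r \ {x} ⊆ ⋃ j, S j := by
    rintro z ⟨hz, hzx⟩
    have hd : 0 < dist z x := dist_pos.2 hzx
    have hlim : ∃ j : ℕ, r * 2⁻¹ ^ j ≤ dist z x := by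
      obtain ⟨j, hj⟩ := exists_pow_lt_of_lt_one (div_pos hd hr) (by norm_num : (2⁻¹ : ℝ) < 1)
      exact ⟨j, by rw [lt_div_iff₀ hr] at hj; linarith⟩
    classical
    have hj0 : Nat.find hlim ≠ 0 := by
      intro h0
      have := Nat.find_spec hlim
      rw [h0] at this
      rw [mem_ball] at hz
      simp at this
      linarith
    obtain ⟨j, hj⟩ := Nat.exists_eq_succ_of_ne_zero hj0
    refine mem_iUnion.2 ⟨j, ?_, ?_⟩
    · have := Nat.find_min hlim (m := j) (by omega)
      rw [mem_ball]; exact not_le.1 this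
    · have := Nat.find_spec hlim
      rw [hj] at this
      simpa using this
  have hmain := lintegral_le_geometric (μ := μ) (A := ball x r \ {x}) (S := S)
    (f := fun z => ENNReal.ofReal (singWeight (dist x z) ^ a)) (D := C)
    (B := 2 ^ a * r ^ (ν - a)) hcov (by positivity) hq0 hq1 (fun j => ?_)
  · have e : ∫⁻ z in ball x r, ENNReal.ofReal (singWeight (dist x z) ^ a) ∂μ =
        ∫⁻ z in ball x r \ {x}, ENNReal.ofReal (singWeight (dist x z) ^ a) ∂μ := by
      refine setLIntegral_congr ?_
      exact (sdiff_null_ae_eq_self (h.measure_singleton x)).symm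
    rw [e]
    refine hmain.trans (le_of_eq ?_)
    rw [mul_assoc C, ← ENNReal.ofReal_mul (by have := sub_pos.2 hq1; positivity)]
    congr 2
    ring
  · have hrj : 0 < r * 2⁻¹ ^ (j + 1) := by positivity
    have hrj1 : r * 2⁻¹ ^ (j + 1) ≤ 1 :=
      mul_le_one₀ (hrR.trans h.radius_le_one) (by positivity)
        (pow_le_one₀ (by norm_num) (by norm_num))
    have hrj' : r * 2⁻¹ ^ j ≤ R :=
      (mul_le_of_le_one_right hr.le (pow_le_one₀ (by norm_num) (by norm_num))).trans hrR
    have := setLIntegral_ofReal_le (μ := μ)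
      (measurableSet_ball.inter measurableSet_ball.compl : MeasurableSet (S j))
      (f := fun z => singWeight (dist x z) ^ a) (b := singWeight (r * 2⁻¹ ^ (j + 1)) ^ a)
      (fun z hz => by
        have : r * 2⁻¹ ^ (j + 1) ≤ dist x z := by simpa [dist_comm] using hz.2
        exact Real.rpow_le_rpow (singWeight_pos _).le (singWeight_anti hrj this) ha)
      ((measure_mono inter_subset_left).trans (h.ball_le x _ (by positivity) hrj'))
    refine this.trans (le_of_eq ?_)
    rw [mul_left_comm, ← ENNReal.ofReal_mul (Real.rpow_nonneg (singWeight_pos _).le _),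
      singWeight_of_le_one hrj hrj1]
    congr 2
    have hm : 0 < r * 2⁻¹ ^ j := by positivity
    have e1 : r * 2⁻¹ ^ (j + 1) = r * 2⁻¹ ^ j / 2 := by rw [pow_succ]; ring
    rw [mul_assoc, hq, ← mul_pow_rpow hr.le (by norm_num), e1, inv_div,
      Real.div_rpow (by norm_num) hm.le, Real.rpow_sub hm, Real.rpow_natCast]
    ring

/-- The integral of a power of the weight over a ball of radius `R`, uniformly in the position
of the singularity. -/
theorem UniformVolumeGrowth.lintegral_le (h : UniformVolumeGrowth ν μ R C) {a : ℝ}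
    (ha : 0 ≤ a) (haν : a < ν) : ∃ D : ℝ≥0∞, D ≠ ⊤ ∧ ∀ x p : X,
      ∫⁻ z in ball p R, ENNReal.ofReal (singWeight (dist x z) ^ a) ∂μ ≤ D := by
  obtain ⟨D, hD, hb⟩ := h.lintegral_ball_le ha haν
  refine ⟨D * ENNReal.ofReal (R ^ (ν - a)) +
    ENNReal.ofReal (singWeight R ^ a) * (C * ENNReal.ofReal (R ^ ν)), ?_, fun x p => ?_⟩
  · finiteness [hD, h.const_ne_top]
  · rw [← lintegral_inter_add_sdiff _ _ (measurableSet_ball (x := x) (ε := R))]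
    exact add_le_add ((lintegral_mono_set inter_subset_right).trans
      (hb x R h.radius_pos le_rfl)) (h.lintegral_outer_le ha x p h.radius_pos)

/-- The integral of an integrable power of the weight near its singularity. -/
theorem UniformVolumeGrowth.lintegral_inner_le (h : UniformVolumeGrowth ν μ R C) {a : ℝ}
    (ha : 0 ≤ a) (haν : a < ν) : ∃ D : ℝ≥0∞, D ≠ ⊤ ∧ ∀ (x p : X) (r : ℝ), 0 < r →
      ∫⁻ z in ball p R ∩ ball x r, ENNReal.ofReal (singWeight (dist x z) ^ a) ∂μ ≤
        D * ENNReal.ofReal (singWeight r ^ (a - ν)) := by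
  obtain ⟨D, hD, hb⟩ := h.lintegral_ball_le ha haν
  obtain ⟨D', hD', hb'⟩ := h.lintegral_le ha haν
  refine ⟨D + D' * ENNReal.ofReal (singWeight R ^ (ν - a)), by finiteness [hD, hD'],
    fun x p r hr => ?_⟩
  rcases le_total r R with hrR | hrR
  · refine (lintegral_mono_set inter_subset_right).trans ((hb x r hr hrR).trans ?_)
    rw [singWeight_of_le_one hr (hrR.trans h.radius_le_one), Real.inv_rpow hr.le,
      ← Real.rpow_neg hr.le, neg_sub]
    gcongr
    exact le_self_add
  · refine (lintegral_mono_set inter_subset_left).trans ((hb' x p).trans ?_)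
    rw [add_mul, mul_assoc, ← ENNReal.ofReal_mul (Real.rpow_nonneg (singWeight_pos _).le _)]
    refine le_trans ?_ le_add_self
    have h1 : 1 ≤ singWeight R ^ (ν - a) * singWeight r ^ (a - ν) := by
      rw [← neg_sub (ν : ℝ) a, Real.rpow_neg (singWeight_pos _).le, ← div_eq_mul_inv,
        one_le_div (Real.rpow_pos_of_pos (singWeight_pos _) _)]
      exact Real.rpow_le_rpow (singWeight_pos _).le (singWeight_anti h.radius_pos hrR)
        (by linarith)
    calc D' = D' * 1 := (mul_one _).symm
      _ ≤ _ := by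
        gcongr
        simpa using ENNReal.ofReal_le_ofReal h1

/-- The integral of a non-integrable power of the weight away from its singularity. -/
theorem UniformVolumeGrowth.lintegral_compl_ball_le (h : UniformVolumeGrowth ν μ R C) {c : ℝ}
    (hc : (ν : ℝ) < c) : ∃ D : ℝ≥0∞, D ≠ ⊤ ∧ ∀ (x p : X) (r : ℝ), 0 < r →
      ∫⁻ z in ball p R ∩ (ball x r)ᶜ, ENNReal.ofReal (singWeight (dist x z) ^ c) ∂μ ≤
        D * ENNReal.ofReal (singWeight r ^ (c - ν)) := by
  have hc0 : 0 ≤ c := (Nat.cast_nonneg ν).trans hc.le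
  set q : ℝ := 2 ^ (ν - c) with hq
  have hq0 : 0 ≤ q := by positivity
  have hq1 : q < 1 := Real.rpow_lt_one_of_one_lt_of_neg (by norm_num) (by linarith)
  -- the contribution of the complement of the ball of radius `R`
  set D₁ : ℝ≥0∞ := ENNReal.ofReal (singWeight R ^ c) * (C * ENNReal.ofReal (R ^ ν))
  have hone : ∀ r, (1 : ℝ≥0∞) ≤ ENNReal.ofReal (singWeight r ^ (c - ν)) := fun r => by
    simpa using ENNReal.ofReal_le_ofReal (one_le_singWeight_rpow r (sub_nonneg.2 hc.le))
  have hD₁ : D₁ ≠ ⊤ := by finiteness [h.const_ne_top]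
  refine ⟨D₁ + C * ENNReal.ofReal (2 ^ ν * (1 - q)⁻¹), by finiteness [h.const_ne_top],
    fun x p r hr => ?_⟩
  rcases le_total R r with hrR | hrR
  · calc _ ≤ ∫⁻ z in ball p R ∩ (ball x R)ᶜ, ENNReal.ofReal (singWeight (dist x z) ^ c) ∂μ :=
          lintegral_mono_set (inter_subset_inter_right _
            (compl_subset_compl.2 (ball_subset_ball hrR)))
      _ ≤ D₁ * 1 := by rw [mul_one]; exact h.lintegral_outer_le hc0 x p h.radius_pos
      _ ≤ _ := by gcongr; exacts [le_self_add, hone r]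
  -- decomposition into dyadic annuli that grow from radius `r` to radius `R`
  set S : ℕ → Set X := fun j => ball x (min R (r * 2 ^ (j + 1))) ∩ (ball x (r * 2 ^ j))ᶜ with hS
  have hcov : ball x R ∩ (ball x r)ᶜ ⊆ ⋃ j, S j := by
    rintro z ⟨hz, hzx⟩
    rw [mem_ball] at hz
    have hd : r ≤ dist z x := by simpa using hzx
    have hlim : ∃ j : ℕ, dist z x < r * 2 ^ j := by
      obtain ⟨j, hj⟩ := pow_unbounded_of_one_lt (dist z x / r) (by norm_num : (1 : ℝ) < 2)
      exact ⟨j, by rw [div_lt_iff₀ hr] at hj; linarith⟩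
    classical
    have hj0 : Nat.find hlim ≠ 0 := by
      intro h0
      have := Nat.find_spec hlim
      rw [h0] at this
      simp at this
      linarith
    obtain ⟨j, hj⟩ := Nat.exists_eq_succ_of_ne_zero hj0
    refine mem_iUnion.2 ⟨j, ?_, ?_⟩
    · have := Nat.find_spec hlim
      rw [hj] at this
      rw [mem_ball]
      exact lt_min hz this
    · have := Nat.find_min hlim (m := j) (by omega)
      simpa using this
  have hmain := lintegral_le_geometric (μ := μ) (A := ball x R ∩ (ball x r)ᶜ) (S := S)
    (f := fun z => ENNReal.ofReal (singWeight (dist x z) ^ c)) (D := C)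
    (B := 2 ^ ν * r ^ (ν - c)) hcov (by positivity) hq0 hq1 (fun j => ?_)
  · rw [← lintegral_inter_add_sdiff _ _ (measurableSet_ball (x := x) (ε := R)), add_mul, add_comm]
    refine add_le_add ?_ ?_
    · calc _ ≤ ∫⁻ z in ball p R ∩ (ball x R)ᶜ, ENNReal.ofReal (singWeight (dist x z) ^ c) ∂μ :=
            lintegral_mono_set (fun z hz => ⟨hz.1.1, hz.2⟩)
        _ ≤ D₁ * 1 := by rw [mul_one]; exact h.lintegral_outer_le hc0 x p h.radius_pos
        _ ≤ _ := by gcongr; exact hone r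
    · calc _ ≤ ∫⁻ z in ball x R ∩ (ball x r)ᶜ, ENNReal.ofReal (singWeight (dist x z) ^ c) ∂μ :=
            lintegral_mono_set (fun z hz => ⟨hz.2, hz.1.2⟩)
        _ ≤ _ := hmain
        _ = _ := by
          rw [mul_assoc C, ← ENNReal.ofReal_mul (by have := sub_pos.2 hq1; positivity),
            singWeight_of_le_one hr (hrR.trans h.radius_le_one), Real.inv_rpow hr.le,
            ← Real.rpow_neg hr.le, neg_sub]
          congr 2
          ring
  · have hm : 0 < r * 2 ^ j := by positivity
    have hrm : r * 2 ^ (j + 1) = 2 * (r * 2 ^ j) := by rw [pow_succ]; ring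
    by_cases hmR : R ≤ r * 2 ^ j
    · have : S j = ∅ := by
        refine eq_empty_of_forall_notMem fun z hz => hz.2 ?_
        have := (mem_ball.1 hz.1).trans_le (min_le_left _ _)
        exact mem_ball.2 (this.trans_le hmR)
      rw [this]; simp
    push Not at hmR
    have hvol : μ (S j) ≤ C * ENNReal.ofReal ((2 * (r * 2 ^ j)) ^ ν) := by
      refine (measure_mono inter_subset_left).trans ((h.ball_le x _ (lt_min h.radius_pos
        (by positivity)) (min_le_left _ _)).trans ?_)
      rw [hrm]
      have : 0 ≤ min R (2 * (r * 2 ^ j)) := le_min h.radius_pos.le (by positivity)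
      gcongr
      exact min_le_right _ _
    have := setLIntegral_ofReal_le (μ := μ)
      (measurableSet_ball.inter measurableSet_ball.compl : MeasurableSet (S j))
      (f := fun z => singWeight (dist x z) ^ c) (b := singWeight (r * 2 ^ j) ^ c)
      (fun z hz => by
        have : r * 2 ^ j ≤ dist x z := by simpa [dist_comm] using hz.2
        exact Real.rpow_le_rpow (singWeight_pos _).le (singWeight_anti hm this) hc0) hvol
    refine this.trans (le_of_eq ?_)
    rw [mul_left_comm, ← ENNReal.ofReal_mul (Real.rpow_nonneg (singWeight_pos _).le _),
      singWeight_of_le_one hm (hmR.le.trans h.radius_le_one)]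
    congr 2
    rw [mul_assoc, hq, ← mul_pow_rpow hr.le (by norm_num), Real.rpow_sub hm, Real.rpow_natCast,
      Real.inv_rpow hm.le, mul_pow]
    ring

end

/-! ### Integrals of a product of two singular powers -/

/-- A product of powers with two bases is at most the sum of the powers with the total exponent. -/
theorem Real.rpow_mul_rpow_le_add {u v a b : ℝ} (hu : 0 < u) (hv : 0 < v) (ha : 0 ≤ a)
    (hb : 0 ≤ b) : u ^ a * v ^ b ≤ u ^ (a + b) + v ^ (a + b) := by
  rcases le_total u v with h | h
  · calc _ ≤ v ^ a * v ^ b := by gcongr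
      _ = v ^ (a + b) := (Real.rpow_add hv _ _).symm
      _ ≤ _ := le_add_of_nonneg_left (Real.rpow_nonneg hu.le _)
  · calc _ ≤ u ^ a * u ^ b := by gcongr
      _ = u ^ (a + b) := (Real.rpow_add hu _ _).symm
      _ ≤ _ := le_add_of_nonneg_right (Real.rpow_nonneg hv.le _)

section

variable {X : Type*} [MetricSpace X] [MeasurableSpace X] [BorelSpace X] {ν : ℕ} {μ : Measure X}
  {R : ℝ} {C : ℝ≥0∞}

@[fun_prop]
theorem measurable_ofReal_singWeight_rpow (x : X) (a : ℝ) :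
    Measurable fun z => ENNReal.ofReal (singWeight (dist x z) ^ a) :=
  ((measurable_singWeight.comp (continuous_const.dist continuous_id).measurable).pow_const
    a).ennreal_ofReal

/-- Two singularities of total order below the dimension. -/
theorem UniformVolumeGrowth.lintegral_two_le_of_lt (h : UniformVolumeGrowth ν μ R C) {a b : ℝ}
    (ha : 0 ≤ a) (hb : 0 ≤ b) (hab : a + b < ν) : ∃ D : ℝ≥0∞, D ≠ ⊤ ∧ ∀ x y p : X,
      ∫⁻ z in ball p R, ENNReal.ofReal
        (singWeight (dist x z) ^ a * singWeight (dist y z) ^ b) ∂μ ≤ D := by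
  obtain ⟨D, hD, hle⟩ := h.lintegral_le (add_nonneg ha hb) hab
  refine ⟨D + D, by finiteness, fun x y p => ?_⟩
  calc _ ≤ ∫⁻ z in ball p R, (ENNReal.ofReal (singWeight (dist x z) ^ (a + b)) +
        ENNReal.ofReal (singWeight (dist y z) ^ (a + b))) ∂μ := by
        refine lintegral_mono fun z => ?_
        rw [← ENNReal.ofReal_add (Real.rpow_nonneg (singWeight_pos _).le _)
          (Real.rpow_nonneg (singWeight_pos _).le _)]
        exact ENNReal.ofReal_le_ofReal
          (Real.rpow_mul_rpow_le_add (singWeight_pos _) (singWeight_pos _) ha hb)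
    _ = _ := lintegral_add_left (by fun_prop) _
    _ ≤ _ := add_le_add (hle x p) (hle y p)

theorem UniformVolumeGrowth.lintegral_two_inner_le (h : UniformVolumeGrowth ν μ R C) {a b : ℝ}
    (ha : 0 ≤ a) (hb : 0 ≤ b) (haν : a < ν) : ∃ D : ℝ≥0∞, D ≠ ⊤ ∧ ∀ x y p : X, x ≠ y →
      ∫⁻ z in ball p R ∩ ball x (dist x y / 2), ENNReal.ofReal
        (singWeight (dist x z) ^ a * singWeight (dist y z) ^ b) ∂μ ≤
        D * ENNReal.ofReal (singWeight (dist x y / 2) ^ (a + b - ν)) := by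
  obtain ⟨D, hD, hle⟩ := h.lintegral_inner_le ha haν
  refine ⟨D, hD, fun x y p hxy => ?_⟩
  have hd : 0 < dist x y / 2 := half_pos (dist_pos.2 hxy)
  calc _ ≤ ∫⁻ z in ball p R ∩ ball x (dist x y / 2),
        ENNReal.ofReal (singWeight (dist x y / 2) ^ b) *
          ENNReal.ofReal (singWeight (dist x z) ^ a) ∂μ := by
        refine setLIntegral_mono_ae' (measurableSet_ball.inter measurableSet_ball)
          (ae_of_all _ fun z hz => ?_)
        rw [← ENNReal.ofReal_mul (Real.rpow_nonneg (singWeight_pos _).le _), mul_comm]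
        refine ENNReal.ofReal_le_ofReal (mul_le_mul_of_nonneg_right ?_
          (Real.rpow_nonneg (singWeight_pos _).le _))
        have hz2 : dist z x < dist x y / 2 := hz.2
        have : dist x y / 2 ≤ dist y z := by
          linarith [dist_triangle x z y, dist_comm x z, dist_comm y z]
        exact Real.rpow_le_rpow (singWeight_pos _).le (singWeight_anti hd this) hb
    _ = ENNReal.ofReal (singWeight (dist x y / 2) ^ b) *
        ∫⁻ z in ball p R ∩ ball x (dist x y / 2),
          ENNReal.ofReal (singWeight (dist x z) ^ a) ∂μ := lintegral_const_mul _ (by fun_prop)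
    _ ≤ ENNReal.ofReal (singWeight (dist x y / 2) ^ b) *
        (D * ENNReal.ofReal (singWeight (dist x y / 2) ^ (a - ν))) := by
        gcongr; exact hle x p _ hd
    _ = _ := by
        rw [mul_left_comm, ← ENNReal.ofReal_mul (Real.rpow_nonneg (singWeight_pos _).le _),
          ← Real.rpow_add (singWeight_pos _)]
        congr 3; ring

/-- Two singularities, each of order below the dimension `ν`, of total order above it: away from
the two singular points the integrand is bounded by powers with one centre. -/
theorem UniformVolumeGrowth.lintegral_two_le_of_gt (h : UniformVolumeGrowth ν μ R C) {a b : ℝ}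
    (ha : 0 ≤ a) (hb : 0 ≤ b) (haν : a < ν) (hbν : b < ν) (hab : (ν : ℝ) < a + b) :
    ∃ D : ℝ≥0∞, D ≠ ⊤ ∧ ∀ x y p : X, x ≠ y →
      ∫⁻ z in ball p R, ENNReal.ofReal
        (singWeight (dist x z) ^ a * singWeight (dist y z) ^ b) ∂μ ≤
        D * ENNReal.ofReal (singWeight (dist x y) ^ (a + b - ν)) := by
  obtain ⟨D₁, hD₁, h₁⟩ := h.lintegral_two_inner_le ha hb haν
  obtain ⟨D₂, hD₂, h₂⟩ := h.lintegral_two_inner_le hb ha hbν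
  obtain ⟨D₃, hD₃, h₃⟩ := h.lintegral_compl_ball_le hab
  refine ⟨(D₁ + D₂ + (D₃ + D₃)) * ENNReal.ofReal (2 ^ (a + b - ν)), by finiteness,
    fun x y p hxy => ?_⟩
  set ρ := dist x y / 2 with hρ
  have hρ0 : 0 < ρ := half_pos (dist_pos.2 hxy)
  set f : X → ℝ≥0∞ := fun z => ENNReal.ofReal
        (singWeight (dist x z) ^ a * singWeight (dist y z) ^ b) with hf
  have hρw : ENNReal.ofReal (singWeight ρ ^ (a + b - ν)) ≤ ENNReal.ofReal (2 ^ (a + b - ν)) *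
      ENNReal.ofReal (singWeight (dist x y) ^ (a + b - ν)) := by
    rw [← ENNReal.ofReal_mul (by positivity),
      ← Real.mul_rpow (by norm_num) (singWeight_pos _).le]
    exact ENNReal.ofReal_le_ofReal (Real.rpow_le_rpow (singWeight_pos _).le
      (singWeight_half_le _) (by linarith))
  set S := ball p R ∩ (ball x ρ)ᶜ ∩ (ball y ρ)ᶜ with hS
  have hcov : ball p R ⊆ (ball p R ∩ ball x ρ) ∪ ((ball p R ∩ ball y ρ) ∪ S) := by
    intro z hz
    by_cases h1 : z ∈ ball x ρ
    · exact Or.inl ⟨hz, h1⟩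
    · by_cases h2 : z ∈ ball y ρ
      · exact Or.inr (Or.inl ⟨hz, h2⟩)
      · exact Or.inr (Or.inr ⟨⟨hz, h1⟩, h2⟩)
  have i1 := h₁ x y p hxy
  have i2 : ∫⁻ z in ball p R ∩ ball y ρ, f z ∂μ ≤
      D₂ * ENNReal.ofReal (singWeight ρ ^ (a + b - ν)) := by
    have := h₂ y x p hxy.symm
    rw [dist_comm y x, ← hρ, add_comm b a] at this
    simpa only [hf, mul_comm] using this
  have i3 : ∫⁻ z in S, f z ∂μ ≤ (D₃ + D₃) * ENNReal.ofReal (singWeight ρ ^ (a + b - ν)) := by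
    calc _ ≤ ∫⁻ z in S, (ENNReal.ofReal (singWeight (dist x z) ^ (a + b)) +
          ENNReal.ofReal (singWeight (dist y z) ^ (a + b))) ∂μ := by
          refine lintegral_mono fun z => ?_
          rw [← ENNReal.ofReal_add (Real.rpow_nonneg (singWeight_pos _).le _)
            (Real.rpow_nonneg (singWeight_pos _).le _)]
          exact ENNReal.ofReal_le_ofReal
            (Real.rpow_mul_rpow_le_add (singWeight_pos _) (singWeight_pos _) ha hb)
      _ = _ := lintegral_add_left (by fun_prop) _
      _ ≤ _ := by
          rw [add_mul]
          exact add_le_add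
            ((lintegral_mono_set (fun z hz => hz.1)).trans (h₃ x p ρ hρ0))
            ((lintegral_mono_set (show S ⊆ ball p R ∩ (ball y ρ)ᶜ from
              fun z hz => ⟨hz.1.1, hz.2⟩)).trans (h₃ y p ρ hρ0))
  calc ∫⁻ z in ball p R, f z ∂μ
      ≤ ∫⁻ z in (ball p R ∩ ball x ρ) ∪ ((ball p R ∩ ball y ρ) ∪ S), f z ∂μ :=
        lintegral_mono_set hcov
    _ ≤ ∫⁻ z in ball p R ∩ ball x ρ, f z ∂μ + (∫⁻ z in ball p R ∩ ball y ρ, f z ∂μ +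
          ∫⁻ z in S, f z ∂μ) :=
        (lintegral_union_le _ _ _).trans (add_le_add le_rfl (lintegral_union_le _ _ _))
    _ ≤ (D₁ + D₂ + (D₃ + D₃)) * ENNReal.ofReal (singWeight ρ ^ (a + b - ν)) := by
        rw [add_mul, add_mul, add_assoc]
        exact add_le_add i1 (add_le_add i2 i3)
    _ ≤ _ := by rw [mul_assoc]; gcongr

/-- The bound of the composition of two singular powers, in terms of an exponent `γ` that
dominates the order `a + b - ν` of the singularity of the composition; `γ = 0` is allowed only if
the total order of the singularities is below the dimension. -/
theorem UniformVolumeGrowth.lintegral_two_le (h : UniformVolumeGrowth ν μ R C) {a b γ : ℝ}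
    (ha : 0 ≤ a) (hb : 0 ≤ b) (haν : a < ν) (hbν : b < ν) (hγ : 0 ≤ γ) (hab : a + b - ν ≤ γ)
    (hγ' : γ = 0 → a + b < ν) :
    ∃ D : ℝ≥0∞, D ≠ ⊤ ∧ ∀ x y p : X, (a + b < ν ∨ x ≠ y) →
      ∫⁻ z in ball p R, ENNReal.ofReal
        (singWeight (dist x z) ^ a * singWeight (dist y z) ^ b) ∂μ ≤
        D * ENNReal.ofReal (singWeight (dist x y) ^ γ) := by
  by_cases hlt : a + b < ν
  · obtain ⟨D, hD, hle⟩ := h.lintegral_two_le_of_lt ha hb hlt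
    refine ⟨D, hD, fun x y p _ => (hle x y p).trans ?_⟩
    calc D = D * 1 := (mul_one D).symm
      _ ≤ _ := by
        gcongr
        simpa using ENNReal.ofReal_le_ofReal (one_le_singWeight_rpow (dist x y) hγ)
  · have hγ0 : 0 < γ := lt_of_le_of_ne hγ fun h0 => hlt (hγ' h0.symm)
    -- if `a + b = ν`, the exponent `a` is increased a little, to avoid a logarithm
    obtain ⟨a', haa', ha'ν, ha'b, ha'γ⟩ : ∃ a', a ≤ a' ∧ a' < ν ∧ (ν : ℝ) < a' + b ∧
        a' + b - ν ≤ γ := by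
      push Not at hlt
      rcases hlt.eq_or_lt with heq | hgt
      · refine ⟨a + min γ ((ν - a) / 2), ?_, ?_, ?_, ?_⟩
        · have : 0 ≤ min γ ((ν - a) / 2) := le_min hγ (by linarith)
          linarith
        · linarith [min_le_right γ ((ν - a) / 2)]
        · have : 0 < min γ ((ν - a) / 2) := lt_min hγ0 (by linarith)
          linarith
        · linarith [min_le_left γ ((ν - a) / 2)]
      · exact ⟨a, le_rfl, haν, hgt, hab⟩
    obtain ⟨D, hD, hle⟩ := h.lintegral_two_le_of_gt (ha.trans haa') hb ha'ν hbν ha'b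
    refine ⟨D, hD, fun x y p hxy => ?_⟩
    calc _ ≤ ∫⁻ z in ball p R, ENNReal.ofReal
          (singWeight (dist x z) ^ a' * singWeight (dist y z) ^ b) ∂μ := by
          refine lintegral_mono fun z => ENNReal.ofReal_le_ofReal ?_
          have := Real.rpow_nonneg (singWeight_pos (dist y z)).le b
          gcongr
          exact one_le_singWeight _
      _ ≤ D * ENNReal.ofReal (singWeight (dist x y) ^ (a' + b - ν)) :=
          hle x y p (hxy.resolve_left hlt)
      _ ≤ _ := by
          gcongr
          exact one_le_singWeight _

end

/-! ### The product of the two kernels -/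

/-- A bounded function in `L^m` lies in `L^s` for `s ≥ m`, with a norm bounded in terms of the
two bounds. -/
theorem exists_eLpNorm_le_of_bound {m s : ℝ≥0∞} (hm : m ≠ 0) (hms : m ≤ s) (B : ℝ)
    {M : ℝ≥0∞} (hM : M ≠ ⊤) : ∃ D : ℝ≥0∞, D ≠ ⊤ ∧
      ∀ {X : Type*} [MeasurableSpace X] (μ : Measure X) (f : X → ℂ),
        (∀ᵐ x ∂μ, ‖f x‖ ≤ B) → eLpNorm f m μ ≤ M → eLpNorm f s μ ≤ D := by
  by_cases hs : s = ⊤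
  · subst hs
    refine ⟨ENNReal.ofReal B, ENNReal.ofReal_ne_top, fun μ f hf _ => ?_⟩
    rw [eLpNorm_exponent_top]
    exact eLpNormEssSup_le_of_ae_bound hf
  have hmt : m ≠ ⊤ := fun h => hs (top_le_iff.1 (h ▸ hms))
  have hs0 : s ≠ 0 := fun h => hm (le_zero_iff.1 (h ▸ hms))
  have hmr : 0 < m.toReal := ENNReal.toReal_pos hm hmt
  have hsr : 0 < s.toReal := ENNReal.toReal_pos hs0 hs
  have hle : m.toReal ≤ s.toReal := ENNReal.toReal_mono hs hms
  refine ⟨(ENNReal.ofReal B ^ (s.toReal - m.toReal) * M ^ m.toReal) ^ (1 / s.toReal),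
    ?_, fun μ f hf hfM => ?_⟩
  · refine ENNReal.rpow_ne_top_of_nonneg (by positivity) (ENNReal.mul_ne_top ?_ ?_)
    · exact ENNReal.rpow_ne_top_of_nonneg (by linarith) ENNReal.ofReal_ne_top
    · exact ENNReal.rpow_ne_top_of_nonneg hmr.le hM
  · rw [eLpNorm_eq_lintegral_rpow_enorm_toReal hs0 hs]
    rw [eLpNorm_eq_lintegral_rpow_enorm_toReal hm hmt, one_div,
      ENNReal.rpow_inv_le_iff hmr] at hfM
    refine ENNReal.rpow_le_rpow ?_ (by positivity)
    calc _ ≤ ∫⁻ x, ENNReal.ofReal B ^ (s.toReal - m.toReal) * ‖f x‖ₑ ^ m.toReal ∂μ := by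
          refine lintegral_mono_ae ?_
          filter_upwards [hf] with x hx
          have h1 : ‖f x‖ₑ ≤ ENNReal.ofReal B := by
            rw [← ofReal_norm]; exact ENNReal.ofReal_le_ofReal hx
          calc ‖f x‖ₑ ^ s.toReal = ‖f x‖ₑ ^ (s.toReal - m.toReal) * ‖f x‖ₑ ^ m.toReal := by
                rw [← ENNReal.rpow_add_of_nonneg _ _ (by linarith) hmr.le, sub_add_cancel]
            _ ≤ _ := by gcongr
      _ = ENNReal.ofReal B ^ (s.toReal - m.toReal) * ∫⁻ x, ‖f x‖ₑ ^ m.toReal ∂μ :=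
          lintegral_const_mul' _ _
            (ENNReal.rpow_ne_top_of_nonneg (by linarith) ENNReal.ofReal_ne_top)
      _ ≤ _ := by gcongr

theorem singWeight_dist_rpow_le {X : Type*} [MetricSpace X] {x y : X} (h : x ≠ y) (α : ℝ) :
    singWeight (dist x y) ^ α ≤ max 1 (dist x y ^ (-α)) := by
  have hd := dist_pos.2 h
  rcases le_total 1 (dist x y)⁻¹ with h1 | h1
  · rw [singWeight, max_eq_right h1, Real.inv_rpow hd.le, ← Real.rpow_neg hd.le]
    exact le_max_right _ _
  · rw [singWeight, max_eq_left h1, Real.one_rpow]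
    exact le_max_left _ _

section

variable {X : Type*} [MetricSpace X] [MeasurableSpace X] {ν : ℕ} {μ : Measure X}
  {α α₁ α₂ : ℝ} {q q₁ q₂ : ℝ≥0∞} {K K₁ K₂ : X → X → ℂ}

/-- The bound of a kernel in terms of the weight. -/
theorem MemKernelClass.exists_norm_le (hK : MemKernelClass ν μ α q K) :
    ∃ c : ℝ, 0 < c ∧ ∀ x z, (0 < α → x ≠ z) → ‖K x z‖ ≤ c * singWeight (dist x z) ^ α := by
  obtain ⟨c, hc, h⟩ := hK.bound
  refine ⟨c, hc, fun x z hxz => (h x z hxz).trans (mul_le_mul_of_nonneg_left ?_ hc.le)⟩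
  refine max_le (one_le_singWeight_rpow _ hK.exponent_nonneg) ?_
  by_cases hd : x = z
  · have hα : α = 0 := le_antisymm (not_lt.1 fun h0 => hxz h0 hd) hK.exponent_nonneg
    simp [hα]
  · rw [Real.rpow_neg dist_nonneg, ← Real.inv_rpow dist_nonneg]
    exact Real.rpow_le_rpow (inv_nonneg.2 dist_nonneg) (le_max_right _ _) hK.exponent_nonneg

theorem aestronglyMeasurable_mul_kernel (hK₁ : MemKernelClass ν μ α₁ q₁ K₁)
    (hK₂ : MemKernelClass ν μ α₂ q₂ K₂) (x y : X) :
    AEStronglyMeasurable (fun z => K₁ x z * K₂ z y) μ :=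
  (hK₁.aestronglyMeasurable_left x).mul (hK₂.aestronglyMeasurable_right y)

/-- The kernels multiply to a function in `L^s` away from both singular points, uniformly in
these, for all `s` with `1 / s ≤ 1 / q₁ + 1 / q₂`. -/
theorem MemKernelClass.exists_eLpNorm_far_le [BorelSpace X] (hK₁ : MemKernelClass ν μ α₁ q₁ K₁)
    (hK₂ : MemKernelClass ν μ α₂ q₂ K₂) {s : ℝ≥0∞} (hs : s⁻¹ ≤ q₁⁻¹ + q₂⁻¹) {r : ℝ} (hr : 0 < r) :
    ∃ D : ℝ≥0∞, D ≠ ⊤ ∧ ∀ x y : X,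
      eLpNorm (fun z => K₁ x z * K₂ z y) s (μ.restrict (ball x r ∪ ball y r)ᶜ) ≤ D := by
  obtain ⟨c₁, hc₁, hb₁⟩ := hK₁.exists_norm_le
  obtain ⟨c₂, hc₂, hb₂⟩ := hK₂.exists_norm_le
  have := ENNReal.HolderTriple.of q₁ q₂
  set m := (q₁⁻¹ + q₂⁻¹)⁻¹ with hm
  have hm0 : m ≠ 0 := by
    rw [hm, ENNReal.inv_ne_zero]
    have h1 : q₁ ≠ 0 := (zero_lt_one.trans_le hK₁.one_le).ne'
    have h2 : q₂ ≠ 0 := (zero_lt_one.trans_le hK₂.one_le).ne'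
    exact ENNReal.add_ne_top.2 ⟨ENNReal.inv_ne_top.2 h1, ENNReal.inv_ne_top.2 h2⟩
  have hms : m ≤ s := by rw [hm, ENNReal.inv_le_iff_inv_le]; exact hs
  obtain ⟨D, hD, h⟩ := exists_eLpNorm_le_of_bound hm0 hms
    ((c₁ * singWeight r ^ α₁) * (c₂ * singWeight r ^ α₂))
    (ENNReal.mul_ne_top (hK₁.offDiagNorm_lt_top r hr).ne (hK₂.offDiagNorm_lt_top r hr).ne)
  refine ⟨D, hD, fun x y => h _ _ ?_ ?_⟩
  · refine (ae_restrict_iff' (measurableSet_ball.union measurableSet_ball).compl).2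
      (ae_of_all _ fun z hz => ?_)
    rw [compl_union] at hz
    have h1 : r ≤ dist x z := by simpa [dist_comm] using hz.1
    have h2 : r ≤ dist z y := by simpa using hz.2
    have hx : x ≠ z := dist_pos.1 (hr.trans_le h1)
    have hy : z ≠ y := dist_pos.1 (hr.trans_le h2)
    rw [norm_mul]
    have g1 := Real.rpow_le_rpow (singWeight_pos _).le (singWeight_anti hr h1) hK₁.exponent_nonneg
    have g2 := Real.rpow_le_rpow (singWeight_pos _).le (singWeight_anti hr h2) hK₂.exponent_nonneg
    refine mul_le_mul ((hb₁ x z fun _ => hx).trans (by gcongr))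
      ((hb₂ z y fun _ => hy).trans (by gcongr)) (norm_nonneg _) ?_
    have := Real.rpow_nonneg (singWeight_pos r).le α₁
    positivity
  · have hsub : μ.restrict (ball x r ∪ ball y r)ᶜ ≤ μ.restrict (ball x r)ᶜ :=
      Measure.restrict_mono (compl_subset_compl.2 subset_union_left) le_rfl
    have hsub' : μ.restrict (ball x r ∪ ball y r)ᶜ ≤ μ.restrict (ball y r)ᶜ :=
      Measure.restrict_mono (compl_subset_compl.2 subset_union_right) le_rfl
    have hmul := eLpNorm_smul_le_mul_eLpNorm (p := q₁) (q := q₂) (r := m)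
      (μ := μ.restrict (ball x r ∪ ball y r)ᶜ)
      (hK₂.aestronglyMeasurable_right y).restrict (hK₁.aestronglyMeasurable_left x).restrict
    refine hmul.trans (mul_le_mul' ?_ ?_)
    · refine (eLpNorm_mono_measure _ hsub).trans ?_
      rw [← eLpNorm_indicator_eq_eLpNorm_restrict measurableSet_ball.compl]
      exact (le_iSup (fun x => eLpNorm ((ball x r)ᶜ.indicator fun z => K₁ x z) q₁ μ) x).trans
        (le_max_left _ _)
    · refine (eLpNorm_mono_measure _ hsub').trans ?_
      rw [← eLpNorm_indicator_eq_eLpNorm_restrict measurableSet_ball.compl]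
      exact (le_iSup (fun y => eLpNorm ((ball y r)ᶜ.indicator fun z => K₂ z y) q₂ μ) y).trans
        (le_max_right _ _)

theorem ENNReal.mul_ofReal_lt_natCast_iff {s : ℝ≥0∞} (hs : s ≠ ⊤) {a : ℝ} {n : ℕ} :
    s * ENNReal.ofReal a < n ↔ s.toReal * a < n ∧ 0 < n := by
  rw [← ENNReal.ofReal_toReal hs, ← ENNReal.ofReal_mul ENNReal.toReal_nonneg,
    ← ENNReal.ofReal_natCast, ENNReal.ofReal_lt_ofReal_iff', ENNReal.toReal_ofReal
    ENNReal.toReal_nonneg, Nat.cast_pos]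

/-- The kernels multiply to a function in `L^s` near the singular points; here `γ` dominates the
order `α₁ + α₂ - ν / s` of the singularity of the `L^s` norm on the diagonal. -/
theorem UniformVolumeGrowth.exists_eLpNorm_near_le [BorelSpace X] {R : ℝ} {C : ℝ≥0∞}
    (h : UniformVolumeGrowth ν μ R C) (hK₁ : MemKernelClass ν μ α₁ q₁ K₁)
    (hK₂ : MemKernelClass ν μ α₂ q₂ K₂) {s : ℝ≥0∞} (hs1 : 1 ≤ s)
    (h₁ : s * ENNReal.ofReal α₁ < ν) (h₂ : s * ENNReal.ofReal α₂ < ν) {γ : ℝ} (hγ : 0 ≤ γ)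
    (h₃ : s * ENNReal.ofReal (α₁ + α₂) ≤ ν + s * ENNReal.ofReal γ)
    (h₄ : γ = 0 → s * ENNReal.ofReal (α₁ + α₂) < ν) :
    ∃ D : ℝ≥0∞, D ≠ ⊤ ∧ ∀ x y p : X, (s * ENNReal.ofReal (α₁ + α₂) < ν ∨ x ≠ y) →
      eLpNorm (fun z => K₁ x z * K₂ z y) s (μ.restrict (ball p R)) ≤
        D * ENNReal.ofReal (singWeight (dist x y) ^ γ) := by
  obtain ⟨c₁, hc₁, hb₁⟩ := hK₁.exists_norm_le
  obtain ⟨c₂, hc₂, hb₂⟩ := hK₂.exists_norm_le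
  have hα₁ := hK₁.exponent_nonneg
  have hα₂ := hK₂.exponent_nonneg
  have hae : ∀ x y : X, ∀ᵐ z ∂μ, ‖K₁ x z * K₂ z y‖ ≤
      (c₁ * c₂) * (singWeight (dist x z) ^ α₁ * singWeight (dist y z) ^ α₂) := by
    intro x y
    have hx : ∀ᵐ z ∂μ, z ≠ x := by
      rw [ae_iff]; simpa using h.measure_singleton x
    have hy : ∀ᵐ z ∂μ, z ≠ y := by
      rw [ae_iff]; simpa using h.measure_singleton y
    filter_upwards [hx, hy] with z hzx hzy
    rw [norm_mul]
    have g1 := hb₁ x z fun _ => hzx.symm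
    have g2 := hb₂ z y fun _ => hzy
    rw [dist_comm z y] at g2
    calc _ ≤ (c₁ * singWeight (dist x z) ^ α₁) * (c₂ * singWeight (dist y z) ^ α₂) :=
          mul_le_mul g1 g2 (norm_nonneg _) ((norm_nonneg _).trans g1)
      _ = _ := by ring
  by_cases hs : s = ⊤
  · subst hs
    have z1 : α₁ = 0 := by
      by_contra hne
      have : 0 < α₁ := lt_of_le_of_ne hα₁ (Ne.symm hne)
      rw [ENNReal.top_mul (ENNReal.ofReal_pos.2 this).ne'] at h₁
      exact not_top_lt h₁
    have z2 : α₂ = 0 := by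
      by_contra hne
      have : 0 < α₂ := lt_of_le_of_ne hα₂ (Ne.symm hne)
      rw [ENNReal.top_mul (ENNReal.ofReal_pos.2 this).ne'] at h₂
      exact not_top_lt h₂
    refine ⟨ENNReal.ofReal (c₁ * c₂), ENNReal.ofReal_ne_top, fun x y p _ => ?_⟩
    calc _ ≤ ENNReal.ofReal (c₁ * c₂) * 1 := by
          rw [eLpNorm_exponent_top, mul_one]
          refine eLpNormEssSup_le_of_ae_bound (ae_restrict_of_ae ?_)
          filter_upwards [hae x y] with z hz
          simpa [z1, z2] using hz
      _ ≤ _ := by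
          gcongr
          simpa using ENNReal.ofReal_le_ofReal (one_le_singWeight_rpow (dist x y) hγ)
  set t := s.toReal with ht
  have ht1 : 1 ≤ t := by simpa using ENNReal.toReal_mono hs hs1
  have ht0 : 0 < t := zero_lt_one.trans_le ht1
  have hs0 : s ≠ 0 := (zero_lt_one.trans_le hs1).ne'
  have i1 := ((ENNReal.mul_ofReal_lt_natCast_iff hs).1 h₁).1
  have i2 := ((ENNReal.mul_ofReal_lt_natCast_iff hs).1 h₂).1
  have i3 : t * α₁ + t * α₂ - ν ≤ t * γ := by
    rw [← ENNReal.ofReal_toReal hs, ← ENNReal.ofReal_mul ENNReal.toReal_nonneg,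
      ← ENNReal.ofReal_mul ENNReal.toReal_nonneg, ← ENNReal.ofReal_natCast,
      ← ENNReal.ofReal_add (Nat.cast_nonneg _) (by positivity),
      ENNReal.ofReal_le_ofReal_iff (by positivity)] at h₃
    linarith
  have i5 : s * ENNReal.ofReal (α₁ + α₂) < ν ↔ t * α₁ + t * α₂ < ν := by
    rw [ENNReal.mul_ofReal_lt_natCast_iff hs, ← mul_add]
    exact and_iff_left h.dim_pos
  have i4 : t * γ = 0 → t * α₁ + t * α₂ < ν := fun h0 =>
    i5.1 (h₄ ((mul_eq_zero.1 h0).resolve_left ht0.ne'))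
  obtain ⟨D, hD, hle⟩ := h.lintegral_two_le (mul_nonneg ht0.le hα₁) (mul_nonneg ht0.le hα₂) i1 i2
    (mul_nonneg ht0.le hγ) i3 i4
  refine ⟨(ENNReal.ofReal ((c₁ * c₂) ^ t) * D) ^ (1 / t),
    ENNReal.rpow_ne_top_of_nonneg (by positivity) (ENNReal.mul_ne_top ENNReal.ofReal_ne_top hD),
    fun x y p hxy => ?_⟩
  rw [eLpNorm_eq_lintegral_rpow_enorm_toReal hs0 hs, ← ht]
  have hmain : ∫⁻ z in ball p R, ‖K₁ x z * K₂ z y‖ₑ ^ t ∂μ ≤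
      ENNReal.ofReal ((c₁ * c₂) ^ t) * D * ENNReal.ofReal (singWeight (dist x y) ^ γ) ^ t := by
    calc _ ≤ ∫⁻ z in ball p R, ENNReal.ofReal ((c₁ * c₂) ^ t) * ENNReal.ofReal
          (singWeight (dist x z) ^ (t * α₁) * singWeight (dist y z) ^ (t * α₂)) ∂μ := by
          refine lintegral_mono_ae (ae_restrict_of_ae ?_)
          filter_upwards [hae x y] with z hz
          rw [← ofReal_norm, ENNReal.ofReal_rpow_of_nonneg (norm_nonneg _) ht0.le,
            ← ENNReal.ofReal_mul (by positivity)]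
          refine ENNReal.ofReal_le_ofReal ((Real.rpow_le_rpow (norm_nonneg _) hz ht0.le).trans
            (le_of_eq ?_))
          have p1 := (singWeight_pos (dist x z)).le
          have p2 := (singWeight_pos (dist y z)).le
          rw [Real.mul_rpow (x := c₁ * c₂) (by positivity) (by positivity),
            Real.mul_rpow (Real.rpow_nonneg p1 _) (Real.rpow_nonneg p2 _),
            ← Real.rpow_mul p1, ← Real.rpow_mul p2, mul_comm α₁, mul_comm α₂]
      _ = ENNReal.ofReal ((c₁ * c₂) ^ t) * ∫⁻ z in ball p R, ENNReal.ofReal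
          (singWeight (dist x z) ^ (t * α₁) * singWeight (dist y z) ^ (t * α₂)) ∂μ :=
          lintegral_const_mul' _ _ ENNReal.ofReal_ne_top
      _ ≤ _ := by
          rw [mul_assoc]
          gcongr
          refine (hle x y p (hxy.imp_left i5.1)).trans (le_of_eq ?_)
          have p1 := (singWeight_pos (dist x y)).le
          rw [ENNReal.ofReal_rpow_of_nonneg (Real.rpow_nonneg p1 _) ht0.le, ← Real.rpow_mul p1,
            mul_comm γ]
  refine (ENNReal.rpow_le_rpow hmain (by positivity)).trans (le_of_eq ?_)
  rw [ENNReal.mul_rpow_of_nonneg _ _ (by positivity), ← ENNReal.rpow_mul,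
    mul_one_div_cancel ht0.ne',
    ENNReal.rpow_one]

/-- Hölder's inequality for the integrand of the composition. -/
theorem lintegral_compIntegrand_le (hK₁ : MemKernelClass ν μ α₁ q₁ K₁)
    (hK₂ : MemKernelClass ν μ α₂ q₂ K₂) {V : X → ℂ} (hV : AEStronglyMeasurable V μ)
    {p s : ℝ≥0∞} (hps : ENNReal.HolderConjugate p s) (x y : X) (A : Set X) :
    ∫⁻ z in A, ‖compIntegrand K₁ K₂ V x y z‖ₑ ∂μ ≤
      eLpNorm V p (μ.restrict A) * eLpNorm (fun z => K₁ x z * K₂ z y) s (μ.restrict A) := by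
  have := eLpNorm_smul_le_mul_eLpNorm (p := p) (q := s) (r := 1) (μ := μ.restrict A)
    (aestronglyMeasurable_mul_kernel hK₁ hK₂ x y).restrict hV.restrict
  rw [eLpNorm_one_eq_lintegral_enorm] at this
  refine le_trans (le_of_eq ?_) this
  refine lintegral_congr fun z => ?_
  congr 1
  simp only [compIntegrand, Pi.smul_apply', smul_eq_mul]
  ring

end

/-! ### Kernel bounds for the composition -/

theorem compIntegrand_sum {X ι : Type*} [Fintype ι] (K₁ K₂ : X → X → ℂ) (V : ι → X → ℂ)
    (x y z : X) : compIntegrand K₁ K₂ (fun z => ∑ k, V k z) x y z =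
      ∑ k, compIntegrand K₁ K₂ (V k) x y z := by
  simp only [compIntegrand, Finset.mul_sum, Finset.sum_mul]

theorem UniformVolumeGrowth.isLocallyFiniteMeasure {X : Type*} [MetricSpace X]
    [MeasurableSpace X] {ν : ℕ} {μ : Measure X} {R : ℝ} {C : ℝ≥0∞}
    (h : UniformVolumeGrowth ν μ R C) : IsLocallyFiniteMeasure μ :=
  ⟨fun x => ⟨ball x 1, ball_mem_nhds x one_pos, h.ball_lt_top x 1⟩⟩

section

variable {X : Type*} [MetricSpace X] [MeasurableSpace X] {ν : ℕ} {μ : Measure X}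
  {α₁ α₂ : ℝ} {q₁ q₂ : ℝ≥0∞} {K₁ K₂ : X → X → ℂ}

theorem aestronglyMeasurable_compIntegrand (hK₁ : MemKernelClass ν μ α₁ q₁ K₁)
    (hK₂ : MemKernelClass ν μ α₂ q₂ K₂) {V : X → ℂ} (hV : AEStronglyMeasurable V μ) (x y : X) :
    AEStronglyMeasurable (compIntegrand K₁ K₂ V x y) μ :=
  ((hK₁.aestronglyMeasurable_left x).mul hV).mul (hK₂.aestronglyMeasurable_right y)

/-- The integral of `|F(x, y, ·)|` is bounded by a power of the weight, uniformly in `x` and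
`y`. -/
theorem UniformVolumeGrowth.exists_lintegral_compIntegrand_le [BorelSpace X] {R : ℝ} {C : ℝ≥0∞}
    (h : UniformVolumeGrowth ν μ R C) (hK₁ : MemKernelClass ν μ α₁ q₁ K₁)
    (hK₂ : MemKernelClass ν μ α₂ q₂ K₂) {p s : ℝ≥0∞} (hps : ENNReal.HolderConjugate p s)
    (hs : s⁻¹ ≤ q₁⁻¹ + q₂⁻¹) (h₁ : s * ENNReal.ofReal α₁ < ν) (h₂ : s * ENNReal.ofReal α₂ < ν)
    {γ : ℝ} (hγ : 0 ≤ γ) (h₃ : s * ENNReal.ofReal (α₁ + α₂) ≤ ν + s * ENNReal.ofReal γ)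
    (h₄ : γ = 0 → s * ENNReal.ofReal (α₁ + α₂) < ν) {V : X → ℂ} (hV : MemLp V p μ) :
    ∃ D : ℝ≥0∞, D ≠ ⊤ ∧ ∀ x y : X, (s * ENNReal.ofReal (α₁ + α₂) < ν ∨ x ≠ y) →
      ∫⁻ z, ‖compIntegrand K₁ K₂ V x y z‖ₑ ∂μ ≤
        D * ENNReal.ofReal (singWeight (dist x y) ^ γ) := by
  have hs1 : 1 ≤ s := by have := hps.symm; exact ENNReal.HolderConjugate.one_le s p
  obtain ⟨D, hD, hnear⟩ := h.exists_eLpNorm_near_le hK₁ hK₂ hs1 h₁ h₂ hγ h₃ h₄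
  obtain ⟨D', hD', hfar⟩ := hK₁.exists_eLpNorm_far_le hK₂ hs h.radius_pos
  have hVt := hV.eLpNorm_ne_top
  refine ⟨eLpNorm V p μ * (D + D + D'), by finiteness, fun x y hxy => ?_⟩
  have hA : ∀ A : Set X, ∫⁻ z in A, ‖compIntegrand K₁ K₂ V x y z‖ₑ ∂μ ≤
      eLpNorm V p μ * eLpNorm (fun z => K₁ x z * K₂ z y) s (μ.restrict A) := fun A =>
    (lintegral_compIntegrand_le hK₁ hK₂ hV.1 hps x y A).trans
      (mul_le_mul_left (eLpNorm_mono_measure _ Measure.restrict_le_self) _)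
  have hone : (1 : ℝ≥0∞) ≤ ENNReal.ofReal (singWeight (dist x y) ^ γ) := by
    simpa using ENNReal.ofReal_le_ofReal (one_le_singWeight_rpow (dist x y) hγ)
  rw [← setLIntegral_univ, ← union_compl_self (ball x R ∪ ball y R)]
  refine (lintegral_union_le _ _ _).trans
    ((add_le_add_left (lintegral_union_le _ _ _) _).trans ?_)
  refine (add_le_add (add_le_add (hA _) (hA _)) (hA _)).trans ?_
  rw [← mul_add, ← mul_add, mul_assoc, add_mul, add_mul]
  gcongr
  · exact hnear x y x hxy
  · exact hnear x y y hxy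
  · calc _ ≤ D' * 1 := by rw [mul_one]; exact hfar x y
      _ ≤ _ := by gcongr

/-- A bound of the integrals of `|F(x, y, ·)|` by a power of the weight puts the composition into
the corresponding class of kernels. -/
theorem memKernelClass_compKernel [BorelSpace X] [SFinite μ] (hK₁ : MemKernelClass ν μ α₁ q₁ K₁)
    (hK₂ : MemKernelClass ν μ α₂ q₂ K₂) {V : X → ℂ} (hV : AEStronglyMeasurable V μ) {γ : ℝ}
    (hγ : 0 ≤ γ) (hγν : γ < ν) {D : ℝ≥0∞} (hD : D ≠ ⊤)
    (hle : ∀ x y, (0 < γ → x ≠ y) → ∫⁻ z, ‖compIntegrand K₁ K₂ V x y z‖ₑ ∂μ ≤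
      D * ENNReal.ofReal (singWeight (dist x y) ^ γ)) :
    MemKernelClass ν μ γ ⊤ (compKernel μ K₁ K₂ V) := by
  have hnorm : ∀ x y, (0 < γ → x ≠ y) →
      ‖compKernel μ K₁ K₂ V x y‖ ≤ (D.toReal + 1) * singWeight (dist x y) ^ γ := by
    intro x y hxy
    have hw := Real.rpow_nonneg (singWeight_pos (dist x y)).le γ
    have h1 : ‖compKernel μ K₁ K₂ V x y‖ₑ ≤ D * ENNReal.ofReal (singWeight (dist x y) ^ γ) :=
      (enorm_integral_le_lintegral_enorm _).trans (hle x y hxy)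
    have h2 := ENNReal.toReal_mono (by finiteness) h1
    rw [toReal_enorm, ENNReal.toReal_mul, ENNReal.toReal_ofReal hw] at h2
    linarith
  have hfar : ∀ r : ℝ, 0 < r → ∀ x y, r ≤ dist x y →
      ‖compKernel μ K₁ K₂ V x y‖ ≤ (D.toReal + 1) * singWeight r ^ γ := by
    intro r hr x y hxy
    refine (hnorm x y fun _ => dist_pos.1 (hr.trans_le hxy)).trans ?_
    have := singWeight_pos (dist x y)
    gcongr
    exact singWeight_anti hr hxy
  refine ⟨hγ, hγν, le_top, ?_, fun x => ?_, fun y => ?_, ?_, fun r hr => ?_⟩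
  · refine AEStronglyMeasurable.integral_prod_right'
      (f := fun w : (X × X) × X => compIntegrand K₁ K₂ V w.1.1 w.1.2 w.2) ?_
    have e1 := hK₁.aestronglyMeasurable.comp_quasiMeasurePreserving
      (QuasiMeasurePreserving.prodMap (Measure.quasiMeasurePreserving_fst (μ := μ) (ν := μ))
        (Measure.QuasiMeasurePreserving.id μ))
    have e2 := hK₂.aestronglyMeasurable.prod_swap.comp_quasiMeasurePreserving
      (QuasiMeasurePreserving.prodMap (Measure.quasiMeasurePreserving_snd (μ := μ) (ν := μ))
        (Measure.QuasiMeasurePreserving.id μ))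
    have e3 := hV.comp_quasiMeasurePreserving
      (Measure.quasiMeasurePreserving_snd (μ := μ.prod μ) (ν := μ))
    exact (e1.mul e3).mul e2
  · refine AEStronglyMeasurable.integral_prod_right'
      (f := fun w : X × X => compIntegrand K₁ K₂ V x w.1 w.2) ?_
    have e1 := (hK₁.aestronglyMeasurable_left x).comp_quasiMeasurePreserving
      (Measure.quasiMeasurePreserving_snd (μ := μ) (ν := μ))
    have e3 := hV.comp_quasiMeasurePreserving
      (Measure.quasiMeasurePreserving_snd (μ := μ) (ν := μ))
    exact (e1.mul e3).mul hK₂.aestronglyMeasurable.prod_swap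
  · refine AEStronglyMeasurable.integral_prod_right'
      (f := fun w : X × X => compIntegrand K₁ K₂ V w.1 y w.2) ?_
    have e2 := (hK₂.aestronglyMeasurable_right y).comp_quasiMeasurePreserving
      (Measure.quasiMeasurePreserving_snd (μ := μ) (ν := μ))
    have e3 := hV.comp_quasiMeasurePreserving
      (Measure.quasiMeasurePreserving_snd (μ := μ) (ν := μ))
    exact (hK₁.aestronglyMeasurable.mul e3).mul e2
  · refine ⟨D.toReal + 1, by positivity, fun x y hxy => (hnorm x y hxy).trans ?_⟩
    gcongr
    by_cases hxy' : x = y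
    · have : γ = 0 := le_antisymm (not_lt.1 fun h0 => hxy h0 hxy') hγ
      simp [this]
    · exact singWeight_dist_rpow_le hxy' γ
  · refine max_lt_iff.2 ⟨?_, ?_⟩ <;>
    · refine (iSup_le fun x => ?_).trans_lt
        (ENNReal.ofReal_lt_top (r := (D.toReal + 1) * singWeight r ^ γ))
      rw [eLpNorm_exponent_top]
      refine eLpNormEssSup_le_of_ae_bound (ae_of_all _ fun z => ?_)
      by_cases hz : z ∈ ball x r
      · rw [indicator_of_notMem (by simpa using hz), norm_zero]
        have := Real.rpow_nonneg (singWeight_pos r).le γ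
        positivity
      · have hd : r ≤ dist z x := by simpa using hz
        rw [indicator_of_mem (by simpa using hz)]
        first
        | exact hfar r hr z x hd
        | exact hfar r hr x z (by rwa [dist_comm])

end

/-! ### Exponents -/

/-- If `p > ν / (ν - a)`, then the exponent `s` conjugate to `p` satisfies `s a < ν`. -/
theorem ENNReal.HolderConjugate.mul_ofReal_lt {p s : ℝ≥0∞} (hps : ENNReal.HolderConjugate p s)
    {ν : ℕ} {a : ℝ} (ha : 0 ≤ a) (haν : a < ν) (hp : ENNReal.ofReal (ν / (ν - a)) < p) :
    s * ENNReal.ofReal a < ν := by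
  have hν : (0 : ℝ) < ν := ha.trans_lt haν
  rcases ha.eq_or_lt with rfl | ha0
  · simpa using hν
  have h1 : p⁻¹ < ENNReal.ofReal ((ν - a) / ν) := by
    rw [← inv_div, ENNReal.ofReal_inv_of_pos (div_pos hν (sub_pos.2 haν))]
    exact ENNReal.inv_lt_inv.2 hp
  have h2 : ENNReal.ofReal ((ν - a) / ν) + ENNReal.ofReal (a / ν) = 1 := by
    rw [← ENNReal.ofReal_add (div_nonneg (sub_pos.2 haν).le hν.le) (by positivity), ← add_div,
      sub_add_cancel, div_self hν.ne', ENNReal.ofReal_one]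
  have h3 : ENNReal.ofReal (a / ν) < s⁻¹ := by
    by_contra hle
    have := ENNReal.add_lt_add_of_lt_of_le (ENNReal.inv_ne_top.2 fun hs => ?_) h1 (not_lt.1 hle)
    · rw [h2, hps.inv_add_inv_eq_one] at this
      exact lt_irrefl _ this
    · rw [hs, ENNReal.inv_zero] at hle
      exact hle ENNReal.ofReal_lt_top
  have h4 : s < ν / ENNReal.ofReal a := by
    rw [← ENNReal.ofReal_natCast, ← ENNReal.ofReal_div_of_pos ha0, ← inv_div a,
      ENNReal.ofReal_inv_of_pos (by positivity)]
    exact ENNReal.lt_inv_iff_lt_inv.1 h3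
  exact ENNReal.mul_lt_of_lt_div h4

/-- The exponents `p` and `s` are conjugate, and the product `K₁(x, ·) K₂(·, y)` of kernels of
orders `α₁`, `α₂` with exponents `q₁`, `q₂` at infinity is in `L^s` far from `x` and `y` (by
`inv_le`) and near each of them if they are distinct (by `mul_lt_left` and `mul_lt_right`). -/
structure AdmissibleExponents (ν : ℕ) (α₁ α₂ : ℝ) (q₁ q₂ p s : ℝ≥0∞) : Prop where
  conj : ENNReal.HolderConjugate p s
  inv_le : s⁻¹ ≤ q₁⁻¹ + q₂⁻¹
  mul_lt_left : s * ENNReal.ofReal α₁ < ν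
  mul_lt_right : s * ENNReal.ofReal α₂ < ν

/-- The conditions (a) and (b) on the exponents, for one of the summands of `W`. -/
theorem admissibleExponents_conjExponent {ν : ℕ} {α₁ α₂ : ℝ} {q₁ q₂ p p_max : ℝ≥0∞}
    (hα₁ : 0 ≤ α₁) (hα₁ν : α₁ < ν) (hα₂ν : α₂ < ν) (hp : p ≤ p_max)
    (ha : p_max⁻¹ + q₁⁻¹ + q₂⁻¹ = 1) (hb₀ : α₁ = 0 ∧ α₂ = 0 → 1 ≤ p)
    (hb₁ : ¬ (α₁ = 0 ∧ α₂ = 0) → ENNReal.ofReal (ν / (ν - max α₁ α₂)) < p) :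
    AdmissibleExponents ν α₁ α₂ q₁ q₂ p p.conjExponent := by
  have hmν : max α₁ α₂ < ν := max_lt hα₁ν hα₂ν
  have hm0 : 0 ≤ max α₁ α₂ := hα₁.trans (le_max_left _ _)
  have hp1 : 1 ≤ p := by
    by_cases h0 : α₁ = 0 ∧ α₂ = 0
    · exact hb₀ h0
    · refine le_trans ?_ (hb₁ h0).le
      rw [ENNReal.one_le_ofReal, one_le_div (sub_pos.2 hmν)]
      linarith
  have hconj := ENNReal.HolderConjugate.conjExponent hp1
  have hlt : p.conjExponent * ENNReal.ofReal (max α₁ α₂) < ν := by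
    by_cases h0 : α₁ = 0 ∧ α₂ = 0
    · simpa [h0.1, h0.2] using (hα₁.trans_lt hα₁ν)
    · exact hconj.mul_ofReal_lt hm0 hmν (hb₁ h0)
  refine ⟨hconj, ?_, lt_of_le_of_lt ?_ hlt, lt_of_le_of_lt ?_ hlt⟩
  · have h1 := hconj.inv_add_inv_eq_one
    have hpi : p⁻¹ ≠ ⊤ := ENNReal.inv_ne_top.2 (zero_lt_one.trans_le hp1).ne'
    rw [← ENNReal.add_le_add_iff_left hpi, h1, ← ha, add_assoc]
    gcongr
  · gcongr; exact le_max_left _ _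
  · gcongr; exact le_max_right _ _

namespace AdmissibleExponents

variable {ν : ℕ} {α₁ α₂ : ℝ} {q₁ q₂ p s : ℝ≥0∞}

theorem one_le (h : AdmissibleExponents ν α₁ α₂ q₁ q₂ p s) : 1 ≤ s := by
  have := h.conj.symm
  exact ENNReal.HolderConjugate.one_le s p

theorem mul_ofReal_add_le (h : AdmissibleExponents ν α₁ α₂ q₁ q₂ p s) {γ : ℝ} (hγ : 0 ≤ γ)
    (hle : α₁ + α₂ - ((ν : ℝ≥0∞) / s).toReal ≤ γ) :
    s * ENNReal.ofReal (α₁ + α₂) ≤ ν + s * ENNReal.ofReal γ := by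
  have hs0 : s ≠ 0 := (zero_lt_one.trans_le h.one_le).ne'
  have ht : (ν : ℝ≥0∞) / s ≠ ⊤ := ENNReal.div_ne_top (by simp) hs0
  calc s * ENNReal.ofReal (α₁ + α₂)
      ≤ s * (ENNReal.ofReal ((ν : ℝ≥0∞) / s).toReal + ENNReal.ofReal γ) := by
        rw [← ENNReal.ofReal_add ENNReal.toReal_nonneg hγ]
        exact mul_le_mul_right (ENNReal.ofReal_le_ofReal (by linarith)) _
    _ ≤ _ := by
        rw [ENNReal.ofReal_toReal ht, mul_add]
        gcongr
        exact ENNReal.mul_div_le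

theorem add_sub_lt (h : AdmissibleExponents ν α₁ α₂ q₁ q₂ p s) (hν : 0 < ν) (hα₁ : 0 ≤ α₁)
    (hα₂ : 0 ≤ α₂) (hα₁ν : α₁ < ν) : α₁ + α₂ - ((ν : ℝ≥0∞) / s).toReal < ν := by
  by_cases hs : s = ⊤
  · have h1 := h.mul_lt_left
    have h2 := h.mul_lt_right
    have z1 : α₁ = 0 := by
      by_contra hne
      simp [hs, ENNReal.top_mul (ENNReal.ofReal_pos.2 (lt_of_le_of_ne hα₁ (Ne.symm hne))).ne']
        at h1
    have z2 : α₂ = 0 := by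
      by_contra hne
      simp [hs, ENNReal.top_mul (ENNReal.ofReal_pos.2 (lt_of_le_of_ne hα₂ (Ne.symm hne))).ne']
        at h2
    simpa [z1, z2, hs] using hν
  · have hs1 : 0 < s.toReal := ENNReal.toReal_pos (zero_lt_one.trans_le h.one_le).ne' hs
    have h2 := ((ENNReal.mul_ofReal_lt_natCast_iff hs).1 h.mul_lt_right).1
    rw [ENNReal.toReal_div, ENNReal.toReal_natCast]
    have : α₂ < ν / s.toReal := by rw [lt_div_iff₀ hs1]; linarith
    linarith

end AdmissibleExponents

theorem aestronglyMeasurable_sum_of_memLp {X ι : Type*} [MeasurableSpace X] [Fintype ι]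
    {μ : Measure X} {p : ι → ℝ≥0∞} {V : ι → X → ℂ} (hV : ∀ k, MemLp (V k) (p k) μ) :
    AEStronglyMeasurable (fun z => ∑ k, V k z) μ :=
  Finset.aestronglyMeasurable_fun_sum _ fun k _ => (hV k).1

section

variable {X : Type*} [MetricSpace X] [MeasurableSpace X] [BorelSpace X] {ν : ℕ} {μ : Measure X}
  {R : ℝ} {C : ℝ≥0∞} {α₁ α₂ : ℝ} {q₁ q₂ : ℝ≥0∞} {K₁ K₂ : X → X → ℂ} {ι : Type*} [Fintype ι]
  {p s : ι → ℝ≥0∞} {V : ι → X → ℂ}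

theorem UniformVolumeGrowth.exists_lintegral_sum_le (h : UniformVolumeGrowth ν μ R C)
    (hK₁ : MemKernelClass ν μ α₁ q₁ K₁) (hK₂ : MemKernelClass ν μ α₂ q₂ K₂)
    (hp : ∀ k, AdmissibleExponents ν α₁ α₂ q₁ q₂ (p k) (s k))
    (hV : ∀ k, MemLp (V k) (p k) μ) {γ : ℝ} (hγ : 0 ≤ γ)
    (h₃ : ∀ k, α₁ + α₂ - ((ν : ℝ≥0∞) / s k).toReal ≤ γ)
    (h₄ : γ = 0 → ∀ k, s k * ENNReal.ofReal (α₁ + α₂) ≠ ν) :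
    ∃ D : ℝ≥0∞, D ≠ ⊤ ∧ ∀ x y : X, (0 < γ → x ≠ y) →
      ∫⁻ z, ‖compIntegrand K₁ K₂ (fun z => ∑ k, V k z) x y z‖ₑ ∂μ ≤
        D * ENNReal.ofReal (singWeight (dist x y) ^ γ) := by
  have h₃' := fun k => (hp k).mul_ofReal_add_le hγ (h₃ k)
  have h₄' : γ = 0 → ∀ k, s k * ENNReal.ofReal (α₁ + α₂) < ν := fun h0 k =>
    lt_of_le_of_ne (by simpa [h0] using h₃' k) (h₄ h0 k)
  choose D hD hle using fun k => h.exists_lintegral_compIntegrand_le hK₁ hK₂ (hp k).conj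
    (hp k).inv_le (hp k).mul_lt_left (hp k).mul_lt_right hγ (h₃' k) (fun h0 => h₄' h0 k) (hV k)
  refine ⟨∑ k, D k, ENNReal.sum_ne_top.2 fun k _ => hD k, fun x y hxy => ?_⟩
  calc _ ≤ ∫⁻ z, ∑ k, ‖compIntegrand K₁ K₂ (V k) x y z‖ₑ ∂μ := by
        refine lintegral_mono fun z => ?_
        rw [compIntegrand_sum]
        exact enorm_sum_le _ _
    _ = ∑ k, ∫⁻ z, ‖compIntegrand K₁ K₂ (V k) x y z‖ₑ ∂μ :=
        lintegral_finsetSum' _ fun k _ =>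
          (aestronglyMeasurable_compIntegrand hK₁ hK₂ (hV k).1 x y).enorm
    _ ≤ _ := by
        rw [Finset.sum_mul]
        refine Finset.sum_le_sum fun k _ => hle k x y ?_
        rcases hγ.eq_or_lt with h0 | h0
        · exact Or.inl (h₄' h0.symm k)
        · exact Or.inr (hxy h0)

end

/-! ### Convergence of integrals and uniformly small tails -/

/-- Convergence of integrals: the functions converge almost everywhere, and up to an error that is
uniformly small in `L¹` they are dominated by an integrable function. -/
theorem tendsto_integral_of_dominated_up_to {T X E : Type*} [MeasurableSpace X] {μ : Measure X}
    [NormedAddCommGroup E] [NormedSpace ℝ E] {l : Filter T} [l.IsCountablyGenerated]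
    {f : T → X → E} {f₀ : X → E} (hf : ∀ᶠ t in l, Integrable (f t) μ) (hf₀ : Integrable f₀ μ)
    (hlim : ∀ᵐ z ∂μ, Tendsto (fun t => f t z) l (𝓝 (f₀ z)))
    (h : ∀ ε : ℝ≥0∞, 0 < ε → ∃ A : Set X, MeasurableSet A ∧ (∃ g : X → ℝ, IntegrableOn g A μ ∧
      ∀ᶠ t in l, ∀ z ∈ A, ‖f t z‖ ≤ g z) ∧ (∀ᶠ t in l, ∫⁻ z in Aᶜ, ‖f t z‖ₑ ∂μ ≤ ε) ∧
      ∫⁻ z in Aᶜ, ‖f₀ z‖ₑ ∂μ ≤ ε) :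
    Tendsto (fun t => ∫ z, f t z ∂μ) l (𝓝 (∫ z, f₀ z ∂μ)) := by
  rw [EMetric.tendsto_nhds]
  intro ε hε
  have hε2 : 0 < ε / 2 := ENNReal.half_pos hε.ne'
  obtain ⟨A, hA, ⟨g, hg, hgf⟩, ht, ht₀⟩ := h (ε / 2 / 2) (ENNReal.half_pos hε2.ne')
  have hdom : Tendsto (fun t => ∫ z in A, f t z ∂μ) l (𝓝 (∫ z in A, f₀ z ∂μ)) :=
    tendsto_integral_filter_of_dominated_convergence g (hf.mono fun t h => h.1.restrict)
      (hgf.mono fun t h => (ae_restrict_iff' hA).2 (ae_of_all _ h)) hg (ae_restrict_of_ae hlim)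
  by_cases hεt : ε = ⊤
  · exact Eventually.of_forall fun t => by simp [hεt, edist_lt_top]
  filter_upwards [hf, ht, EMetric.tendsto_nhds.1 hdom (ε / 2) hε2] with t htf htA htE
  rw [edist_eq_enorm_sub] at htE ⊢
  rw [← integral_add_compl hA htf, ← integral_add_compl hA hf₀, add_sub_add_comm,
    sub_eq_add_neg (∫ z in Aᶜ, f t z ∂μ)]
  calc _ ≤ ‖(∫ z in A, f t z ∂μ) - ∫ z in A, f₀ z ∂μ‖ₑ + (‖∫ z in Aᶜ, f t z ∂μ‖ₑ +
        ‖∫ z in Aᶜ, f₀ z ∂μ‖ₑ) := by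
        refine (enorm_add_le _ _).trans (add_le_add le_rfl ((enorm_add_le _ _).trans ?_))
        rw [enorm_neg]
    _ < ε / 2 + (ε / 2 / 2 + ε / 2 / 2) := ENNReal.add_lt_add_of_lt_of_le (by finiteness) htE
        (add_le_add ((enorm_integral_le_lintegral_enorm _).trans htA)
          ((enorm_integral_le_lintegral_enorm _).trans ht₀))
    _ = ε := by rw [ENNReal.add_halves, ENNReal.add_halves]

/-- Existence of a factor that makes a product with a finite number small. -/
theorem ENNReal.exists_pos_mul_le {ε D : ℝ≥0∞} (hε : 0 < ε) (hD : D ≠ ⊤) :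
    ∃ η : ℝ≥0∞, 0 < η ∧ η * D ≤ ε :=
  ⟨ε / (D + 1), ENNReal.div_pos hε.ne' (by finiteness), by
    calc ε / (D + 1) * D ≤ ε / (D + 1) * (D + 1) := by gcongr; exact le_self_add
      _ = ε := ENNReal.div_mul_cancel (by simp) (by finiteness)⟩

theorem ball_subset_ball_two_mul {X : Type*} [MetricSpace X] {x x₀ : X} {δ : ℝ}
    (hx : x ∈ ball x₀ δ) : ball x δ ⊆ ball x₀ (2 * δ) :=
  ball_subset_ball' (by rw [mem_ball] at hx; linarith)

section

variable {X : Type*} [MetricSpace X] [MeasurableSpace X] {ν : ℕ} {μ : Measure X}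
  {α₁ α₂ : ℝ} {q₁ q₂ p s : ℝ≥0∞} {K₁ K₂ : X → X → ℂ} {V : X → ℂ}

/-- The integrals of `|F(x, y, ·)|` are uniformly small outside of a set of finite measure and
away from the points `x₀` and `y₀`, for `x` near `x₀` and `y` near `y₀`. -/
def UniformlySmallTails (μ : Measure X) (K₁ K₂ : X → X → ℂ) (V : X → ℂ) : Prop :=
  ∀ (x₀ y₀ : X) (δ : ℝ) (ε : ℝ≥0∞), 0 < δ → 0 < ε → ∃ S : Set X, MeasurableSet S ∧ μ S < ⊤ ∧
    ∀ x ∈ ball x₀ δ, ∀ y ∈ ball y₀ δ,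
      ∫⁻ z in Sᶜ ∩ (ball x₀ (2 * δ) ∪ ball y₀ (2 * δ))ᶜ, ‖compIntegrand K₁ K₂ V x y z‖ₑ ∂μ ≤ ε

/-- If `p < ∞`, a function in `L^p` is small outside of a set of finite measure. -/
theorem uniformlySmallTails_of_ne_top [BorelSpace X] (hK₁ : MemKernelClass ν μ α₁ q₁ K₁)
    (hK₂ : MemKernelClass ν μ α₂ q₂ K₂) (hps : AdmissibleExponents ν α₁ α₂ q₁ q₂ p s)
    (hp : p ≠ ⊤) (hV : MemLp V p μ) : UniformlySmallTails μ K₁ K₂ V := by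
  intro x₀ y₀ δ ε hδ hε
  obtain ⟨D, hD, hle⟩ := hK₁.exists_eLpNorm_far_le hK₂ hps.inv_le hδ
  obtain ⟨η, hη, hηD⟩ := ENNReal.exists_pos_mul_le hε hD
  obtain ⟨S, hS, hSt, hSV⟩ := hV.exists_eLpNorm_indicator_compl_lt hp hη.ne'
  refine ⟨S, hS, hSt, fun x hx y hy => ?_⟩
  refine (lintegral_compIntegrand_le hK₁ hK₂ hV.1 hps.conj x y _).trans
    ((mul_le_mul' ?_ ?_).trans hηD)
  · rw [eLpNorm_indicator_eq_eLpNorm_restrict hS.compl] at hSV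
    exact (eLpNorm_mono_measure _ (Measure.restrict_mono inter_subset_left le_rfl)).trans hSV.le
  · refine (eLpNorm_mono_measure _ (Measure.restrict_mono ?_ le_rfl)).trans (hle x y)
    exact inter_subset_right.trans (compl_subset_compl.2 (union_subset_union
      (ball_subset_ball_two_mul hx) (ball_subset_ball_two_mul hy)))

/-- Hölder's inequality with three factors, for `V ∈ L^∞` and conjugate exponents of the kernels. -/
theorem lintegral_compIntegrand_le_offDiagNorm [BorelSpace X] (hK₁ : MemKernelClass ν μ α₁ q₁ K₁)
    (hK₂ : MemKernelClass ν μ α₂ q₂ K₂) (hq : q₁⁻¹ + q₂⁻¹ = 1) (hV : AEStronglyMeasurable V μ)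
    (x y : X) {a b : ℝ} {A : Set X} (ha : A ⊆ (ball x a)ᶜ) (hb : A ⊆ (ball y b)ᶜ) :
    ∫⁻ z in A, ‖compIntegrand K₁ K₂ V x y z‖ₑ ∂μ ≤
      eLpNorm V ⊤ μ * (offDiagNorm μ K₁ q₁ a * offDiagNorm μ K₂ q₂ b) := by
  have : ENNReal.HolderTriple q₁ q₂ 1 := ⟨by simpa using hq⟩
  refine (lintegral_compIntegrand_le hK₁ hK₂ hV (p := ⊤) (s := 1) inferInstance x y A).trans
    (mul_le_mul' (eLpNorm_mono_measure _ Measure.restrict_le_self) ?_)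
  refine (eLpNorm_smul_le_mul_eLpNorm (p := q₁) (q := q₂) (r := 1) (μ := μ.restrict A)
    (hK₂.aestronglyMeasurable_right y).restrict
    (hK₁.aestronglyMeasurable_left x).restrict).trans (mul_le_mul' ?_ ?_)
  · refine (eLpNorm_mono_measure _ (Measure.restrict_mono ha le_rfl)).trans ?_
    rw [← eLpNorm_indicator_eq_eLpNorm_restrict measurableSet_ball.compl]
    exact (le_iSup (fun x => eLpNorm ((ball x a)ᶜ.indicator fun z => K₁ x z) q₁ μ) x).trans
      (le_max_left _ _)
  · refine (eLpNorm_mono_measure _ (Measure.restrict_mono hb le_rfl)).trans ?_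
    rw [← eLpNorm_indicator_eq_eLpNorm_restrict measurableSet_ball.compl]
    exact (le_iSup (fun y => eLpNorm ((ball y b)ᶜ.indicator fun z => K₂ z y) q₂ μ) y).trans
      (le_max_right _ _)

/-- For `V ∈ L^∞` the tails are small if one of the kernels decays at infinity. -/
theorem UniformVolumeGrowth.uniformlySmallTails_of_zero [BorelSpace X] {R : ℝ} {C : ℝ≥0∞}
    (h : UniformVolumeGrowth ν μ R C) (hK₁ : MemKernelClass ν μ α₁ q₁ K₁)
    (hK₂ : MemKernelClass ν μ α₂ q₂ K₂)
    (hz : MemKernelClassZero ν μ α₁ q₁ K₁ ∨ MemKernelClassZero ν μ α₂ q₂ K₂)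
    (hq : q₁⁻¹ + q₂⁻¹ = 1) (hV : MemLp V ⊤ μ) : UniformlySmallTails μ K₁ K₂ V := by
  intro x₀ y₀ δ ε hδ hε
  have hVt := hV.eLpNorm_ne_top
  have hball : ∀ (x x₀ : X) (ρ : ℝ), x ∈ ball x₀ δ → (ball x₀ (ρ + δ))ᶜ ⊆ (ball x ρ)ᶜ :=
    fun x x₀ ρ hx => compl_subset_compl.2 (ball_subset_ball' (by rw [mem_ball] at hx; linarith))
  have hsub : ∀ x ∈ ball x₀ δ, (ball x₀ (2 * δ) ∪ ball y₀ (2 * δ))ᶜ ⊆ (ball x δ)ᶜ :=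
    fun x hx => compl_subset_compl.2 ((ball_subset_ball_two_mul hx).trans subset_union_left)
  have hsub' : ∀ y ∈ ball y₀ δ, (ball x₀ (2 * δ) ∪ ball y₀ (2 * δ))ᶜ ⊆ (ball y δ)ᶜ :=
    fun y hy => compl_subset_compl.2 ((ball_subset_ball_two_mul hy).trans subset_union_right)
  rcases hz with hz | hz
  · have hD := (hK₂.offDiagNorm_lt_top δ hδ).ne
    obtain ⟨η, hη, hηD⟩ := ENNReal.exists_pos_mul_le hε (ENNReal.mul_ne_top hVt hD)
    obtain ⟨ρ, hρ⟩ := (hz.tendsto_offDiagNorm.eventually (eventually_le_nhds hη)).exists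
    refine ⟨ball x₀ (ρ + δ), measurableSet_ball, h.ball_lt_top _ _, fun x hx y hy => ?_⟩
    refine (lintegral_compIntegrand_le_offDiagNorm hK₁ hK₂ hq hV.1 x y
      (inter_subset_left.trans (hball x x₀ ρ hx)) (inter_subset_right.trans (hsub' y hy))).trans
      (le_trans ?_ hηD)
    rw [mul_left_comm]
    gcongr
  · have hD := (hK₁.offDiagNorm_lt_top δ hδ).ne
    obtain ⟨η, hη, hηD⟩ := ENNReal.exists_pos_mul_le hε (ENNReal.mul_ne_top hVt hD)
    obtain ⟨ρ, hρ⟩ := (hz.tendsto_offDiagNorm.eventually (eventually_le_nhds hη)).exists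
    refine ⟨ball y₀ (ρ + δ), measurableSet_ball, h.ball_lt_top _ _, fun x hx y hy => ?_⟩
    refine (lintegral_compIntegrand_le_offDiagNorm hK₁ hK₂ hq hV.1 x y
      (inter_subset_right.trans (hsub x hx)) (inter_subset_left.trans (hball y y₀ ρ hy))).trans
      (le_trans ?_ hηD)
    rw [mul_comm η, mul_assoc]
    gcongr

end

/-! ### Local control and convergence of the composition -/

section

variable {X : Type*} [MetricSpace X] [MeasurableSpace X] {ν : ℕ} {μ : Measure X}
  {R : ℝ} {C : ℝ≥0∞} {α₁ α₂ : ℝ} {q₁ q₂ p s : ℝ≥0∞} {K₁ K₂ : X → X → ℂ} {V : X → ℂ}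
  {x₀ y₀ c : X}

/-- Near the point `c`, Hölder's inequality with a finite exponent `p` on the factor `V` bounds the
integral of `|F(x, y, ·)|`, uniformly for `x` near `x₀` and `y` near `y₀`. Here `p` may differ from
the exponent of the space to which `V` belongs globally: the latter may be infinite, and then the
norm of `V` over small balls need not tend to zero. -/
def LocallyControlled (μ : Measure X) (K₁ K₂ : X → X → ℂ) (V : X → ℂ) (x₀ y₀ c : X) : Prop :=
  ∃ p s : ℝ≥0∞, ENNReal.HolderConjugate p s ∧ p ≠ ⊤ ∧ ∃ r : ℝ, 0 < r ∧
    MemLp V p (μ.restrict (ball c r)) ∧ ∃ D : ℝ≥0∞, D ≠ ⊤ ∧ ∀ᶠ w : X × X in 𝓝 (x₀, y₀),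
      eLpNorm (fun z => K₁ w.1 z * K₂ z w.2) s (μ.restrict (ball c r)) ≤ D

/-- The contribution of small balls to the integral of `|F(x, y, ·)|` is uniformly small. -/
theorem LocallyControlled.eventually_lintegral_le [BorelSpace X]
    (h : UniformVolumeGrowth ν μ R C) (hK₁ : MemKernelClass ν μ α₁ q₁ K₁)
    (hK₂ : MemKernelClass ν μ α₂ q₂ K₂) (hV : AEStronglyMeasurable V μ)
    (hc : LocallyControlled μ K₁ K₂ V x₀ y₀ c) {ε : ℝ≥0∞} (hε : 0 < ε) :
    ∀ᶠ δ in 𝓝[>] (0 : ℝ), ∀ᶠ w : X × X in 𝓝 (x₀, y₀),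
      ∫⁻ z in ball c δ, ‖compIntegrand K₁ K₂ V w.1 w.2 z‖ₑ ∂μ ≤ ε := by
  obtain ⟨p, s, hps, hp, r, hr, hVp, D, hD, hle⟩ := hc
  obtain ⟨η, hη, hηD⟩ := ENNReal.exists_pos_mul_le hε hD
  obtain ⟨η', hη', hηη'⟩ : ∃ η' : ℝ, 0 < η' ∧ ENNReal.ofReal η' ≤ η := by
    obtain ⟨a, ha, haη⟩ := exists_between hη
    exact ⟨a.toReal, ENNReal.toReal_pos ha.ne' (haη.trans_le le_top).ne,
      ENNReal.ofReal_toReal_le.trans haη.le⟩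
  obtain ⟨κ, hκ, hsmall⟩ := hVp.eLpNorm_indicator_le (ENNReal.HolderConjugate.one_le p s) hp hη'
  filter_upwards [(h.tendsto_measure_ball c).eventually
    (eventually_le_nhds (ENNReal.ofReal_pos.2 hκ)), Ioc_mem_nhdsGT hr] with δ hδκ hδ
  filter_upwards [hle] with w hw
  refine (lintegral_compIntegrand_le hK₁ hK₂ hV hps w.1 w.2 (ball c δ)).trans
    ((mul_le_mul' ?_ ?_).trans hηD)
  · have := hsmall (ball c δ) measurableSet_ball ((Measure.restrict_apply_le _ _).trans hδκ)
    rw [eLpNorm_indicator_eq_eLpNorm_restrict measurableSet_ball,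
      Measure.restrict_restrict measurableSet_ball,
      inter_eq_left.2 (ball_subset_ball hδ.2)] at this
    exact this.trans hηη'
  · exact (eLpNorm_mono_measure _ (Measure.restrict_mono (ball_subset_ball hδ.2) le_rfl)).trans hw

/-- The integrand is integrable for `(x, y)` near `(x₀, y₀)`, and at this point itself. -/
theorem eventually_integrable_compIntegrand [BorelSpace X]
    (h : UniformVolumeGrowth ν μ R C) (hK₁ : MemKernelClass ν μ α₁ q₁ K₁)
    (hK₂ : MemKernelClass ν μ α₂ q₂ K₂) (hps : AdmissibleExponents ν α₁ α₂ q₁ q₂ p s)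
    (hV : MemLp V p μ) (hx : LocallyControlled μ K₁ K₂ V x₀ y₀ x₀)
    (hy : LocallyControlled μ K₁ K₂ V x₀ y₀ y₀) :
    ∀ᶠ w : X × X in 𝓝 (x₀, y₀), Integrable (compIntegrand K₁ K₂ V w.1 w.2) μ := by
  obtain ⟨δ, ⟨hδx, hδy⟩, hδ⟩ := (((hx.eventually_lintegral_le h hK₁ hK₂ hV.1 one_pos).and
    (hy.eventually_lintegral_le h hK₁ hK₂ hV.1 one_pos)).and self_mem_nhdsWithin).exists
  replace hδ : 0 < δ := hδ
  obtain ⟨D, hD, hle⟩ := hK₁.exists_eLpNorm_far_le hK₂ hps.inv_le (half_pos hδ)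
  have hball : ball x₀ (δ / 2) ×ˢ ball y₀ (δ / 2) ∈ 𝓝 (x₀, y₀) :=
    prod_mem_nhds (ball_mem_nhds _ (half_pos hδ)) (ball_mem_nhds _ (half_pos hδ))
  filter_upwards [hδx, hδy, hball] with w hwx hwy hw
  refine ⟨aestronglyMeasurable_compIntegrand hK₁ hK₂ hV.1 _ _, ?_⟩
  rw [hasFiniteIntegral_iff_enorm, ← setLIntegral_univ,
    ← union_compl_self (ball x₀ δ ∪ ball y₀ δ)]
  refine (lintegral_union_le _ _ _).trans_lt
    ((add_le_add_left (lintegral_union_le _ _ _) _).trans_lt ?_)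
  have hVt := hV.eLpNorm_ne_top
  have h3 : ∫⁻ z in (ball x₀ δ ∪ ball y₀ δ)ᶜ, ‖compIntegrand K₁ K₂ V w.1 w.2 z‖ₑ ∂μ ≤
      eLpNorm V p μ * D := by
    refine (lintegral_compIntegrand_le hK₁ hK₂ hV.1 hps.conj w.1 w.2 _).trans
      (mul_le_mul' (eLpNorm_mono_measure _ Measure.restrict_le_self)
        ((eLpNorm_mono_measure _ (Measure.restrict_mono ?_ le_rfl)).trans (hle w.1 w.2)))
    have hx' := ball_subset_ball_two_mul hw.1
    have hy' := ball_subset_ball_two_mul hw.2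
    rw [mul_div_cancel₀ δ (two_ne_zero)] at hx' hy'
    exact compl_subset_compl.2 (union_subset_union hx' hy')
  calc _ ≤ 1 + 1 + eLpNorm V p μ * D := add_le_add (add_le_add hwx hwy) h3
    _ < ⊤ := by finiteness

/-- Convergence of the composition at `(x₀, y₀)` along any filter on which the product of the
kernels converges almost everywhere. The three parts of the space are small balls around `x₀` and
`y₀`, the complement of a set of finite measure, and the rest, where `F` is dominated by a multiple
of `|V|`. -/
theorem tendsto_compKernel [BorelSpace X]
    (h : UniformVolumeGrowth ν μ R C) (hK₁ : MemKernelClass ν μ α₁ q₁ K₁)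
    (hK₂ : MemKernelClass ν μ α₂ q₂ K₂) (hps : AdmissibleExponents ν α₁ α₂ q₁ q₂ p s)
    (hV : MemLp V p μ) (htail : UniformlySmallTails μ K₁ K₂ V)
    (hx : LocallyControlled μ K₁ K₂ V x₀ y₀ x₀) (hy : LocallyControlled μ K₁ K₂ V x₀ y₀ y₀)
    {T : Type*} {l : Filter T} [l.IsCountablyGenerated] {f : T → X × X}
    (hf : Tendsto f l (𝓝 (x₀, y₀)))
    (hlim : ∀ᵐ z ∂μ, Tendsto (fun t => K₁ (f t).1 z * K₂ z (f t).2) l (𝓝 (K₁ x₀ z * K₂ z y₀))) :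
    Tendsto (fun t => compKernel μ K₁ K₂ V (f t).1 (f t).2) l
      (𝓝 (compKernel μ K₁ K₂ V x₀ y₀)) := by
  have hint := eventually_integrable_compIntegrand h hK₁ hK₂ hps hV hx hy
  refine tendsto_integral_of_dominated_up_to (hf.eventually hint) hint.self_of_nhds ?_
    fun ε hε => ?_
  · filter_upwards [hlim] with z hz
    simpa only [compIntegrand, mul_right_comm _ (V z)] using hz.mul_const (V z)
  have hε2 := ENNReal.half_pos (ENNReal.half_pos hε.ne').ne'
  obtain ⟨δ', ⟨hδx, hδy⟩, hδ'⟩ := (((hx.eventually_lintegral_le h hK₁ hK₂ hV.1 hε2).and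
    (hy.eventually_lintegral_le h hK₁ hK₂ hV.1 hε2)).and self_mem_nhdsWithin).exists
  replace hδ' : 0 < δ' := hδ'
  obtain ⟨δ, hδ, rfl⟩ : ∃ δ, 0 < δ ∧ δ' = 2 * δ := ⟨δ' / 2, half_pos hδ', by ring⟩
  obtain ⟨S, hS, hSt, hSle⟩ := htail x₀ y₀ δ (ε / 2) hδ (ENNReal.half_pos hε.ne')
  set N := ball x₀ (2 * δ) ∪ ball y₀ (2 * δ) with hN
  have hNm : MeasurableSet N := measurableSet_ball.union measurableSet_ball
  have hball : ∀ᶠ w : X × X in 𝓝 (x₀, y₀), w ∈ ball x₀ δ ×ˢ ball y₀ δ :=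
    prod_mem_nhds (ball_mem_nhds _ hδ) (ball_mem_nhds _ hδ)
  have hsmall : ∀ᶠ w : X × X in 𝓝 (x₀, y₀),
      ∫⁻ z in (S ∩ Nᶜ)ᶜ, ‖compIntegrand K₁ K₂ V w.1 w.2 z‖ₑ ∂μ ≤ ε := by
    filter_upwards [hδx, hδy, hball] with w hwx hwy hw
    have hsub : (S ∩ Nᶜ)ᶜ ⊆ N ∪ Sᶜ ∩ Nᶜ := by
      intro z hz
      by_cases hzN : z ∈ N
      · exact Or.inl hzN
      · exact Or.inr ⟨fun hzS => hz ⟨hzS, hzN⟩, hzN⟩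
    calc _ ≤ ∫⁻ z in N ∪ Sᶜ ∩ Nᶜ, ‖compIntegrand K₁ K₂ V w.1 w.2 z‖ₑ ∂μ := lintegral_mono_set hsub
      _ ≤ ε / 2 / 2 + ε / 2 / 2 + ε / 2 := by
          refine (lintegral_union_le _ _ _).trans (add_le_add ?_ (hSle _ hw.1 _ hw.2))
          exact (lintegral_union_le _ _ _).trans (add_le_add hwx hwy)
      _ = ε := by rw [ENNReal.add_halves, ENNReal.add_halves]
  refine ⟨S ∩ Nᶜ, hS.inter hNm.compl, ?_, hf.eventually hsmall, hsmall.self_of_nhds⟩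
  obtain ⟨c₁, hc₁, hb₁⟩ := hK₁.exists_norm_le
  obtain ⟨c₂, hc₂, hb₂⟩ := hK₂.exists_norm_le
  refine ⟨fun z => (c₁ * singWeight δ ^ α₁) * (c₂ * singWeight δ ^ α₂) * ‖V z‖, ?_, ?_⟩
  · have : IsFiniteMeasure (μ.restrict S) := ⟨by simpa using hSt⟩
    have hp1 : 1 ≤ p := by have := hps.conj; exact ENNReal.HolderConjugate.one_le p s
    have hVS : IntegrableOn V S μ := (hV.restrict S).integrable hp1
    exact (hVS.mono_set inter_subset_left).norm.const_mul _
  · filter_upwards [hf.eventually hball] with t ht z hz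
    have hzN := hz.2
    rw [hN, compl_union] at hzN
    have h1 : δ ≤ dist (f t).1 z := by
      have := compl_subset_compl.2 (ball_subset_ball_two_mul ht.1) hzN.1
      simpa [dist_comm] using this
    have h2 : δ ≤ dist z (f t).2 := by
      have := compl_subset_compl.2 (ball_subset_ball_two_mul ht.2) hzN.2
      simpa using this
    have g1 := Real.rpow_le_rpow (singWeight_pos _).le (singWeight_anti hδ h1) hK₁.exponent_nonneg
    have g2 := Real.rpow_le_rpow (singWeight_pos _).le (singWeight_anti hδ h2) hK₂.exponent_nonneg
    have k1 : ‖K₁ (f t).1 z‖ ≤ c₁ * singWeight δ ^ α₁ :=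
      (hb₁ _ z fun _ => dist_pos.1 (hδ.trans_le h1)).trans (by gcongr)
    have k2 : ‖K₂ z (f t).2‖ ≤ c₂ * singWeight δ ^ α₂ :=
      (hb₂ z _ fun _ => dist_pos.1 (hδ.trans_le h2)).trans (by gcongr)
    rw [compIntegrand, mul_right_comm, norm_mul, norm_mul]
    have := Real.rpow_nonneg (singWeight_pos δ).le α₁
    gcongr

/-- A factor `V` that lies locally in `L^p` with `p < ∞` gives local control if the kernels are
locally in `L^s`, and `x₀ ≠ y₀` or also their product is, uniformly up to the diagonal. -/
theorem UniformVolumeGrowth.locallyControlled [BorelSpace X]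
    (h : UniformVolumeGrowth ν μ R C) (hK₁ : MemKernelClass ν μ α₁ q₁ K₁)
    (hK₂ : MemKernelClass ν μ α₂ q₂ K₂) (hps : ENNReal.HolderConjugate p s) (hp : p ≠ ⊤)
    (hV : MemLp V p (μ.restrict (ball c R))) (h₁ : s * ENNReal.ofReal α₁ < ν)
    (h₂ : s * ENNReal.ofReal α₂ < ν) (hxy : s * ENNReal.ofReal (α₁ + α₂) < ν ∨ x₀ ≠ y₀) :
    LocallyControlled μ K₁ K₂ V x₀ y₀ c := by
  have hs1 : 1 ≤ s := by have := hps.symm; exact ENNReal.HolderConjugate.one_le s p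
  refine ⟨p, s, hps, hp, R, h.radius_pos, hV, ?_⟩
  by_cases hlt : s * ENNReal.ofReal (α₁ + α₂) < ν
  · obtain ⟨D, hD, hle⟩ := h.exists_eLpNorm_near_le hK₁ hK₂ hs1 h₁ h₂ le_rfl
      (by simpa using hlt.le) fun _ => hlt
    exact ⟨D, hD, Eventually.of_forall fun w => by simpa using hle w.1 w.2 c (Or.inl hlt)⟩
  · have hne := hxy.resolve_left hlt
    have hd : 0 < dist x₀ y₀ / 2 := half_pos (dist_pos.2 hne)
    -- off the diagonal any positive order that dominates the singularity will do
    have hγ : 0 < max 1 (α₁ + α₂) := lt_max_of_lt_left one_pos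
    obtain ⟨D, hD, hle⟩ := h.exists_eLpNorm_near_le hK₁ hK₂ hs1 h₁ h₂ hγ.le
      (le_add_of_nonneg_of_le zero_le (by gcongr; exact le_max_right _ _))
      fun h0 => absurd h0 hγ.ne'
    refine ⟨D * ENNReal.ofReal (singWeight (dist x₀ y₀ / 2) ^ max 1 (α₁ + α₂)), by finiteness, ?_⟩
    have hev : ∀ᶠ w : X × X in 𝓝 (x₀, y₀), dist x₀ y₀ / 2 < dist w.1 w.2 :=
      continuous_dist.continuousAt.eventually (lt_mem_nhds (half_lt_self (dist_pos.2 hne)))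
    filter_upwards [hev] with w hw
    refine (hle w.1 w.2 c (Or.inr (dist_pos.1 (hd.trans hw)))).trans ?_
    gcongr
    · exact (singWeight_pos _).le
    · exact singWeight_anti hd hw.le

theorem UniformVolumeGrowth.isFiniteMeasure_restrict_ball (h : UniformVolumeGrowth ν μ R C)
    (c : X) (r : ℝ) : IsFiniteMeasure (μ.restrict (ball c r)) :=
  ⟨by simpa using h.ball_lt_top c r⟩

theorem UniformVolumeGrowth.locallyControlled_of_ne [BorelSpace X]
    (h : UniformVolumeGrowth ν μ R C) (hK₁ : MemKernelClass ν μ α₁ q₁ K₁)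
    (hK₂ : MemKernelClass ν μ α₂ q₂ K₂) (hps : AdmissibleExponents ν α₁ α₂ q₁ q₂ p s)
    (hV : MemLp V p μ) (hxy : x₀ ≠ y₀) (c : X) : LocallyControlled μ K₁ K₂ V x₀ y₀ c := by
  by_cases hp : p = ⊤
  · have hmν : max α₁ α₂ < ν := max_lt hK₁.exponent_lt hK₂.exponent_lt
    have hm0 : 0 ≤ max α₁ α₂ := hK₁.exponent_nonneg.trans (le_max_left _ _)
    -- a bounded function lies in every `L^t` on a ball; take `t` finite but large enough
    set t : ℝ≥0∞ := ENNReal.ofReal (ν / (ν - max α₁ α₂) + 1) with ht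
    have h0 : 0 ≤ ν / (ν - max α₁ α₂) := div_nonneg (Nat.cast_nonneg _) (sub_pos.2 hmν).le
    have ht1 : 1 ≤ t := by rw [ht, ENNReal.one_le_ofReal]; linarith
    have hconj := ENNReal.HolderConjugate.conjExponent ht1
    have hlt : t.conjExponent * ENNReal.ofReal (max α₁ α₂) < ν :=
      hconj.mul_ofReal_lt hm0 hmν ((ENNReal.ofReal_lt_ofReal_iff (by linarith)).2 (by linarith))
    have := h.isFiniteMeasure_restrict_ball c R
    refine h.locallyControlled hK₁ hK₂ hconj ENNReal.ofReal_ne_top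
      ((hV.restrict _).mono_exponent (hp ▸ le_top)) (lt_of_le_of_lt ?_ hlt)
      (lt_of_le_of_lt ?_ hlt) (Or.inr hxy)
    · gcongr; exact le_max_left _ _
    · gcongr; exact le_max_right _ _
  · exact h.locallyControlled hK₁ hK₂ hps.conj hp (hV.restrict _) hps.mul_lt_left hps.mul_lt_right
      (Or.inr hxy)

/-- If `V` lies locally in `L^q` with `q > ν / (ν - α₁ - α₂)`, there is local control on the
diagonal as well. -/
theorem UniformVolumeGrowth.locallyControlled_of_locally_memLp [BorelSpace X] [ProperSpace X]
    (h : UniformVolumeGrowth ν μ R C) (hK₁ : MemKernelClass ν μ α₁ q₁ K₁)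
    (hK₂ : MemKernelClass ν μ α₂ q₂ K₂) (hps : AdmissibleExponents ν α₁ α₂ q₁ q₂ p s)
    (hV : MemLp V p μ) (hα : α₁ + α₂ < ν) (hq : α₁ + α₂ ≠ 0 → ∃ q : ℝ≥0∞,
      ENNReal.ofReal (ν / (ν - α₁ - α₂)) < q ∧
        ∀ A : Set X, IsCompact A → MemLp V q (μ.restrict A)) (x₀ y₀ c : X) :
    LocallyControlled μ K₁ K₂ V x₀ y₀ c := by
  have := h.isFiniteMeasure_restrict_ball c R
  have hα₁ := hK₁.exponent_nonneg
  have hα₂ := hK₂.exponent_nonneg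
  by_cases h0 : α₁ + α₂ = 0
  · have z1 : α₁ = 0 := by linarith
    have z2 : α₂ = 0 := by linarith
    have hν : (0 : ℝ≥0∞) < ν := by simpa using h.dim_pos
    have hp1 : 1 ≤ p := by have := hps.conj; exact ENNReal.HolderConjugate.one_le p s
    exact h.locallyControlled hK₁ hK₂ (p := 1) (s := ⊤) inferInstance ENNReal.one_ne_top
      ((hV.restrict _).mono_exponent hp1) (by simpa [z1] using hν) (by simpa [z2] using hν)
      (Or.inl (by simpa [h0] using hν))
  · obtain ⟨q, hlt, hVq⟩ := hq h0
    rw [sub_sub] at hlt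
    have hq0 : 0 ≤ ν / (ν - (α₁ + α₂)) := div_nonneg (Nat.cast_nonneg _) (sub_pos.2 hα).le
    set t : ℝ≥0∞ := min q (ENNReal.ofReal (ν / (ν - (α₁ + α₂)) + 1)) with ht
    have htt : t ≠ ⊤ := ((min_le_right _ _).trans_lt ENNReal.ofReal_lt_top).ne
    have hlt' : ENNReal.ofReal (ν / (ν - (α₁ + α₂))) < t :=
      lt_min hlt ((ENNReal.ofReal_lt_ofReal_iff (by linarith)).2 (by linarith))
    have ht1 : 1 ≤ t := by
      refine le_trans ?_ hlt'.le
      rw [ENNReal.one_le_ofReal, one_le_div (sub_pos.2 hα)]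
      linarith
    have hconj := ENNReal.HolderConjugate.conjExponent ht1
    have hs := hconj.mul_ofReal_lt (add_nonneg hα₁ hα₂) hα hlt'
    have hVt : MemLp V t (μ.restrict (ball c R)) := by
      refine MemLp.mono_exponent ?_ (min_le_left _ _)
      exact (hVq _ (isCompact_closedBall c R)).mono_measure
        (Measure.restrict_mono ball_subset_closedBall le_rfl)
    refine h.locallyControlled hK₁ hK₂ hconj htt hVt (lt_of_le_of_lt ?_ hs)
      (lt_of_le_of_lt ?_ hs) (Or.inl hs)
    · gcongr; linarith
    · gcongr; linarith

end

/-! ### Continuity of the composition -/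

section

variable {X ι : Type*} [MeasurableSpace X] {μ : Measure X} [Fintype ι] {K₁ K₂ : X → X → ℂ}
  {V : ι → X → ℂ}

theorem integrable_compIntegrand_sum (x y : X)
    (hint : ∀ k, Integrable (compIntegrand K₁ K₂ (V k) x y) μ) :
    Integrable (compIntegrand K₁ K₂ (fun z => ∑ k, V k z) x y) μ := by
  have : compIntegrand K₁ K₂ (fun z => ∑ k, V k z) x y =
      fun z => ∑ k, compIntegrand K₁ K₂ (V k) x y z := funext (compIntegrand_sum K₁ K₂ V x y)
  rw [this]
  exact integrable_finsetSum _ fun k _ => hint k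

theorem compKernel_sum (x y : X) (hint : ∀ k, Integrable (compIntegrand K₁ K₂ (V k) x y) μ) :
    compKernel μ K₁ K₂ (fun z => ∑ k, V k z) x y = ∑ k, compKernel μ K₁ K₂ (V k) x y := by
  simp only [compKernel, compIntegrand_sum]
  exact integral_finsetSum _ fun k _ => hint k

end

section

variable {X : Type*} [MetricSpace X] [MeasurableSpace X] {ν : ℕ} {μ : Measure X}
  {R : ℝ} {C : ℝ≥0∞} {α₁ α₂ : ℝ} {q₁ q₂ : ℝ≥0∞} {K₁ K₂ : X → X → ℂ} {ι : Type*} [Fintype ι]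
  {p s : ι → ℝ≥0∞} {V : ι → X → ℂ} {x₀ y₀ : X}

/-- Continuity of the composition at a point, in one variable or in both. The values of the
kernels at `z = x₀` and `z = y₀` do not matter, since points are null sets. -/
theorem continuousAt_compKernel_sum [BorelSpace X]
    (h : UniformVolumeGrowth ν μ R C) (hK₁ : MemKernelClass ν μ α₁ q₁ K₁)
    (hK₂ : MemKernelClass ν μ α₂ q₂ K₂)
    (hps : ∀ k, AdmissibleExponents ν α₁ α₂ q₁ q₂ (p k) (s k)) (hV : ∀ k, MemLp (V k) (p k) μ)
    (htail : ∀ k, UniformlySmallTails μ K₁ K₂ (V k))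
    (hc : ∀ k c, LocallyControlled μ K₁ K₂ (V k) x₀ y₀ c) :
    ((∀ᵐ z ∂μ, ContinuousOn (fun x => K₁ x z) {z}ᶜ) →
      ContinuousAt (fun x => compKernel μ K₁ K₂ (fun z => ∑ k, V k z) x y₀) x₀) ∧
    ((∀ᵐ z ∂μ, ContinuousOn (fun y => K₂ z y) {z}ᶜ) →
      ContinuousAt (fun y => compKernel μ K₁ K₂ (fun z => ∑ k, V k z) x₀ y) y₀) ∧
    ((∀ᵐ z ∂μ, ContinuousOn (fun x => K₁ x z) {z}ᶜ ∧ ContinuousOn (fun y => K₂ z y) {z}ᶜ) →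
      ContinuousAt (fun w : X × X => compKernel μ K₁ K₂ (fun z => ∑ k, V k z) w.1 w.2)
        (x₀, y₀)) := by
  have hint : ∀ᶠ w : X × X in 𝓝 (x₀, y₀),
      ∀ k, Integrable (compIntegrand K₁ K₂ (V k) w.1 w.2) μ :=
    eventually_all.2 fun k => eventually_integrable_compIntegrand h hK₁ hK₂ (hps k) (hV k)
      (hc k x₀) (hc k y₀)
  have key : ∀ {T : Type _} [TopologicalSpace T] [FirstCountableTopology T] {t₀ : T}
      {f : T → X × X}, ContinuousAt f t₀ → f t₀ = (x₀, y₀) →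
      (∀ᵐ z ∂μ, Tendsto (fun t => K₁ (f t).1 z * K₂ z (f t).2) (𝓝 t₀)
        (𝓝 (K₁ x₀ z * K₂ z y₀))) →
      Tendsto (fun t => compKernel μ K₁ K₂ (fun z => ∑ k, V k z) (f t).1 (f t).2) (𝓝 t₀)
        (𝓝 (compKernel μ K₁ K₂ (fun z => ∑ k, V k z) x₀ y₀)) := by
    intro T _ _ t₀ f hf h0 hlim
    rw [ContinuousAt, h0] at hf
    rw [compKernel_sum _ _ hint.self_of_nhds]
    refine (tendsto_finsetSum _ fun k _ => tendsto_compKernel h hK₁ hK₂ (hps k) (hV k) (htail k)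
      (hc k x₀) (hc k y₀) hf hlim).congr' ?_
    filter_upwards [hf.eventually hint] with t ht
    rw [compKernel_sum _ _ ht]
  have hx₀ : ∀ᵐ z ∂μ, x₀ ∈ ({z} : Set X)ᶜ := by
    filter_upwards [measure_eq_zero_iff_ae_notMem.1 (h.measure_singleton x₀)] with z hz
    exact fun hzx => hz hzx.symm
  have hy₀ : ∀ᵐ z ∂μ, y₀ ∈ ({z} : Set X)ᶜ := by
    filter_upwards [measure_eq_zero_iff_ae_notMem.1 (h.measure_singleton y₀)] with z hz
    exact fun hzy => hz hzy.symm
  refine ⟨fun hK => ?_, fun hK => ?_, fun hK => ?_⟩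
  · refine key (f := fun x => (x, y₀)) (by fun_prop) rfl ?_
    filter_upwards [hK, hx₀] with z hz hzx
    exact (hz.continuousAt (isOpen_compl_singleton.mem_nhds hzx)).tendsto.mul_const _
  · refine key (f := fun y => (x₀, y)) (by fun_prop) rfl ?_
    filter_upwards [hK, hy₀] with z hz hzy
    exact (hz.continuousAt (isOpen_compl_singleton.mem_nhds hzy)).tendsto.const_mul _
  · refine key (f := fun w => w) continuousAt_id rfl ?_
    filter_upwards [hK, hx₀, hy₀] with z hz hzx hzy
    exact ((hz.1.continuousAt (isOpen_compl_singleton.mem_nhds hzx)).tendsto.comp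
      (continuous_fst.tendsto (x₀, y₀))).mul ((hz.2.continuousAt
      (isOpen_compl_singleton.mem_nhds hzy)).tendsto.comp (continuous_snd.tendsto (x₀, y₀)))

end

/-! ### Composition on manifolds of bounded geometry -/

theorem BoundedGeometry.exists_uniformVolumeGrowth {ν : ℕ} {X : Type*} [MetricSpace X]
    [CompleteSpace X] [ConnectedSpace X] [MeasurableSpace X] [BorelSpace X]
    [ChartedSpace (EuclideanSpace ℝ (Fin ν)) X] [IsManifold (𝓡 ν) ∞ X]
    [RiemannianBundle (fun x : X => TangentSpace (𝓡 ν) x)]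
    [IsContMDiffRiemannianBundle (𝓡 ν) ∞ (EuclideanSpace ℝ (Fin ν))
      (fun x : X => TangentSpace (𝓡 ν) x)]
    [IsRiemannianManifold (𝓡 ν) X]
    (hX : BoundedGeometry ν X) (hν : 0 < ν) :
    ∃ R C, UniformVolumeGrowth ν (riemannianVolume ν X) R C := by
  obtain ⟨R, hR, C, hC, hle⟩ := hX.exists_volume_ball_le
  exact ⟨min R 1, C, hν, lt_min hR one_pos, min_le_right _ _, hC,
    fun x s hs hsR => hle x s hs (hsR.trans (min_le_left _ _)), hX.volume_ball_lt_top⟩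

theorem lemma2p2 {ν : ℕ} {X : Type*} [MetricSpace X] [CompleteSpace X] [ConnectedSpace X]
    [MeasurableSpace X] [BorelSpace X]
    [ChartedSpace (EuclideanSpace ℝ (Fin ν)) X] [IsManifold (𝓡 ν) ∞ X]
    [RiemannianBundle (fun x : X => TangentSpace (𝓡 ν) x)]
    [IsContMDiffRiemannianBundle (𝓡 ν) ∞ (EuclideanSpace ℝ (Fin ν))
      (fun x : X => TangentSpace (𝓡 ν) x)]
    [IsRiemannianManifold (𝓡 ν) X]
    (hX : BoundedGeometry ν X)
    (μ : Measure X) (hμ : μ = riemannianVolume ν X)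
    {α₁ α₂ : ℝ} {q₁ q₂ : ℝ≥0∞} {K₁ K₂ : X → X → ℂ}
    (hK₁ : MemKernelClass ν μ α₁ q₁ K₁) (hK₂ : MemKernelClass ν μ α₂ q₂ K₂)
    {n : ℕ} (hn : 0 < n) (p : Fin n → ℝ≥0∞) (Wk : Fin n → X → ℂ)
    (hWk : ∀ k, MemLp (Wk k) (p k) μ)
    (W : X → ℂ) (hW : W = fun z => ∑ k, Wk k z)
    (ha : (⨆ k, p k)⁻¹ + q₁⁻¹ + q₂⁻¹ = 1)
    (hb₀ : α₁ = 0 ∧ α₂ = 0 → 1 ≤ ⨅ k, p k)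
    (hb₁ : ¬ (α₁ = 0 ∧ α₂ = 0) → ENNReal.ofReal (ν / (ν - max α₁ α₂)) < ⨅ k, p k)
    (F : X → X → X → ℂ) (hF : F = compIntegrand K₁ K₂ W)
    (J : X → X → ℂ) (hJ : J = compKernel μ K₁ K₂ W)
    (α : ℝ)
    (hα : α = max 0 (⨆ k, (α₁ + α₂ - ((ν : ℝ≥0∞) / (p k).conjExponent).toReal))) :
    -- (1)
    (∀ x y, x ≠ y → Integrable (F x y) μ) ∧
    -- (2)
    ((∀ k, (p k).conjExponent * ENNReal.ofReal (α₁ + α₂) ≠ ν) →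
      MemKernelClass ν μ α ⊤ J ∧ (α = 0 → ∀ x y, Integrable (F x y) μ)) ∧
    ((∃ k, (p k).conjExponent * ENNReal.ofReal (α₁ + α₂) = ν) →
      (0 < α → MemKernelClass ν μ α ⊤ J) ∧
      (α = 0 → ∀ β : ℝ, 0 < β → β < ν → MemKernelClass ν μ β ⊤ J)) ∧
    -- (3)
    ((⨆ k, p k) < ⊤ ∨ MemKernelClassZero ν μ α₁ q₁ K₁ ∨ MemKernelClassZero ν μ α₂ q₂ K₂ →
      ((∀ᵐ z ∂μ, ContinuousOn (fun x => K₁ x z) {z}ᶜ) →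
        ∀ y, ContinuousOn (fun x => J x y) {y}ᶜ) ∧
      ((∀ᵐ z ∂μ, ContinuousOn (fun y => K₂ z y) {z}ᶜ) →
        ∀ x, ContinuousOn (fun y => J x y) {x}ᶜ) ∧
      ((∀ᵐ z ∂μ, ContinuousOn (fun x => K₁ x z) {z}ᶜ ∧ ContinuousOn (fun y => K₂ z y) {z}ᶜ) →
        ContinuousOn (fun w : X × X => J w.1 w.2) {w | w.1 ≠ w.2})) ∧
    -- (4)
    (α₁ + α₂ < ν →
      (α₁ + α₂ ≠ 0 → ∃ q : ℝ≥0∞, ENNReal.ofReal (ν / (ν - α₁ - α₂)) < q ∧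
        ∀ k, ∀ s : Set X, IsCompact s → MemLp (Wk k) q (μ.restrict s)) →
      (∀ x y, Integrable (F x y) μ) ∧
      ((⨆ k, p k) < ⊤ ∨ MemKernelClassZero ν μ α₁ q₁ K₁ ∨ MemKernelClassZero ν μ α₂ q₂ K₂ →
        ((∀ᵐ z ∂μ, ContinuousOn (fun x => K₁ x z) {z}ᶜ) → ∀ y, Continuous fun x => J x y) ∧
        ((∀ᵐ z ∂μ, ContinuousOn (fun y => K₂ z y) {z}ᶜ) → ∀ x, Continuous fun y => J x y) ∧
        ((∀ᵐ z ∂μ, ContinuousOn (fun x => K₁ x z) {z}ᶜ ∧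
            ContinuousOn (fun y => K₂ z y) {z}ᶜ) →
          Continuous fun w : X × X => J w.1 w.2))) := by
  subst hμ hW hF hJ
  have hν : 0 < ν := by exact_mod_cast hK₁.exponent_nonneg.trans_lt hK₁.exponent_lt
  obtain ⟨R, C, h⟩ := hX.exists_uniformVolumeGrowth hν
  have := hX.properSpace
  have := h.isLocallyFiniteMeasure
  have : Nonempty (Fin n) := ⟨⟨0, hn⟩⟩
  have hα₁ := hK₁.exponent_nonneg
  have hα₂ := hK₂.exponent_nonneg
  have hp : ∀ k, AdmissibleExponents ν α₁ α₂ q₁ q₂ (p k) (p k).conjExponent := fun k =>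
    admissibleExponents_conjExponent hα₁ hK₁.exponent_lt hK₂.exponent_lt (le_iSup p k) ha
      (fun h0 => (hb₀ h0).trans (iInf_le p k)) fun h0 => (hb₁ h0).trans_le (iInf_le p k)
  have hWm := aestronglyMeasurable_sum_of_memLp hWk
  have hα0 : 0 ≤ α := hα ▸ le_max_left _ _
  have hαk : ∀ k, α₁ + α₂ - ((ν : ℝ≥0∞) / (p k).conjExponent).toReal ≤ α := fun k =>
    hα ▸ (le_ciSup (f := fun k => α₁ + α₂ - ((ν : ℝ≥0∞) / (p k).conjExponent).toReal)
      (Set.finite_range _).bddAbove k).trans (le_max_right _ _)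
  have hαν : α < ν := by
    obtain ⟨k, hk⟩ := exists_eq_ciSup_of_finite
      (f := fun k => α₁ + α₂ - ((ν : ℝ≥0∞) / (p k).conjExponent).toReal)
    rw [hα, ← hk]
    exact max_lt (by exact_mod_cast hν) ((hp k).add_sub_lt hν hα₁ hα₂ hK₁.exponent_lt)
  have hclass : ∀ {γ : ℝ}, α ≤ γ → γ < ν →
      (γ = 0 → ∀ k, (p k).conjExponent * ENNReal.ofReal (α₁ + α₂) ≠ ν) →
      MemKernelClass ν (riemannianVolume ν X) γ ⊤
        (compKernel (riemannianVolume ν X) K₁ K₂ fun z => ∑ k, Wk k z) := by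
    intro γ hγ hγν hne
    obtain ⟨D, hD, hle⟩ := h.exists_lintegral_sum_le hK₁ hK₂ hp hWk (hα0.trans hγ)
      (fun k => (hαk k).trans hγ) hne
    exact memKernelClass_compKernel hK₁ hK₂ hWm (hα0.trans hγ) hγν hD hle
  have htail : (⨆ k, p k) < ⊤ ∨ MemKernelClassZero ν (riemannianVolume ν X) α₁ q₁ K₁ ∨
      MemKernelClassZero ν (riemannianVolume ν X) α₂ q₂ K₂ →
      ∀ k, UniformlySmallTails (riemannianVolume ν X) K₁ K₂ (Wk k) := by
    intro hz k
    by_cases hk : p k = ⊤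
    · have hsup : (⨆ k, p k) = ⊤ := top_le_iff.1 (hk ▸ le_iSup p k)
      exact h.uniformlySmallTails_of_zero hK₁ hK₂ (hz.resolve_left (by simp [hsup]))
        (by simpa [hsup] using ha) (hk ▸ hWk k)
    · exact uniformlySmallTails_of_ne_top hK₁ hK₂ (hp k) hk (hWk k)
  have hint : ∀ {x y : X},
      (∀ k c, LocallyControlled (riemannianVolume ν X) K₁ K₂ (Wk k) x y c) →
      Integrable (compIntegrand K₁ K₂ (fun z => ∑ k, Wk k z) x y) (riemannianVolume ν X) :=
    fun {x y} hc => integrable_compIntegrand_sum x y fun k =>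
      (eventually_integrable_compIntegrand h hK₁ hK₂ (hp k) (hWk k) (hc k x)
        (hc k y)).self_of_nhds
  have hoff : ∀ {x y : X}, x ≠ y →
      ∀ k c, LocallyControlled (riemannianVolume ν X) K₁ K₂ (Wk k) x y c :=
    fun hxy k c => h.locallyControlled_of_ne hK₁ hK₂ (hp k) (hWk k) hxy c
  refine ⟨fun x y hxy => hint (hoff hxy), fun hne => ⟨hclass le_rfl hαν fun _ => hne, ?_⟩,
    fun _ => ⟨fun h0 => hclass le_rfl hαν fun h0' => absurd h0' h0.ne', fun h0 β hβ hβν =>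
      hclass (h0.trans_le hβ.le) hβν fun h0' => absurd h0' hβ.ne'⟩, fun hz => ?_,
    fun hlt hq => ?_⟩
  · intro h0 x y
    obtain ⟨D, hD, hle⟩ := h.exists_lintegral_sum_le hK₁ hK₂ hp hWk hα0 hαk fun _ => hne
    refine ⟨aestronglyMeasurable_compIntegrand hK₁ hK₂ hWm x y, ?_⟩
    rw [hasFiniteIntegral_iff_enorm]
    exact (hle x y fun hpos => absurd h0 hpos.ne').trans_lt (by finiteness)
  · have hcont := fun {x y : X} (hxy : x ≠ y) =>
      continuousAt_compKernel_sum h hK₁ hK₂ hp hWk (htail hz) (hoff hxy)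
    exact ⟨fun hK y x hxy => ((hcont hxy).1 hK).continuousWithinAt,
      fun hK x y hxy => ((hcont (Ne.symm hxy)).2.1 hK).continuousWithinAt,
      fun hK w hw => ((hcont hw).2.2 hK).continuousWithinAt⟩
  · have hc : ∀ (x y : X) k c, LocallyControlled (riemannianVolume ν X) K₁ K₂ (Wk k) x y c :=
      fun x y k c => h.locallyControlled_of_locally_memLp hK₁ hK₂ (hp k) (hWk k) hlt
        (fun h0 => (hq h0).imp fun q hq => ⟨hq.1, hq.2 k⟩) x y c
    refine ⟨fun x y => hint (hc x y), fun hz => ?_⟩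
    have hcont := fun (x y : X) =>
      continuousAt_compKernel_sum h hK₁ hK₂ hp hWk (htail hz) (hc x y)
    exact ⟨fun hK y => continuous_iff_continuousAt.2 fun x => (hcont x y).1 hK,
      fun hK x => continuous_iff_continuousAt.2 fun y => (hcont x y).2.1 hK,
      fun hK => continuous_iff_continuousAt.2 fun w => (hcont w.1 w.2).2.2 hK⟩
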